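/- Let $d\ge 1$. For $\Delta x>0$, identify a function on $\mathbb R^d$ that is constant on the cells of the grid $\Delta x\,\mathbb Z^d$ with the family $(f_\alpha)_{\alpha\in\mathbb Z^d}$ of its values, and put $x_\alpha=\alpha\Delta x$, $\|f\|_{L^p}=(\sum_\alpha|f_\alpha|^p\Delta x^d)^{1/p}$ for $p<\infty$, $\|f\|_{L^\infty}=\sup_\alpha|f_\alpha|$, and let $L^p_{\Delta x}$ be the space of bounded families with $\|f\|_{L^p}<\infty$. Put $\nabla_+^jf_\alpha=(f_{\alpha+e_j}-f_\alpha)/\Delta x$ and $\nabla_-^jf_\alpha=(f_\alpha-f_{\alpha-e_j})/\Delta x$. Let $c=(c_\alpha^j)$, $\alpha\in\mathbb Z^d$, $1\le j\le d$, satisfy $0<c_{\min}\le c^j_\alpha\le c_{\max}$ and $|c^j_\alpha-c^j_\beta|\le L|x_\alpha-x_\beta|$ for all $\alpha,\beta,j$. Let $p,q\in(0,\infty]$ satisfy $p>d$ and $\frac1q+\frac d{2p}<1$ (with $1/\infty=0$). A fundamental solution on $[0,T]$, $T\in(0,\infty)$, is a map $\Gamma\in C^1([0,T];\ell^\infty(\mathbb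 Z^d\times\mathbb Z^d))$ with $\frac{d}{dt}\Gamma_{\alpha,\beta}=\sum_jc^j_\alpha\nabla^j_+\nabla^j_-\Gamma_{\alpha,\beta}$ (differences in $\alpha$) for $t>0$ and $\Gamma_{\alpha,\beta}(0)=\Delta x^{-d}\mathbf 1_{\alpha=\beta}$. (i) A fundamental solution on $[0,T]$ exists. Let $\Gamma$ be any fundamental solution on $[0,T]$, and let $f\in L^q([0,T];L^p_{\Delta x})$ and $\psi\in L^\infty_{\Delta x}$. Then the sums and the integral in $$u_\alpha(t)=\sum_{\eta\in\mathbb Z^d}\Gamma_{\alpha,\eta}(t)\psi_\eta\,\Delta x^d+\int_0^t\sum_{\eta\in\mathbb Z^d}\Gamma_{\alpha,\eta}(t-s)f_\eta(s)\,\Delta x^d\,ds,\qquad t\in[0,T],\ \alpha\in\mathbb Z^d,$$ converge absolutely (the sum under the integral for almost every $s$), and this formula gives the unique solution on $[0,T]$ of $$\frac{d}{dt}u_\alpha-\sum_{j=1}^dc_\alpha^j\nabla_+^j\nabla_-^ju_\alpha=f_\alpha,\qquad u_\alpha(0)=\psi_\alpha,$$ where a solution is bounded on $[0,T]\times\mathbb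 Z^d$, each $u_\alpha$ is absolutely continuous on $[0,T]$, and the equation holds for almost every $t$. (ii) Let $Y\in L^p_{\Delta x}$, let $f\in L^p_{\Delta x}+L^\infty_{\Delta x}$ be independent of time, and let $\psi\in L^\infty_{\Delta x}$ with $\nabla^j_+\nabla^j_-\psi\in L^\infty_{\Delta x}$ for all $j$. Then the Cauchy problem $$\frac{d}{dt}u_\alpha-\sum_{j=1}^dc^j_\alpha\nabla^j_+\nabla^j_-u_\alpha+Y_\alpha u_\alpha=f_\alpha\quad(\alpha\in\mathbb Z^d,\ t>0),\qquad u(0)=\psi,$$ has a unique solution among the families $u$ that are bounded on $[0,T]\times\mathbb Z^d$ for every $T<\infty$, with each $u_\alpha$ continuous on $[0,\infty)$ and differentiable on $(0,\infty)$. If $f\ge0$ and $\psi\ge0$, then $u\ge0$ on $[0,\infty)\times\mathbb Z^d$. Moreover, for every $T\in(0,\infty)$ and all $j$, $$\sup_{t\in[0,T]}\|u(t)\|_{L^\infty}\le C\,(1+\|\psi\|_{L^\infty}),\qquad \sup_{t\in[0,T]}\|\nabla^j_\pm u(t)\|_{L^\infty}\le C\,\bigl(1+\|\psi\|_{L^\infty}+\max_k\|\nabla^k_+\nabla^k_-\psi\|_{L^\infty}\bigr),$$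 where $C$ depends only on $d$, $p$, $T$, $c_{\min}$, $c_{\max}$, $L$ and on upper bounds for $\|Y\|_{L^p}$ and $\|f\|_{L^p+L^\infty}=\inf\{\|g\|_{L^p}+\|h\|_{L^\infty}: f=g+h\}$. In particular $C$ does not depend on $\Delta x$, nor (beyond the bound on $\|Y\|_{L^p}$) on $\|Y\|_{L^\infty}$. -/

import Mathlib

open scoped ENNReal NNReal
open MeasureTheory Set

/-- Multi-indices `α ∈ ℤ^d`. A grid function (piecewise constant on the cells of the grid `Δx ℤ^d`)
is identified with the family `α ↦ f α` of its cell values. -/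
abbrev Grid (d : ℕ) : Type := Fin d → ℤ

namespace SemiDiscrete

/-- The grid point `x_α = α Δx` of `ℝ^d`. -/
noncomputable def gridPoint {d : ℕ} (Δx : ℝ) (α : Grid d) : EuclideanSpace ℝ (Fin d) :=
  WithLp.toLp 2 (fun j => (α j : ℝ) * Δx)

/-- The forward difference `∇₊ʲ f`. -/
noncomputable def gradPlus {d : ℕ} (Δx : ℝ) (j : Fin d) (f : Grid d → ℝ) (α : Grid d) : ℝ :=
  (f (α + Pi.single j 1) - f α) / Δx

/-- The backward difference `∇₋ʲ f`. -/
noncomputable def gradMinus {d : ℕ} (Δx : ℝ) (j : Fin d) (f : Grid d → ℝ) (α : Grid d) : ℝ :=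
  (f α - f (α - Pi.single j 1)) / Δx

/-- The operator `u ↦ ∑ⱼ cʲ_α ∇₊ʲ ∇₋ʲ u_α`. -/
noncomputable def ellipticOp {d : ℕ} (Δx : ℝ) (c : Grid d → Fin d → ℝ) (u : Grid d → ℝ)
    (α : Grid d) : ℝ :=
  ∑ j, c α j * gradPlus Δx j (gradMinus Δx j u) α

/-- Each multi-index carries the volume `Δx^d` of its cell. Hence `eLpNorm f p (gridMeasure d Δx)` is
`(∑_α |f_α|^p Δx^d)^{1/p}` for `p < ∞` and `sup_α |f_α|` for `p = ∞`. -/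
noncomputable def gridMeasure (d : ℕ) (Δx : ℝ) : Measure (Grid d) :=
  ENNReal.ofReal (Δx ^ d) • Measure.count

/-- Membership in `L^p_{Δx}(ℝ^d) = L^∞_{Δx}(ℝ^d) ∩ L^p(ℝ^d)`. -/
def MemLpGrid {d : ℕ} (Δx : ℝ) (p : ℝ≥0∞) (f : Grid d → ℝ) : Prop :=
  MemLp f ∞ (gridMeasure d Δx) ∧ MemLp f p (gridMeasure d Δx)

/-- Membership in `L^p_{Δx}(ℝ^d) + L^∞_{Δx}(ℝ^d)`. -/
def MemLpAddLinfty {d : ℕ} (Δx : ℝ) (p : ℝ≥0∞) (f : Grid d → ℝ) : Prop :=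
  ∃ g h : Grid d → ℝ, MemLpGrid Δx p g ∧ MemLpGrid Δx ∞ h ∧ f = g + h

/-- The norm of `L^p(ℝ^d) + L^∞(ℝ^d)`: the infimum of `‖g‖_p + ‖h‖_∞` over all splittings
`f = g + h`. -/
noncomputable def sumNorm {d : ℕ} (Δx : ℝ) (p : ℝ≥0∞) (f : Grid d → ℝ) : ℝ≥0∞ :=
  ⨅ (g : Grid d → ℝ) (h : Grid d → ℝ) (_ : f = g + h),
    eLpNorm g p (gridMeasure d Δx) + eLpNorm h ∞ (gridMeasure d Δx)

/-- Membership in `L^q([0,T]; L^p_{Δx}(ℝ^d))`. -/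
structure MemLqLpGrid {d : ℕ} (Δx T : ℝ) (q p : ℝ≥0∞) (f : ℝ → Grid d → ℝ) : Prop where
  measurable : ∀ α, AEStronglyMeasurable (fun t => f t α) (volume.restrict (Icc 0 T))
  mem : ∀ᵐ t ∂(volume.restrict (Icc 0 T)), MemLpGrid Δx p (f t)
  norm_lt_top :
    eLpNorm (fun t => eLpNorm (f t) p (gridMeasure d Δx)) q (volume.restrict (Icc 0 T)) < ∞

/-- The assumptions on the coefficients: they lie between `cmin` and `cmax` and are Lipschitz on the
grid with constant `L`. -/
structure IsCoefficient {d : ℕ} (Δx cmin cmax L : ℝ) (c : Grid d → Fin d → ℝ) : Prop where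
  lower : ∀ α j, cmin ≤ c α j
  upper : ∀ α j, c α j ≤ cmax
  lipschitz : ∀ α β j, |c α j - c β j| ≤ L * dist (gridPoint Δx α) (gridPoint Δx β)

/-- The discrete Dirac measure `δ_α = Δx^{-d} 1_{α = 0}`. -/
noncomputable def dirac {d : ℕ} (Δx : ℝ) (α : Grid d) : ℝ :=
  if α = 0 then (Δx ^ d)⁻¹ else 0

/-- Fundamental solution: a map `Γ ∈ C¹([0,T]; L^∞_{Δx}(ℝ^d × ℝ^d))` (bounded families indexed by
pairs `(α, β)`) which solves the homogeneous equation in `α` with datum `δ_{α-β}`. -/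
structure IsFundamentalSolution {d : ℕ} (Δx T : ℝ) (c : Grid d → Fin d → ℝ)
    (Γ : ℝ → lp (fun _ : Grid d × Grid d => ℝ) ∞) : Prop where
  contDiffOn : ContDiffOn ℝ 1 Γ (Icc 0 T)
  equation : ∀ t ∈ Ioc 0 T, ∀ α β,
    HasDerivWithinAt (fun s => Γ s (α, β))
      (ellipticOp Δx c (fun η => Γ t (η, β)) α) (Icc 0 T) t
  initial : ∀ α β, Γ 0 (α, β) = dirac Δx (α - β)

/-- A bounded solution on `[0,T]` of `u' - ∑ⱼ cʲ ∇₊ʲ ∇₋ʲ u = f`, `u(0) = ψ`. As `f` is only integrable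
in time, every component is absolutely continuous and the equation holds at almost every time. -/
structure IsHeatSolution {d : ℕ} (Δx T : ℝ) (c : Grid d → Fin d → ℝ) (f : ℝ → Grid d → ℝ)
    (ψ : Grid d → ℝ) (u : ℝ → Grid d → ℝ) : Prop where
  bounded : ∃ M : ℝ, ∀ t ∈ Icc 0 T, ∀ α, |u t α| ≤ M
  absolutelyContinuous : ∀ α, AbsolutelyContinuousOnInterval (fun t => u t α) 0 T
  equation : ∀ α, ∀ᵐ t ∂(volume.restrict (Ioo 0 T)),
    HasDerivAt (fun s => u s α) (ellipticOp Δx c (u t) α + f t α) t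
  initial : ∀ α, u 0 α = ψ α

/-- The Duhamel formula with kernel `Γ`. -/
noncomputable def duhamel {d : ℕ} (Δx : ℝ) (Γ : ℝ → lp (fun _ : Grid d × Grid d => ℝ) ∞)
    (f : ℝ → Grid d → ℝ) (ψ : Grid d → ℝ) (t : ℝ) (α : Grid d) : ℝ :=
  (∑' η, Γ t (α, η) * ψ η * Δx ^ d)
    + ∫ s in (0 : ℝ)..t, ∑' η, Γ (t - s) (α, η) * f s η * Δx ^ d

/-- The sums and the integral in the Duhamel formula converge absolutely at `(t, α)`. -/
structure DuhamelConverges {d : ℕ} (Δx : ℝ) (Γ : ℝ → lp (fun _ : Grid d × Grid d => ℝ) ∞)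
    (f : ℝ → Grid d → ℝ) (ψ : Grid d → ℝ) (t : ℝ) (α : Grid d) : Prop where
  summable_initial : Summable (fun η => Γ t (α, η) * ψ η * Δx ^ d)
  summable_source : ∀ᵐ s ∂(volume.restrict (Ioo 0 t)),
    Summable (fun η => Γ (t - s) (α, η) * f s η * Δx ^ d)
  integrable_source :
    IntervalIntegrable (fun s => ∑' η, Γ (t - s) (α, η) * f s η * Δx ^ d) volume 0 t

/-- A solution on `[0,∞)` of `u' - ∑ⱼ cʲ ∇₊ʲ ∇₋ʲ u + Y u = f`, `u(0) = ψ`, that is bounded on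
`[0,T] × ℝ^d` for every finite `T`. -/
structure IsCauchySolution {d : ℕ} (Δx : ℝ) (c : Grid d → Fin d → ℝ) (Y f ψ : Grid d → ℝ)
    (u : ℝ → Grid d → ℝ) : Prop where
  bounded : ∀ T : ℝ, ∃ M : ℝ, ∀ t ∈ Icc 0 T, ∀ α, |u t α| ≤ M
  continuousOn : ∀ α, ContinuousOn (fun t => u t α) (Ici 0)
  equation : ∀ α, ∀ t : ℝ, 0 < t →
    HasDerivAt (fun s => u s α) (ellipticOp Δx c (u t) α - Y α * u t α + f α) t
  initial : ∀ α, u 0 α = ψ α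

end SemiDiscrete

open SemiDiscrete

set_option linter.unusedSectionVars false

/-! For fixed `Δx` the operator `heatGen` is bounded on bounded grid functions, so existence,
uniqueness and Duhamel's formula are statements about exponentials of bounded operators. The
exponential is positive because the generator plus a large constant is positive (`evol_nonneg`), and
it fixes constants; hence it is a contraction in the supremum norm. Running the transposed generator
on summable functions shows that the semigroup acts through a matrix whose rows `heatRow` are
probability vectors. Bounded solutions are unique by iterating the integral inequality
(`eq_zero_of_deriv_le`), so every fundamental solution is `heatRow` divided by `Δx ^ d`. For a
source that is merely integrable in time, the integrated equation is obtained by Fubini on the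
triangle `s < r` (`response_eq_integral`).

The substance of (ii) is that the bounds do not see `Δx`. Three estimates carry this.

Gradient: by Bernstein's method, `K u² + (a + b t) |∇₊u|²` is a subsolution, since the dissipation
in the equation for squares absorbs the commutator with the Lipschitz coefficients. This gives `‖∇₊
S(t) ψ‖ ≤ C t^(-1/2) ‖ψ‖` and propagates gradient bounds (`exists_gradient_bound`).

Smoothing: a discrete Nash inequality and the energy inequality for the rows, whose `ℓ¹` norm is 1,
give `∑ w² ≤ C Δx^d t^(-d/2)`. Jensen's inequality for the probability vector `w` and Cauchy–Schwarz
then give `‖S(t) G‖_∞ ≤ C t^(-a) ‖G‖_p` with `a = d/(2p) < 1/2`. This needs `p > 2`, which follows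
from `p > d` if `d ≥ 2`; for `d = 1` reversibility of the kernel gives a pointwise bound that serves
every `p > 1` (`exists_smoothing_bound`).

Closing: the potential is moved into the source, `u = S(t) ψ + ∫ S(t-s)(f - Y u)`. The kernel
`(t-s)^(-a)` is handled by a singular Gronwall inequality, which bounds `u` through `‖Y‖_p` alone.
For the gradient each `S(t-s)` is halved, one half for smoothing and one for differentiating; the
resulting exponent `1/2 + a < 1` is integrable. The gradient of the datum is interpolated between
the datum and its second differences. -/

namespace SemiDiscrete

/-! ### Exponentials of bounded operators -/

section Evolution

variable {E F : Type*} [NormedAddCommGroup E] [NormedSpace ℝ E] [CompleteSpace E]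
  [NormedAddCommGroup F] [NormedSpace ℝ F] [CompleteSpace F]

/-- The group `exp (t B)` generated by a bounded operator `B`. -/
noncomputable def evol (B : E →L[ℝ] E) (t : ℝ) : E →L[ℝ] E := NormedSpace.exp (t • B)

@[simp] lemma evol_zero (B : E →L[ℝ] E) : evol B 0 = 1 := by simp [evol]

lemma hasDerivAt_evol (B : E →L[ℝ] E) (t : ℝ) : HasDerivAt (evol B) (B * evol B t) t :=
  hasDerivAt_exp_smul_const' B t

lemma hasDerivAt_evol' (B : E →L[ℝ] E) (t : ℝ) : HasDerivAt (evol B) (evol B t * B) t :=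
  hasDerivAt_exp_smul_const B t

lemma continuous_evol (B : E →L[ℝ] E) : Continuous (evol B) :=
  continuous_iff_continuousAt.2 fun t => (hasDerivAt_evol B t).continuousAt

lemma evol_gen_comm (B : E →L[ℝ] E) (t : ℝ) (x : E) : evol B t (B x) = B (evol B t x) := by
  have := (hasDerivAt_evol' B t).unique (hasDerivAt_evol B t)
  exact congrArg (fun T : E →L[ℝ] E => T x) this

lemma evol_add (B : E →L[ℝ] E) (s t : ℝ) : evol B (s + t) = evol B s * evol B t := by
  let _ : NormedAlgebra ℚ (E →L[ℝ] E) := NormedAlgebra.restrictScalars ℚ ℝ _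
  rw [evol, add_smul, NormedSpace.exp_add_of_commute]
  · rfl
  · exact ((Commute.refl B).smul_left s).smul_right t

lemma evol_add_apply (B : E →L[ℝ] E) (s t : ℝ) (x : E) :
    evol B (s + t) x = evol B s (evol B t x) := by
  rw [evol_add]; rfl

lemma hasDerivAt_evol_apply (B : E →L[ℝ] E) (x : E) (t : ℝ) :
    HasDerivAt (fun s => evol B s x) (B (evol B t x)) t := by
  simpa using (hasDerivAt_evol B t).clm_apply (hasDerivAt_const t x)

lemma continuous_evol_apply (B : E →L[ℝ] E) (x : E) : Continuous fun t => evol B t x :=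
  continuous_iff_continuousAt.2 fun t => (hasDerivAt_evol_apply B x t).continuousAt

/-- The basic interpolation device: along `r ↦ exp((t-r)B) G(r)` the derivative only sees the defect
`G' - B G`. Uniqueness, intertwining, Duhamel's formula and the comparison principle are all read
off by comparing the endpoints `r = 0` and `r = t`. -/
lemma hasDerivAt_evol_sub_apply (B : E →L[ℝ] E) {G : ℝ → E} {G' : E} {s : ℝ} (t : ℝ)
    (hG : HasDerivAt G G' s) :
    HasDerivAt (fun r => evol B (t - r) (G r)) (evol B (t - s) (G' - B (G s))) s := by
  have h1 : HasDerivAt (fun r => evol B (t - r)) (-(evol B (t - s) * B)) s := by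
    have h0 : HasDerivAt (fun r : ℝ => t - r) (-1) s := (hasDerivAt_id s).const_sub t
    have := HasDerivAt.scomp s (hasDerivAt_evol' B (t - s)) h0
    rwa [neg_one_smul] at this
  have h2 := h1.clm_apply hG
  convert h2 using 1
  simp [sub_eq_neg_add]

lemma evol_intertwine (T : E →L[ℝ] F) {B : E →L[ℝ] E} {B' : F →L[ℝ] F}
    (h : ∀ x, T (B x) = B' (T x)) (t : ℝ) (x : E) : T (evol B t x) = evol B' t (T x) := by
  have hd : ∀ s, HasDerivAt (fun r => evol B' (t - r) (T (evol B r x))) 0 s := fun s => by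
    have := hasDerivAt_evol_sub_apply B' t
      (T.hasFDerivAt.comp_hasDerivAt s (hasDerivAt_evol_apply B x s))
    simpa [h] using this
  have := is_const_of_deriv_eq_zero (fun s => (hd s).differentiableAt) (fun s => (hd s).deriv) t 0
  simpa using this

/-- Splitting the time between the two arguments, `r` on the left and `t - r` on the right, gives a
quantity with zero derivative. -/
lemma evol_pairing (P : E →L[ℝ] F →L[ℝ] ℝ) {B : E →L[ℝ] E} {B' : F →L[ℝ] F}
    (h : ∀ x y, P (B x) y = P x (B' y)) (t : ℝ) (x : E) (y : F) :
    P (evol B t x) y = P x (evol B' t y) := by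
  have hd : ∀ s, HasDerivAt (fun r => P (evol B r x) (evol B' (t - r) y)) 0 s := fun s => by
    have h1 := P.hasFDerivAt.comp_hasDerivAt s (hasDerivAt_evol_apply B x s)
    have h2 := hasDerivAt_evol_sub_apply B' t (hasDerivAt_const s y)
    have h3 := h1.clm_apply h2
    simpa [h, evol_gen_comm] using h3
  have := is_const_of_deriv_eq_zero (fun s => (hd s).differentiableAt) (fun s => (hd s).deriv) t 0
  simpa using this

lemma hasSum_evol (B : E →L[ℝ] E) (t : ℝ) (x : E) :
    HasSum (fun n : ℕ => ((n.factorial : ℝ)⁻¹ * t ^ n) • (B ^ n) x) (evol B t x) := by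
  have h := NormedSpace.exp_series_hasSum_exp' (𝕂 := ℝ) (t • B)
  have := h.mapL (ContinuousLinearMap.apply ℝ E x)
  simpa [smul_pow, smul_smul, evol] using this

lemma evol_add_smul_one (B : E →L[ℝ] E) (K t : ℝ) (x : E) :
    evol (B + K • 1) t x = Real.exp (t * K) • evol B t x := by
  have hd : ∀ s, HasDerivAt
      (fun r => evol (B + K • 1) (t - r) (Real.exp (r * K) • evol B r x)) 0 s := fun s => by
    have h1 : HasDerivAt (fun r : ℝ => Real.exp (r * K)) (Real.exp (s * K) * K) s := by
      simpa using ((hasDerivAt_id s).mul_const K).exp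
    have h2 : Real.exp (s * K) • B (evol B s x) + (Real.exp (s * K) * K) • evol B s x
        - (B + K • 1) (Real.exp (s * K) • evol B s x) = 0 := by
      simp [mul_smul]
    have := hasDerivAt_evol_sub_apply (B + K • 1) t
      (G := fun r => Real.exp (r * K) • evol B r x) (h1.smul (hasDerivAt_evol_apply B x s))
    rwa [h2, map_zero] at this
  have := is_const_of_deriv_eq_zero (fun s => (hd s).differentiableAt) (fun s => (hd s).deriv) 0 t
  simpa using this

/-- Duhamel's formula for a differentiable curve. -/
lemma eq_evol_add_integral (B : E →L[ℝ] E) {G G' : ℝ → E} (hG : ∀ s, HasDerivAt G (G' s) s)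
    (hG' : Continuous G') (t : ℝ) :
    G t = evol B t (G 0) + ∫ s in (0 : ℝ)..t, evol B (t - s) (G' s - B (G s)) := by
  have hc : Continuous G := continuous_iff_continuousAt.2 fun s => (hG s).continuousAt
  have hi : Continuous fun s => evol B (t - s) (G' s - B (G s)) :=
    ((continuous_evol B).comp (continuous_const.sub continuous_id)).clm_apply
      (hG'.sub (B.continuous.comp hc))
  rw [intervalIntegral.integral_eq_sub_of_hasDerivAt
    (fun s _ => hasDerivAt_evol_sub_apply B t (hG s)) (hi.intervalIntegrable _ _)]
  simp

end Evolution

/-! ### Bounded grid functions and difference operators -/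

/-- Bounded grid functions with the supremum norm. -/
abbrev BddGrid (d : ℕ) : Type := BoundedContinuousFunction (Grid d) ℝ

variable {d : ℕ}

/-- A bounded family as an element of `BddGrid`. -/
noncomputable def ofBdd (f : Grid d → ℝ) (C : ℝ) (h : ∀ α, |f α| ≤ C) : BddGrid d :=
  BoundedContinuousFunction.ofNormedAddCommGroupDiscrete f C h

@[simp] lemma ofBdd_apply (f : Grid d → ℝ) (C : ℝ) (h : ∀ α, |f α| ≤ C) (α : Grid d) :
    ofBdd f C h α = f α := rfl

/-- Evaluation at a grid point. -/
noncomputable abbrev evalAt (α : Grid d) : BddGrid d →L[ℝ] ℝ :=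
  BoundedContinuousFunction.evalCLM ℝ α

@[simp] lemma evalAt_apply (α : Grid d) (g : BddGrid d) : evalAt α g = g α := rfl

lemma abs_apply_le (g : BddGrid d) (α : Grid d) : |g α| ≤ ‖g‖ := g.norm_coe_le_norm α

lemma norm_le_of_abs_le {g : BddGrid d} {C : ℝ} (h : ∀ α, |g α| ≤ C) : ‖g‖ ≤ C :=
  (BoundedContinuousFunction.norm_le_of_nonempty).2 h

/-- Translation of a bounded grid function. -/
noncomputable def translate (γ : Grid d) : BddGrid d →L[ℝ] BddGrid d :=
  LinearMap.mkContinuous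
    { toFun := fun g => g.compContinuous ⟨fun α => α + γ, continuous_of_discreteTopology⟩
      map_add' := fun _ _ => rfl
      map_smul' := fun _ _ => rfl } 1
    (fun g => by
      rw [one_mul]
      exact norm_le_of_abs_le fun α => abs_apply_le g (α + γ))

@[simp] lemma translate_apply (γ : Grid d) (g : BddGrid d) (α : Grid d) :
    translate γ g α = g (α + γ) := rfl

/-- The unit multi-index `e_j`. -/
abbrev unitVec (j : Fin d) : Grid d := Pi.single j 1

/-- Forward difference as a bounded operator. -/
noncomputable def diffPlus (Δx : ℝ) (j : Fin d) : BddGrid d →L[ℝ] BddGrid d :=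
  Δx⁻¹ • (translate (unitVec j) - 1)

/-- Backward difference as a bounded operator. -/
noncomputable def diffMinus (Δx : ℝ) (j : Fin d) : BddGrid d →L[ℝ] BddGrid d :=
  Δx⁻¹ • (1 - translate (-unitVec j))

lemma diffPlus_apply (Δx : ℝ) (j : Fin d) (g : BddGrid d) (α : Grid d) :
    diffPlus Δx j g α = Δx⁻¹ * (g (α + unitVec j) - g α) := by
  simp [diffPlus]

lemma diffMinus_apply (Δx : ℝ) (j : Fin d) (g : BddGrid d) (α : Grid d) :
    diffMinus Δx j g α = Δx⁻¹ * (g α - g (α - unitVec j)) := by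
  simp [diffMinus, sub_eq_add_neg, mul_add]

lemma gradPlus_coe (Δx : ℝ) (j : Fin d) (g : BddGrid d) :
    gradPlus Δx j g = diffPlus Δx j g := by
  ext α; rw [diffPlus_apply, gradPlus, div_eq_inv_mul]

lemma gradMinus_coe (Δx : ℝ) (j : Fin d) (g : BddGrid d) :
    gradMinus Δx j g = diffMinus Δx j g := by
  ext α; rw [diffMinus_apply, gradMinus, div_eq_inv_mul]

/-- The operator `∑ⱼ cʲ ∇₊ʲ ∇₋ʲ` on bounded grid functions. -/
noncomputable def heatGen (Δx : ℝ) (c : Fin d → BddGrid d) : BddGrid d →L[ℝ] BddGrid d :=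
  ∑ j, ContinuousLinearMap.mul ℝ (BddGrid d) (c j) ∘L diffPlus Δx j ∘L diffMinus Δx j

lemma heatGen_apply (Δx : ℝ) (c : Fin d → BddGrid d) (g : BddGrid d) (α : Grid d) :
    heatGen Δx c g α = ∑ j, c j α * diffPlus Δx j (diffMinus Δx j g) α := by
  simp [heatGen]

lemma second_diff_apply (Δx : ℝ) (j : Fin d) (g : BddGrid d) (α : Grid d) :
    diffPlus Δx j (diffMinus Δx j g) α
      = (Δx⁻¹) ^ 2 * (g (α + unitVec j) + g (α - unitVec j) - 2 * g α) := by
  rw [diffPlus_apply, diffMinus_apply, diffMinus_apply, add_sub_cancel_right]; ring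

lemma heatGen_apply' (Δx : ℝ) (c : Fin d → BddGrid d) (g : BddGrid d) (α : Grid d) :
    heatGen Δx c g α
      = ∑ j, c j α * ((Δx⁻¹) ^ 2 * (g (α + unitVec j) + g (α - unitVec j) - 2 * g α)) := by
  simp_rw [heatGen_apply, second_diff_apply]

lemma heatGen_eq_ellipticOp (Δx : ℝ) (c : Fin d → BddGrid d) (g : BddGrid d) (α : Grid d) :
    heatGen Δx c g α = ellipticOp Δx (fun α j => c j α) g α := by
  simp_rw [heatGen_apply, ellipticOp, gradMinus_coe, gradPlus_coe]

/-! ### Positivity -/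

lemma apply_nonneg_of_pos_pow {T : BddGrid d →L[ℝ] BddGrid d}
    (hT : ∀ g : BddGrid d, (∀ α, 0 ≤ g α) → ∀ α, 0 ≤ T g α) (n : ℕ) :
    ∀ g : BddGrid d, (∀ α, 0 ≤ g α) → ∀ α, 0 ≤ (T ^ n) g α := by
  induction n with
  | zero => intro g hg α; simpa using hg α
  | succ n ih => intro g hg α; rw [pow_succ]; exact ih _ (hT g hg) α

/-- If `B + K` is positive for some number `K`, then `exp (t B)` is positive for `t ≥ 0`. -/
lemma evol_nonneg {B : BddGrid d →L[ℝ] BddGrid d} {K : ℝ}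
    (hB : ∀ g : BddGrid d, (∀ α, 0 ≤ g α) → ∀ α, 0 ≤ B g α + K * g α) {t : ℝ} (ht : 0 ≤ t)
    (g : BddGrid d) (hg : ∀ α, 0 ≤ g α) (α : Grid d) : 0 ≤ evol B t g α := by
  have hpos : ∀ g : BddGrid d, (∀ α, 0 ≤ g α) → ∀ α, 0 ≤ (B + K • 1) g α := fun g hg α => by
    simpa using hB g hg α
  -- Every term of the exponential series of `B + K` is nonnegative; the shift by `K` only costs the
  -- positive factor `exp (t K)`.
  have h := (hasSum_evol (B + K • 1) t g).mapL (evalAt α)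
  have h0 : 0 ≤ evol (B + K • 1) t g α := h.nonneg fun n => by
    have := apply_nonneg_of_pos_pow hpos n g hg α
    simp only [map_smul, smul_eq_mul, evalAt_apply]
    positivity
  rw [evol_add_smul_one] at h0
  exact nonneg_of_mul_nonneg_right h0 (Real.exp_pos (t * K))


/-! ### The semigroup -/

/-- The semigroup generated by `∑ⱼ cʲ ∇₊ʲ ∇₋ʲ`. -/
noncomputable def heat (Δx : ℝ) (c : Fin d → BddGrid d) (t : ℝ) : BddGrid d →L[ℝ] BddGrid d :=
  evol (heatGen Δx c) t

/-- The operator `∑ⱼ cʲ ∇₊ʲ ∇₋ʲ - Y`. -/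
noncomputable def potGen (Δx : ℝ) (c : Fin d → BddGrid d) (Y : BddGrid d) :
    BddGrid d →L[ℝ] BddGrid d :=
  heatGen Δx c - ContinuousLinearMap.mul ℝ (BddGrid d) Y

lemma potGen_apply (Δx : ℝ) (c : Fin d → BddGrid d) (Y g : BddGrid d) :
    potGen Δx c Y g = heatGen Δx c g - Y * g := by
  simp [potGen]

/-- The off-diagonal entries are nonnegative, so only the diagonal has to be compensated. The
constant blows up as `Δx → 0`, which is harmless because it serves only to determine a sign. -/
lemma potGen_add_nonneg (Δx : ℝ) {c : Fin d → BddGrid d} (hc : ∀ j α, 0 ≤ c j α) (Y : BddGrid d)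
    (g : BddGrid d) (hg : ∀ α, 0 ≤ g α) (α : Grid d) :
    0 ≤ potGen Δx c Y g α + ((∑ j, 2 * (Δx⁻¹) ^ 2 * ‖c j‖) + ‖Y‖) * g α := by
  have h1 : -((∑ j, 2 * (Δx⁻¹) ^ 2 * ‖c j‖) * g α) ≤ heatGen Δx c g α := by
    rw [heatGen_apply', Finset.sum_mul, ← Finset.sum_neg_distrib]
    refine Finset.sum_le_sum fun j _ => ?_
    have h2 : c j α * g α ≤ ‖c j‖ * g α :=
      mul_le_mul_of_nonneg_right ((le_abs_self _).trans (abs_apply_le _ _)) (hg α)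
    have h3 : 0 ≤ c j α * (g (α + unitVec j) + g (α - unitVec j)) :=
      mul_nonneg (hc j α) (add_nonneg (hg _) (hg _))
    have h4 : 0 ≤ (Δx⁻¹) ^ 2 := sq_nonneg _
    nlinarith [mul_le_mul_of_nonneg_left h2 h4, mul_nonneg h4 h3]
  have h2 : Y α * g α ≤ ‖Y‖ * g α :=
    mul_le_mul_of_nonneg_right ((le_abs_self _).trans (abs_apply_le _ _)) (hg α)
  rw [potGen_apply]
  simp only [BoundedContinuousFunction.sub_apply, BoundedContinuousFunction.mul_apply]
  linarith

lemma evol_potGen_nonneg (Δx : ℝ) {c : Fin d → BddGrid d} (hc : ∀ j α, 0 ≤ c j α) (Y : BddGrid d)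
    {t : ℝ} (ht : 0 ≤ t) {g : BddGrid d} (hg : ∀ α, 0 ≤ g α) (α : Grid d) :
    0 ≤ evol (potGen Δx c Y) t g α :=
  evol_nonneg (potGen_add_nonneg Δx hc Y) ht g hg α

section

variable {Δx : ℝ} {c : Fin d → BddGrid d} {t : ℝ}

lemma heat_nonneg (hc : ∀ j α, 0 ≤ c j α) (ht : 0 ≤ t) {g : BddGrid d} (hg : ∀ α, 0 ≤ g α)
    (α : Grid d) : 0 ≤ heat Δx c t g α := by
  have := evol_potGen_nonneg Δx hc 0 ht hg α
  rwa [show potGen Δx c 0 = heatGen Δx c by ext; simp [potGen_apply]] at this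

lemma heat_mono (hc : ∀ j α, 0 ≤ c j α) (ht : 0 ≤ t) {g h : BddGrid d} (hgh : ∀ α, g α ≤ h α)
    (α : Grid d) : heat Δx c t g α ≤ heat Δx c t h α := by
  have := heat_nonneg (Δx := Δx) hc ht (g := h - g) (fun α => by simpa using hgh α) α
  simpa using this

lemma heatGen_one (Δx : ℝ) (c : Fin d → BddGrid d) : heatGen Δx c 1 = 0 := by
  ext α; rw [heatGen_apply']; norm_num

lemma heat_one (Δx : ℝ) (c : Fin d → BddGrid d) (t : ℝ) : heat Δx c t 1 = 1 := by
  have hd : ∀ s, HasDerivAt (fun r => heat Δx c r 1) 0 s := fun s => by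
    have := hasDerivAt_evol_apply (heatGen Δx c) 1 s
    rwa [← evol_gen_comm, heatGen_one, map_zero] at this
  have := is_const_of_deriv_eq_zero (fun s => (hd s).differentiableAt) (fun s => (hd s).deriv) t 0
  simpa [heat] using this

lemma heat_le_of_le (hc : ∀ j α, 0 ≤ c j α) (ht : 0 ≤ t) {g : BddGrid d} {M : ℝ}
    (hg : ∀ α, g α ≤ M) (α : Grid d) : heat Δx c t g α ≤ M := by
  have := heat_mono (Δx := Δx) hc ht (g := g) (h := M • 1) (fun α => by simpa using hg α) α
  simpa [heat_one] using this

lemma abs_heat_apply_le (hc : ∀ j α, 0 ≤ c j α) (ht : 0 ≤ t) (g h : BddGrid d)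
    (hgh : ∀ α, |g α| ≤ h α) (α : Grid d) : |heat Δx c t g α| ≤ heat Δx c t h α := by
  rw [abs_le]
  constructor
  · have := heat_mono (Δx := Δx) hc ht (g := -h) (h := g)
      (fun α => by simpa using (abs_le.1 (hgh α)).1) α
    simpa using this
  · exact heat_mono hc ht (fun α => (abs_le.1 (hgh α)).2) α

lemma norm_heat_le (hc : ∀ j α, 0 ≤ c j α) (ht : 0 ≤ t) (g : BddGrid d) :
    ‖heat Δx c t g‖ ≤ ‖g‖ := by
  refine norm_le_of_abs_le fun α => ?_
  have := abs_heat_apply_le (Δx := Δx) hc ht g (‖g‖ • 1) (fun α => by simpa using abs_apply_le g α) α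
  simpa [heat_one] using this

/-- Comparison principle for differentiable subsolutions. -/
lemma subsolution_le (hc : ∀ j α, 0 ≤ c j α) {G G' : ℝ → BddGrid d}
    (hG : ∀ s, HasDerivAt G (G' s) s) (ht : 0 ≤ t)
    (hle : ∀ s ∈ Ioo 0 t, ∀ α, G' s α ≤ heatGen Δx c (G s) α) {M : ℝ} (hM : ∀ α, G 0 α ≤ M)
    (α : Grid d) : G t α ≤ M := by
  have hd : ∀ s, HasDerivAt (fun r => heat Δx c (t - r) (G r) α)
      (heat Δx c (t - s) (G' s - heatGen Δx c (G s)) α) s := fun s =>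
    (evalAt α).hasFDerivAt.comp_hasDerivAt s (hasDerivAt_evol_sub_apply (heatGen Δx c) t (hG s))
  -- The derivative is the semigroup applied to the defect of a subsolution, and positivity
  -- preserves its sign.
  have hanti : AntitoneOn (fun r => heat Δx c (t - r) (G r) α) (Icc 0 t) := by
    refine antitoneOn_of_deriv_nonpos (convex_Icc 0 t)
      (fun s _ => (hd s).continuousAt.continuousWithinAt)
      (fun s _ => (hd s).differentiableAt.differentiableWithinAt) fun s hs => ?_
    rw [interior_Icc] at hs
    rw [(hd s).deriv]
    refine heat_le_of_le hc (sub_nonneg.2 hs.2.le) (fun β => ?_) α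
    simpa using hle s hs β
  have := hanti (left_mem_Icc.2 ht) (right_mem_Icc.2 ht) ht
  simp only [sub_self, sub_zero] at this
  have h0 : heat Δx c 0 (G t) α = G t α := by simp [heat]
  rw [h0] at this
  exact this.trans (heat_le_of_le hc ht hM α)

end

/-! ### Summable grid functions and the transposed semigroup -/

/-- Summable grid functions. -/
abbrev SumGrid (d : ℕ) : Type := lp (fun _ : Grid d => ℝ) 1

lemma summable_abs_coe (v : SumGrid d) : Summable fun α => |v α| := by
  have := (memℓp_gen_iff (p := 1) (by norm_num)).1 (lp.memℓp v)
  simpa using this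

lemma summable_coe (v : SumGrid d) : Summable fun α => v α := (summable_abs_coe v).of_abs

lemma norm_eq_tsum_abs (v : SumGrid d) : ‖v‖ = ∑' α, |v α| := by
  rw [lp.norm_eq_tsum_rpow (by norm_num)]; simp

/-- A summable family as an element of `SumGrid`. -/
def ofSummable (f : Grid d → ℝ) (h : Summable fun α => |f α|) : SumGrid d :=
  ⟨f, memℓp_gen (by simpa using h)⟩

@[simp] lemma ofSummable_apply (f : Grid d → ℝ) (h : Summable fun α => |f α|) (α : Grid d) :
    ofSummable f h α = f α := rfl

lemma summable_abs_add_right {f : Grid d → ℝ} (h : Summable fun α => |f α|) (γ : Grid d) :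
    Summable fun α => |f (α + γ)| :=
  h.comp_injective (add_left_injective γ)

lemma tsum_add_right (f : Grid d → ℝ) (γ : Grid d) : ∑' α, f (α + γ) = ∑' α, f α :=
  (Equiv.addRight γ).tsum_eq f

/-- Translation of a summable grid function. -/
noncomputable def translateSum (γ : Grid d) : SumGrid d →L[ℝ] SumGrid d :=
  LinearMap.mkContinuous
    { toFun := fun v => ofSummable (fun α => v (α + γ))
        (summable_abs_add_right (summable_abs_coe v) γ)
      map_add' := fun _ _ => rfl
      map_smul' := fun _ _ => rfl } 1
    (fun v => by
      rw [one_mul, norm_eq_tsum_abs v, norm_eq_tsum_abs]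
      exact (tsum_add_right (fun α => |v α|) γ).le)

@[simp] lemma translateSum_apply (γ : Grid d) (v : SumGrid d) (α : Grid d) :
    translateSum γ v α = v (α + γ) := rfl

lemma abs_mul_le (v : Grid d → ℝ) (g : BddGrid d) (α : Grid d) : |g α * v α| ≤ ‖g‖ * |v α| := by
  rw [abs_mul]; gcongr; exact abs_apply_le g α

lemma summable_abs_mul {v : Grid d → ℝ} (hv : Summable fun α => |v α|) (g : BddGrid d) :
    Summable fun α => |g α * v α| :=
  Summable.of_nonneg_of_le (fun _ => abs_nonneg _) (abs_mul_le v g) (hv.mul_left _)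

/-- Multiplication of a summable by a bounded grid function. -/
noncomputable def mulSum (g : BddGrid d) : SumGrid d →L[ℝ] SumGrid d :=
  LinearMap.mkContinuous
    { toFun := fun v => ofSummable (fun α => g α * v α) (summable_abs_mul (summable_abs_coe v) g)
      map_add' := fun v w => by ext α; simp [mul_add]
      map_smul' := fun a v => by ext α; simp [mul_left_comm] } ‖g‖
    (fun v => by
      rw [norm_eq_tsum_abs v, norm_eq_tsum_abs, ← tsum_mul_left]
      exact (summable_abs_mul (summable_abs_coe v) g).tsum_le_tsum (abs_mul_le v g)
        ((summable_abs_coe v).mul_left _))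

@[simp] lemma mulSum_apply (g : BddGrid d) (v : SumGrid d) (α : Grid d) :
    mulSum g v α = g α * v α := rfl

lemma summable_mul_bdd (v : SumGrid d) (g : BddGrid d) : Summable fun α => v α * g α := by
  simpa [mul_comm] using (summable_abs_mul (summable_abs_coe v) g).of_abs

/-- The pairing of summable and bounded grid functions. -/
noncomputable def pairing : SumGrid d →L[ℝ] BddGrid d →L[ℝ] ℝ :=
  LinearMap.mkContinuous₂
    (LinearMap.mk₂ ℝ (fun (v : SumGrid d) (g : BddGrid d) => ∑' α, v α * g α)
      (fun v w g => by
        rw [← (summable_mul_bdd v g).tsum_add (summable_mul_bdd w g)]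
        exact tsum_congr fun α => add_mul _ _ _)
      (fun a v g => by
        rw [smul_eq_mul, ← tsum_mul_left]
        exact tsum_congr fun α => mul_assoc _ _ _)
      (fun v g h => by
        rw [← (summable_mul_bdd v g).tsum_add (summable_mul_bdd v h)]
        exact tsum_congr fun α => mul_add _ _ _)
      (fun a v g => by
        rw [smul_eq_mul, ← tsum_mul_left]
        exact tsum_congr fun α => mul_left_comm _ _ _)) 1
    (fun v g => by
      rw [one_mul, norm_eq_tsum_abs, ← tsum_mul_right]
      refine tsum_of_norm_bounded (((summable_abs_coe v).mul_right _).hasSum) fun α => ?_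
      rw [Real.norm_eq_abs, abs_mul]
      gcongr
      exact abs_apply_le g α)

lemma pairing_apply (v : SumGrid d) (g : BddGrid d) : pairing v g = ∑' α, v α * g α := rfl

lemma pairing_translateSum (γ : Grid d) (v : SumGrid d) (g : BddGrid d) :
    pairing (translateSum γ v) g = pairing v (translate (-γ) g) := by
  rw [pairing_apply, pairing_apply, ← tsum_add_right (fun α => v α * translate (-γ) g α) γ]
  simp

lemma pairing_mulSum (h : BddGrid d) (v : SumGrid d) (g : BddGrid d) :
    pairing (mulSum h v) g = pairing v (h * g) := by
  simp only [pairing_apply, mulSum_apply, BoundedContinuousFunction.mul_apply]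
  exact tsum_congr fun α => by ring

/-- The transpose of `heatGen`. -/
noncomputable def transposeGen (Δx : ℝ) (c : Fin d → BddGrid d) : SumGrid d →L[ℝ] SumGrid d :=
  ∑ j, ((Δx⁻¹) ^ 2 • (translateSum (unitVec j) + translateSum (-unitVec j) - (2 : ℝ) • 1))
    ∘L mulSum (c j)

/-- Translations are transposed by reversing the shift, and the coefficient multiplies before the
difference is taken. Working in `ℓ¹` matters: it yields summable rows, whereas a general bounded
operator on `ℓ^∞` is not determined by its matrix. -/
lemma pairing_transposeGen (Δx : ℝ) (c : Fin d → BddGrid d) (v : SumGrid d) (g : BddGrid d) :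
    pairing (transposeGen Δx c v) g = pairing v (heatGen Δx c g) := by
  have h : heatGen Δx c g = ∑ j, c j * ((Δx⁻¹) ^ 2 •
      (translate (-unitVec j) g + translate (unitVec j) g - (2 : ℝ) • g)) := by
    ext α
    rw [heatGen_apply']
    refine Eq.trans ?_ (map_sum (evalAt α) _ _).symm
    refine Finset.sum_congr rfl fun j _ => ?_
    simp only [sub_eq_add_neg, evalAt_apply, BoundedContinuousFunction.mul_apply,
      BoundedContinuousFunction.smul_apply, BoundedContinuousFunction.add_apply,
      BoundedContinuousFunction.neg_apply, translate_apply, smul_eq_mul]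
    ring
  rw [h, map_sum, transposeGen, sum_apply, map_sum,
    sum_apply]
  refine Finset.sum_congr rfl fun j _ => ?_
  rw [← pairing_mulSum]
  simp [pairing_translateSum]

/-- The summable unit mass at `α`. -/
noncomputable def unitMass (α : Grid d) : SumGrid d :=
  ofSummable (Pi.single α 1) (summable_of_hasFiniteSupport (by
    refine (Set.finite_singleton α).subset fun β hβ => ?_
    by_contra h
    exact hβ (by simp [Pi.single_eq_of_ne h])))

lemma unitMass_apply (α β : Grid d) : unitMass α β = Pi.single (M := fun _ => ℝ) α 1 β := rfl

/-- The bounded unit mass at `α`. -/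
noncomputable def unitBdd (α : Grid d) : BddGrid d :=
  ofBdd (Pi.single α 1) 1 (fun β => by
    by_cases h : β = α
    · subst h; simp
    · simp [Pi.single_eq_of_ne h])

lemma unitBdd_apply (α β : Grid d) : unitBdd α β = Pi.single (M := fun _ => ℝ) α 1 β := rfl

lemma pairing_unitMass (α : Grid d) (g : BddGrid d) : pairing (unitMass α) g = g α := by
  rw [pairing_apply, tsum_eq_single α (fun β h => by simp [unitMass_apply, h])]
  simp [unitMass_apply]

lemma pairing_unitBdd (v : SumGrid d) (α : Grid d) : pairing v (unitBdd α) = v α := by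
  rw [pairing_apply, tsum_eq_single α (fun β h => by simp [unitBdd_apply, h])]
  simp [unitBdd_apply]

/-- The row `α` of the matrix of `heat Δx c t`. -/
noncomputable def heatRow (Δx : ℝ) (c : Fin d → BddGrid d) (t : ℝ) (α : Grid d) : SumGrid d :=
  evol (transposeGen Δx c) t (unitMass α)

lemma heat_apply_eq_pairing (Δx : ℝ) (c : Fin d → BddGrid d) (t : ℝ) (g : BddGrid d)
    (α : Grid d) : heat Δx c t g α = pairing (heatRow Δx c t α) g := by
  rw [heatRow, evol_pairing pairing (pairing_transposeGen Δx c), pairing_unitMass, heat]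

lemma heatRow_apply (Δx : ℝ) (c : Fin d → BddGrid d) (t : ℝ) (α β : Grid d) :
    heatRow Δx c t α β = heat Δx c t (unitBdd β) α := by
  rw [heat_apply_eq_pairing, pairing_unitBdd]

lemma heatRow_nonneg {Δx : ℝ} {c : Fin d → BddGrid d} (hc : ∀ j α, 0 ≤ c j α) {t : ℝ} (ht : 0 ≤ t)
    (α β : Grid d) : 0 ≤ heatRow Δx c t α β := by
  rw [heatRow_apply]
  refine heat_nonneg hc ht (fun γ => ?_) α
  by_cases h : γ = β
  · subst h; simp [unitBdd_apply]
  · simp [unitBdd_apply, h]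

lemma tsum_heatRow (Δx : ℝ) (c : Fin d → BddGrid d) (t : ℝ) (α : Grid d) :
    ∑' β, heatRow Δx c t α β = 1 := by
  have := heat_apply_eq_pairing Δx c t 1 α
  rw [heat_one, pairing_apply] at this
  simpa using this.symm


/-! ### Gradient bounds by Bernstein's method -/

/-- The carré du champ identity. It is exact on the grid and produces both one-sided differences;
these squares are the dissipation that Bernstein's method spends. -/
lemma heatGen_mul_self (Δx : ℝ) (c : Fin d → BddGrid d) (w : BddGrid d) (α : Grid d) :
    heatGen Δx c (w * w) α = 2 * w α * heatGen Δx c w α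
      + ∑ j, c j α * (diffPlus Δx j w α ^ 2 + diffMinus Δx j w α ^ 2) := by
  rw [heatGen_apply', heatGen_apply', Finset.mul_sum, ← Finset.sum_add_distrib]
  refine Finset.sum_congr rfl fun j _ => ?_
  simp only [BoundedContinuousFunction.mul_apply, diffPlus_apply, diffMinus_apply]
  ring

/-- The commutator evaluates second differences at the neighbour `α + e_k`, while the dissipation is
available at `α`. Undoing the shift expresses them through terms that occur in the dissipation at
`α`. -/
lemma second_diff_shift (Δx : ℝ) (j k : Fin d) (u : BddGrid d) (α : Grid d) :
    diffPlus Δx j (diffMinus Δx j u) (α + unitVec k)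
      = diffMinus Δx j (diffPlus Δx j u) α + diffPlus Δx j (diffPlus Δx k u) α
        - diffMinus Δx j (diffPlus Δx k u) α := by
  simp only [diffPlus_apply, diffMinus_apply, sub_add_cancel, add_sub_cancel_right]
  rw [add_right_comm α (unitVec k), show α + unitVec k - unitVec j = α - unitVec j + unitVec k by
    abel]
  ring

lemma diffPlus_heatGen (Δx : ℝ) (c : Fin d → BddGrid d) (k : Fin d) (u : BddGrid d) (α : Grid d) :
    diffPlus Δx k (heatGen Δx c u) α = heatGen Δx c (diffPlus Δx k u) α
      + ∑ j, diffPlus Δx k (c j) α * diffPlus Δx j (diffMinus Δx j u) (α + unitVec k) := by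
  rw [diffPlus_apply, heatGen_apply', heatGen_apply', heatGen_apply', ← Finset.sum_sub_distrib,
    Finset.mul_sum, ← Finset.sum_add_distrib]
  refine Finset.sum_congr rfl fun j _ => ?_
  simp only [second_diff_apply]
  simp only [diffPlus_apply]
  rw [add_right_comm α (unitVec k), show α + unitVec k - unitVec j = α - unitVec j + unitVec k by
    abel]
  ring

/-- The constant in the absorption of the commutator terms. -/
noncomputable def bernsteinConst (d : ℕ) (cmin L : ℝ) : ℝ := d * ((3 + 2 * d) * L ^ 2 / cmin)

lemma bernsteinConst_nonneg {cmin : ℝ} (hcmin : 0 < cmin) (L : ℝ) :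
    0 ≤ bernsteinConst d cmin L := by
  unfold bernsteinConst; positivity

/-- Young's inequality on each product. Here `p` stands for the gradient, `x` and `y` for the
forward and backward differences of its components, and `s` for the differences of the coefficients.
-/
lemma commutator_absorb (hd : 1 ≤ d) {cmin L : ℝ} (hcmin : 0 < cmin) (p : Fin d → ℝ)
    (x y s : Fin d → Fin d → ℝ) (c : Fin d → ℝ) (hc : ∀ j, cmin ≤ c j) (hs : ∀ j k, |s j k| ≤ L) :
    ∑ k, 2 * p k * ∑ j, s j k * (y j j + x j k - y j k)
      ≤ ∑ k, ∑ j, c j * (x j k ^ 2 + y j k ^ 2) + bernsteinConst d cmin L * ∑ k, p k ^ 2 := by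
  have hdpos : (0 : ℝ) < d := by exact_mod_cast hd
  -- The diagonal entry `y j j` recurs for each of the `d` values of `k`, hence its weight `cmin /
  -- (2 * d)`: in total it uses one half of the `y` dissipation and `y j k` the other half. The
  -- three Young constants add up to `1 + 2 + 2d = 3 + 2d`.
  have hterm : ∀ j k, 2 * p k * (s j k * (y j j + x j k - y j k))
      ≤ cmin * x j k ^ 2 + cmin / 2 * y j k ^ 2 + cmin / (2 * d) * y j j ^ 2
        + (3 + 2 * d) * L ^ 2 / cmin * p k ^ 2 := by
    intro j k
    have hs2 : s j k ^ 2 ≤ L ^ 2 := sq_le_sq' (abs_le.1 (hs j k)).1 (abs_le.1 (hs j k)).2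
    have key : ∀ (ε : ℝ) (z : ℝ), 0 < ε → 2 * p k * (s j k * z)
        ≤ ε * z ^ 2 + L ^ 2 / ε * p k ^ 2 := fun ε z hε => by
      have h1 : 0 ≤ (ε * z - s j k * p k) ^ 2 / ε := by positivity
      have h2 : (ε * z - s j k * p k) ^ 2 / ε
          = ε * z ^ 2 - 2 * p k * (s j k * z) + s j k ^ 2 / ε * p k ^ 2 := by
        field_simp; ring
      have h3 : s j k ^ 2 / ε * p k ^ 2 ≤ L ^ 2 / ε * p k ^ 2 := by gcongr
      linarith
    have k1 := key cmin (x j k) hcmin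
    have k2 := key (cmin / 2) (-y j k) (by positivity)
    have k3 := key (cmin / (2 * d)) (y j j) (by positivity)
    have e : L ^ 2 / cmin * p k ^ 2 + L ^ 2 / (cmin / 2) * p k ^ 2
        + L ^ 2 / (cmin / (2 * d)) * p k ^ 2 = (3 + 2 * d) * L ^ 2 / cmin * p k ^ 2 := by
      field_simp; ring
    rw [neg_sq] at k2
    linarith
  have hsum : ∑ k, 2 * p k * ∑ j, s j k * (y j j + x j k - y j k)
      ≤ ∑ k, ∑ j, (cmin * x j k ^ 2 + cmin / 2 * y j k ^ 2 + cmin / (2 * d) * y j j ^ 2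
        + (3 + 2 * d) * L ^ 2 / cmin * p k ^ 2) := by
    refine Finset.sum_le_sum fun k _ => ?_
    rw [Finset.mul_sum]
    exact Finset.sum_le_sum fun j _ => hterm j k
  have hdiag : ∑ _k : Fin d, ∑ j, cmin / (2 * d) * y j j ^ 2
      ≤ ∑ k, ∑ j, cmin / 2 * y j k ^ 2 := by
    rw [Finset.sum_const, Finset.card_univ, Fintype.card_fin, nsmul_eq_mul, ← Finset.mul_sum,
      Finset.sum_comm (f := fun k j => cmin / 2 * y j k ^ 2), ← mul_assoc,
      show (d : ℝ) * (cmin / (2 * d)) = cmin / 2 by field_simp, Finset.mul_sum]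
    refine Finset.sum_le_sum fun j _ => ?_
    exact Finset.single_le_sum (f := fun k => cmin / 2 * y j k ^ 2)
      (fun k _ => by positivity) (Finset.mem_univ j)
  have hgood : ∑ k, ∑ j, (cmin * x j k ^ 2 + cmin * y j k ^ 2)
      ≤ ∑ k, ∑ j, c j * (x j k ^ 2 + y j k ^ 2) := by
    refine Finset.sum_le_sum fun k _ => Finset.sum_le_sum fun j _ => ?_
    rw [← mul_add]
    exact mul_le_mul_of_nonneg_right (hc j) (by positivity)
  have hconst : ∑ k, ∑ _j : Fin d, (3 + 2 * d) * L ^ 2 / cmin * p k ^ 2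
      = bernsteinConst d cmin L * ∑ k, p k ^ 2 := by
    simp only [Finset.sum_const, Finset.card_univ, Fintype.card_fin, nsmul_eq_mul]
    rw [bernsteinConst, Finset.mul_sum]
    exact Finset.sum_congr rfl fun k _ => by ring
  have hhalf : ∑ k, ∑ j, cmin * y j k ^ 2
      = ∑ k, ∑ j, cmin / 2 * y j k ^ 2 + ∑ k, ∑ j, cmin / 2 * y j k ^ 2 := by
    simp only [← Finset.sum_add_distrib]
    exact Finset.sum_congr rfl fun k _ => Finset.sum_congr rfl fun j _ => by ring
  simp only [Finset.sum_add_distrib] at hsum hgood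
  linarith

section

variable {Δx cmin L : ℝ} {c : Fin d → BddGrid d}

/-- The subsolution inequality for `K u² + θ |∇₊u|²` with `θ' = b`. The dissipation of the gradient
absorbs the second differences in the commutator; the dissipation `K cmin |∇₊u|²` of `u²` pays for
the first-order terms that remain, which is the condition `hK`. -/
lemma bernstein_pointwise (hd : 1 ≤ d) (hcmin : 0 < cmin) (hc : ∀ j α, cmin ≤ c j α)
    (hL : ∀ j k α, |diffPlus Δx k (c j) α| ≤ L) {K b θ : ℝ} (hb : 0 ≤ b) (hθ : 0 ≤ θ)
    (hK : b + bernsteinConst d cmin L * θ ≤ K * cmin) (u : BddGrid d) (α : Grid d) :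
    K * (2 * u α * heatGen Δx c u α) + b * ∑ k, diffPlus Δx k u α ^ 2
      + θ * ∑ k, 2 * diffPlus Δx k u α * diffPlus Δx k (heatGen Δx c u) α
    ≤ K * heatGen Δx c (u * u) α
      + θ * ∑ k, heatGen Δx c (diffPlus Δx k u * diffPlus Δx k u) α := by
  have h1 := commutator_absorb hd hcmin (fun k => diffPlus Δx k u α)
    (fun j k => diffPlus Δx j (diffPlus Δx k u) α) (fun j k => diffMinus Δx j (diffPlus Δx k u) α)
    (fun j k => diffPlus Δx k (c j) α) (fun j => c j α) (fun j => hc j α) (fun j k => hL j k α)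
  have h2 : ∑ k, 2 * diffPlus Δx k u α * diffPlus Δx k (heatGen Δx c u) α
      = ∑ k, 2 * diffPlus Δx k u α * heatGen Δx c (diffPlus Δx k u) α
        + ∑ k, 2 * diffPlus Δx k u α * ∑ j, diffPlus Δx k (c j) α
          * (diffMinus Δx j (diffPlus Δx j u) α + diffPlus Δx j (diffPlus Δx k u) α
            - diffMinus Δx j (diffPlus Δx k u) α) := by
    rw [← Finset.sum_add_distrib]
    refine Finset.sum_congr rfl fun k _ => ?_
    simp only [diffPlus_heatGen, second_diff_shift]
    ring
  have h3 : ∑ k, heatGen Δx c (diffPlus Δx k u * diffPlus Δx k u) α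
      = ∑ k, 2 * diffPlus Δx k u α * heatGen Δx c (diffPlus Δx k u) α
        + ∑ k, ∑ j, c j α * (diffPlus Δx j (diffPlus Δx k u) α ^ 2
          + diffMinus Δx j (diffPlus Δx k u) α ^ 2) := by
    simp only [heatGen_mul_self, Finset.sum_add_distrib]
  have h4 : cmin * ∑ k, diffPlus Δx k u α ^ 2
      ≤ ∑ j, c j α * (diffPlus Δx j u α ^ 2 + diffMinus Δx j u α ^ 2) := by
    rw [Finset.mul_sum]
    refine Finset.sum_le_sum fun j _ => ?_
    refine mul_le_mul (hc j α) (le_add_of_nonneg_right (sq_nonneg _)) (sq_nonneg _)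
      (hcmin.le.trans (hc j α))
  have hC := bernsteinConst_nonneg (d := d) hcmin L
  have hK0 : 0 ≤ K := by
    have : 0 ≤ K * cmin := le_trans (by positivity) hK
    exact nonneg_of_mul_nonneg_left this hcmin
  have hS : 0 ≤ ∑ k, diffPlus Δx k u α ^ 2 := Finset.sum_nonneg fun _ _ => sq_nonneg _
  rw [heatGen_mul_self, h2, h3]
  clear h2 h3
  have h5 := mul_le_mul_of_nonneg_left h1 hθ
  have h6 := mul_le_mul_of_nonneg_left h4 hK0
  have h7 := mul_le_mul_of_nonneg_right hK hS
  clear h1 h4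
  generalize ∑ k, diffPlus Δx k u α ^ 2 = S1 at *
  generalize ∑ j, c j α * (diffPlus Δx j u α ^ 2 + diffMinus Δx j u α ^ 2) = S2 at *
  generalize (∑ k, ∑ j, c j α * (diffPlus Δx j (diffPlus Δx k u) α ^ 2
    + diffMinus Δx j (diffPlus Δx k u) α ^ 2)) = S3 at *
  generalize (∑ k, 2 * diffPlus Δx k u α * ∑ j, diffPlus Δx k (c j) α
    * (diffMinus Δx j (diffPlus Δx j u) α + diffPlus Δx j (diffPlus Δx k u) α
      - diffMinus Δx j (diffPlus Δx k u) α)) = S4 at *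
  linarith

/-- The maximum principle for `K u² + (a + b t) |∇₊u|²`. With `a = 0` the gradient of the datum
drops out and smoothing results; with `b = 0` a bound on the initial gradient is propagated. -/
lemma bernstein_bound (hd : 1 ≤ d) (hcmin : 0 < cmin) (hc : ∀ j α, cmin ≤ c j α)
    (hL : ∀ j k α, |diffPlus Δx k (c j) α| ≤ L) {K a b T : ℝ} (ha : 0 ≤ a) (hb : 0 ≤ b)
    (hK : b + bernsteinConst d cmin L * (a + b * T) ≤ K * cmin) (ψ : BddGrid d) {t : ℝ}
    (ht : 0 ≤ t) (htT : t ≤ T) (k : Fin d) (α : Grid d) :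
    (a + b * t) * diffPlus Δx k (heat Δx c t ψ) α ^ 2
      ≤ K * ‖ψ‖ ^ 2 + a * ∑ j, ‖diffPlus Δx j ψ‖ ^ 2 := by
  have hC := bernsteinConst_nonneg (d := d) hcmin L
  have hK0 : 0 ≤ K := by
    have : 0 ≤ K * cmin := le_trans (by have := ht.trans htT; positivity) hK
    exact nonneg_of_mul_nonneg_left this hcmin
  let U : ℝ → BddGrid d := fun s => heat Δx c s ψ
  have hU : ∀ s, HasDerivAt U (heatGen Δx c (U s)) s := hasDerivAt_evol_apply (heatGen Δx c) ψ
  have hD : ∀ j s, HasDerivAt (fun r => diffPlus Δx j (U r)) (diffPlus Δx j (heatGen Δx c (U s))) s :=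
    fun j s => (diffPlus Δx j).hasFDerivAt.comp_hasDerivAt s (hU s)
  have hθ : ∀ s : ℝ, HasDerivAt (fun r : ℝ => a + b * r) b s := fun s => by
    simpa using ((hasDerivAt_id s).const_mul b).const_add a
  let W : ℝ → BddGrid d := fun s => ∑ j, diffPlus Δx j (U s) * diffPlus Δx j (U s)
  let W' : ℝ → BddGrid d := fun s => ∑ j, (diffPlus Δx j (heatGen Δx c (U s)) * diffPlus Δx j (U s)
    + diffPlus Δx j (U s) * diffPlus Δx j (heatGen Δx c (U s)))
  have hW : ∀ s, HasDerivAt W (W' s) s := fun s => by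
    have := HasDerivAt.fun_sum (u := Finset.univ) fun j _ => (hD j s).mul (hD j s)
    exact this
  have hG : ∀ s, HasDerivAt (fun r => K • (U r * U r) + (a + b * r) • W r)
      (K • (heatGen Δx c (U s) * U s + U s * heatGen Δx c (U s))
        + ((a + b * s) • W' s + b • W s)) s := fun s =>
    (((hU s).mul (hU s)).const_smul K).add ((hθ s).smul (hW s))
  have hWa : ∀ s α, W s α = ∑ j, diffPlus Δx j (U s) α ^ 2 := fun s α => by
    refine (map_sum (evalAt α) _ _).trans (Finset.sum_congr rfl fun j _ => ?_)
    simp [sq]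
  have hWa' : ∀ s α, W' s α
      = ∑ j, 2 * diffPlus Δx j (U s) α * diffPlus Δx j (heatGen Δx c (U s)) α := fun s α => by
    refine (map_sum (evalAt α) _ _).trans (Finset.sum_congr rfl fun j _ => ?_)
    simp only [evalAt_apply, BoundedContinuousFunction.mul_apply,
      BoundedContinuousFunction.add_apply]
    ring
  have hHW : ∀ s α, heatGen Δx c (W s) α
      = ∑ j, heatGen Δx c (diffPlus Δx j (U s) * diffPlus Δx j (U s)) α := fun s α =>
    map_sum ((evalAt α).comp (heatGen Δx c)) _ _
  have hmain := subsolution_le (Δx := Δx) (c := c) (fun j α => hcmin.le.trans (hc j α)) hG ht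
    (M := K * ‖ψ‖ ^ 2 + a * ∑ j, ‖diffPlus Δx j ψ‖ ^ 2) ?_ ?_ α
  · simp only [BoundedContinuousFunction.add_apply, BoundedContinuousFunction.smul_apply,
      BoundedContinuousFunction.mul_apply, smul_eq_mul, hWa] at hmain
    have h1 : diffPlus Δx k (U t) α ^ 2 ≤ ∑ j, diffPlus Δx j (U t) α ^ 2 :=
      Finset.single_le_sum (f := fun j => diffPlus Δx j (U t) α ^ 2) (fun _ _ => sq_nonneg _)
        (Finset.mem_univ k)
    have h2 : (a + b * t) * diffPlus Δx k (U t) α ^ 2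
        ≤ (a + b * t) * ∑ j, diffPlus Δx j (U t) α ^ 2 := by gcongr
    have h3 : 0 ≤ K * (U t α * U t α) := mul_nonneg hK0 (mul_self_nonneg _)
    exact (h2.trans (by linarith)).trans hmain
  · intro s hs β
    have hθs : 0 ≤ a + b * s := by have := hs.1.le; positivity
    have hKs : b + bernsteinConst d cmin L * (a + b * s) ≤ K * cmin := by
      refine le_trans ?_ hK
      have := hs.2.le.trans htT
      gcongr
    have := bernstein_pointwise hd hcmin hc hL hb hθs hKs (U s) β
    simp only [map_add, map_smul, BoundedContinuousFunction.add_apply,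
      BoundedContinuousFunction.smul_apply, BoundedContinuousFunction.mul_apply, smul_eq_mul, hWa,
      hWa', hHW]
    linarith
  · intro β
    have hU0 : U 0 = ψ := by simp [U, heat]
    simp only [BoundedContinuousFunction.add_apply, BoundedContinuousFunction.smul_apply,
      BoundedContinuousFunction.mul_apply, smul_eq_mul, hWa, hU0, mul_zero, add_zero]
    have hsq : ∀ g : BddGrid d, g β ^ 2 ≤ ‖g‖ ^ 2 := fun g =>
      sq_le_sq' (neg_le_of_abs_le (abs_apply_le g β)) (le_of_abs_le (abs_apply_le g β))
    rw [← sq]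
    exact add_le_add (mul_le_mul_of_nonneg_left (hsq ψ) hK0)
      (mul_le_mul_of_nonneg_left (Finset.sum_le_sum fun j _ => hsq _) ha)

end

/-- Smoothing bound `‖∇₊ S(t) ψ‖ ≤ C t^{-1/2} ‖ψ‖` and propagation of gradient bounds. -/
lemma exists_gradient_bound (hd : 1 ≤ d) {cmin : ℝ} (hcmin : 0 < cmin) (L T : ℝ) :
    ∃ C : ℝ, 0 ≤ C ∧ ∀ (Δx : ℝ) (c : Fin d → BddGrid d), (∀ j α, cmin ≤ c j α) →
      (∀ j k α, |diffPlus Δx k (c j) α| ≤ L) → ∀ (ψ : BddGrid d) (t : ℝ), 0 < t → t ≤ T → ∀ k,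
        ‖diffPlus Δx k (heat Δx c t ψ)‖ ≤ C * t ^ (-(1 / 2) : ℝ) * ‖ψ‖ ∧
        ∀ M : ℝ, (∀ j, ‖diffPlus Δx j ψ‖ ≤ M) →
          ‖diffPlus Δx k (heat Δx c t ψ)‖ ≤ C * (‖ψ‖ + M) := by
  set C1 := bernsteinConst d cmin L with hC1
  have hC1n : 0 ≤ C1 := bernsteinConst_nonneg hcmin L
  rcases le_or_gt T 0 with hT | hT
  · exact ⟨0, le_rfl, fun _ _ _ _ _ t ht htT => absurd (ht.trans_le htT) (not_lt.2 hT)⟩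
  -- `K1` and `K2` are the least constants that satisfy the hypothesis `hK` of `bernstein_bound` for
  -- `(a, b) = (0, 1)` and `(1, 0)`.
  set K1 := (1 + C1 * T) / cmin with hK1
  set K2 := C1 / cmin with hK2
  have hK1n : 0 ≤ K1 := by positivity
  have hK2n : 0 ≤ K2 := by positivity
  refine ⟨√K1 + √K2 + √d, by positivity, fun Δx c hc hL ψ t ht htT k => ⟨?_, fun M hM => ?_⟩⟩
  · have h : ∀ α, |diffPlus Δx k (heat Δx c t ψ) α| ≤ √K1 * t ^ (-(1 / 2) : ℝ) * ‖ψ‖ := fun α => by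
      have := bernstein_bound hd hcmin hc hL (K := K1) (a := 0) (b := 1) (T := T) le_rfl zero_le_one
        (by rw [hK1]; field_simp; simp [hC1, mul_comm]) ψ ht.le htT k α
      refine abs_le_of_sq_le_sq ?_ (by positivity)
      rw [mul_pow, mul_pow, Real.sq_sqrt hK1n, ← Real.rpow_natCast (t ^ (-(1 / 2) : ℝ)),
        ← Real.rpow_mul ht.le]
      norm_num
      rw [Real.rpow_neg_one]
      rw [zero_add, one_mul, zero_mul, add_zero] at this
      rw [mul_right_comm, ← div_eq_mul_inv, le_div_iff₀ ht]
      linarith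
    refine (norm_le_of_abs_le h).trans ?_
    gcongr
    linarith [Real.sqrt_nonneg K2, Real.sqrt_nonneg d]
  · have hM0 : 0 ≤ M := (norm_nonneg _).trans (hM k)
    have h : ∀ α, |diffPlus Δx k (heat Δx c t ψ) α| ≤ √K2 * ‖ψ‖ + √d * M := fun α => by
      have := bernstein_bound hd hcmin hc hL (K := K2) (a := 1) (b := 0) (T := T) zero_le_one le_rfl
        (by rw [hK2]; field_simp; simp [hC1]) ψ ht.le htT k α
      refine abs_le_of_sq_le_sq ?_ (by positivity)
      have h2 : ∑ j, ‖diffPlus Δx j ψ‖ ^ 2 ≤ d * M ^ 2 := by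
        calc ∑ j, ‖diffPlus Δx j ψ‖ ^ 2 ≤ ∑ _j : Fin d, M ^ 2 :=
              Finset.sum_le_sum fun j _ => by have := hM j; gcongr
          _ = d * M ^ 2 := by simp
      have h3 : (√K2 * ‖ψ‖ + √d * M) ^ 2
          = K2 * ‖ψ‖ ^ 2 + d * M ^ 2 + 2 * (√K2 * ‖ψ‖ * (√d * M)) := by
        rw [add_sq, mul_pow, mul_pow, Real.sq_sqrt hK2n, Real.sq_sqrt (Nat.cast_nonneg d)]; ring
      have h4 : 0 ≤ √K2 * ‖ψ‖ * (√d * M) := by positivity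
      rw [h3]
      linarith
    refine (norm_le_of_abs_le h).trans ?_
    have a1 := Real.sqrt_nonneg K1
    have a2 := Real.sqrt_nonneg K2
    have a3 := Real.sqrt_nonneg d
    have := norm_nonneg ψ
    nlinarith [mul_nonneg a1 this, mul_nonneg a3 this, mul_nonneg a1 hM0, mul_nonneg a2 hM0]


/-! ### Nash's inequality on the grid -/

/-- A summable grid function as a bounded one. -/
noncomputable def toBdd : SumGrid d →L[ℝ] BddGrid d :=
  LinearMap.mkContinuous
    { toFun := fun v => ofBdd v ‖v‖ (fun α => by
        simpa using lp.norm_apply_le_norm one_ne_zero v α)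
      map_add' := fun _ _ => rfl
      map_smul' := fun _ _ => rfl } 1
    (fun v => by
      rw [one_mul]
      exact norm_le_of_abs_le fun α => lp.norm_apply_le_norm one_ne_zero v α)

@[simp] lemma toBdd_apply (v : SumGrid d) (α : Grid d) : toBdd v α = v α := rfl

lemma summable_mul (v w : SumGrid d) : Summable fun α => v α * w α :=
  summable_mul_bdd v (toBdd w)

lemma summable_sq (v : SumGrid d) : Summable fun α => v α ^ 2 := by
  simpa [sq] using summable_mul v v

/-- A summable grid function as a square summable one. -/
noncomputable def toSq (v : SumGrid d) : lp (fun _ : Grid d => ℝ) 2 :=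
  ⟨v, memℓp_gen (by simpa using summable_sq v)⟩

lemma norm_toSq_sq (v : SumGrid d) : ‖toSq v‖ ^ 2 = ∑' α, v α ^ 2 := by
  have := lp.norm_rpow_eq_tsum (p := 2) (by norm_num) (toSq v)
  simpa [toSq] using this

lemma norm_toSq_add_le (v w : SumGrid d) : ‖toSq (v + w)‖ ≤ ‖toSq v‖ + ‖toSq w‖ := by
  have h : toSq (v + w) = toSq v + toSq w := by
    ext α
    rw [lp.coeFn_add, Pi.add_apply]
    exact congrFun (lp.coeFn_add v w) α
  rw [h]
  exact norm_add_le _ _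

lemma norm_toSq_translateSum (γ : Grid d) (v : SumGrid d) :
    ‖toSq (translateSum γ v)‖ = ‖toSq v‖ := by
  rw [← sq_eq_sq₀ (norm_nonneg _) (norm_nonneg _), norm_toSq_sq, norm_toSq_sq]
  exact tsum_add_right (fun α => v α ^ 2) γ

/-- The `ℓ²` modulus of continuity. -/
noncomputable def modulus (v : SumGrid d) (γ : Grid d) : ℝ := ‖toSq (translateSum γ v - v)‖

lemma modulus_nonneg (v : SumGrid d) (γ : Grid d) : 0 ≤ modulus v γ := norm_nonneg _

lemma modulus_zero (v : SumGrid d) : modulus v 0 = 0 := by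
  have : translateSum 0 v - v = 0 := by ext α; simp
  rw [modulus, this]; exact norm_zero

lemma modulus_add_le (v : SumGrid d) (γ δ : Grid d) :
    modulus v (γ + δ) ≤ modulus v γ + modulus v δ := by
  have h : translateSum (γ + δ) v - v
      = (translateSum γ v - v) + translateSum γ (translateSum δ v - v) := by
    ext α; simp [add_assoc]
  rw [modulus, h]
  refine (norm_toSq_add_le _ _).trans ?_
  rw [norm_toSq_translateSum]; rfl

lemma modulus_nsmul_le (v : SumGrid d) (γ : Grid d) (m : ℕ) :
    modulus v (m • γ) ≤ m * modulus v γ := by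
  induction m with
  | zero => simp [modulus_zero]
  | succ m ih =>
    rw [succ_nsmul]
    refine (modulus_add_le v _ _).trans ?_
    push_cast; linarith

lemma modulus_sq (v : SumGrid d) (γ : Grid d) :
    modulus v γ ^ 2 = ∑' α, (v (α + γ) - v α) ^ 2 := norm_toSq_sq _

/-- The Dirichlet sum `∑ⱼ ∑_α (v_{α+eⱼ} - v_α)²`. -/
noncomputable def dirichletSum (v : SumGrid d) : ℝ := ∑ j, modulus v (unitVec j) ^ 2

/-- The box `{0, …, n-1}^d`. -/
noncomputable def box (d n : ℕ) : Finset (Grid d) := Fintype.piFinset fun _ => Finset.Ico (0 : ℤ) n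

lemma card_box (d n : ℕ) : (box d n).card = n ^ d := by
  simp [box, Fintype.card_piFinset]

/-- The shift `γ` is a path of unit steps, fewer than `n` in each direction, and the modulus is
subadditive. -/
lemma modulus_le_of_mem_box (v : SumGrid d) {n : ℕ} {γ : Grid d} (hγ : γ ∈ box d n) :
    modulus v γ ≤ n * ∑ j, modulus v (unitVec j) := by
  have hγ' : γ = ∑ j, (γ j).toNat • unitVec j := by
    funext i
    have hi := (Finset.mem_Ico.1 (Fintype.mem_piFinset.1 hγ i)).1
    rw [Finset.sum_apply, Finset.sum_eq_single i]
    · simp [hi]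
    · intro j _ hji; simp [unitVec, Pi.single_eq_of_ne hji.symm]
    · simp
  rw [hγ', Finset.mul_sum]
  refine (Finset.le_sum_of_subadditive (modulus v) (modulus_zero v).le (modulus_add_le v)
    _ _).trans (Finset.sum_le_sum fun j _ => ?_)
  refine (modulus_nsmul_le v _ _).trans ?_
  have hj := Finset.mem_Ico.1 (Fintype.mem_piFinset.1 hγ j)
  have : ((γ j).toNat : ℝ) ≤ n := by exact_mod_cast (by omega : (γ j).toNat ≤ n)
  exact mul_le_mul_of_nonneg_right this (modulus_nonneg _ _)

lemma two_mul_tsum_mul_translate (v : SumGrid d) (γ : Grid d) :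
    2 * ∑' α, v α ^ 2 = 2 * ∑' α, v α * v (α + γ) + modulus v γ ^ 2 := by
  have h1 := summable_sq (translateSum γ v)
  have h2 := summable_sq v
  have h3 := (summable_mul v (translateSum γ v)).mul_left 2
  simp only [translateSum_apply] at h1 h3
  have h4 : ∑' α, v (α + γ) ^ 2 = ∑' α, v α ^ 2 := tsum_add_right (fun α => v α ^ 2) γ
  have h5 : ∑' α, (v (α + γ) - v α) ^ 2
      = ∑' α, v (α + γ) ^ 2 + ∑' α, v α ^ 2 - ∑' α, 2 * (v α * v (α + γ)) := by
    rw [← h1.tsum_add h2, ← (h1.add h2).tsum_sub h3]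
    exact tsum_congr fun α => by ring
  rw [modulus_sq, h5, h4, tsum_mul_left]
  ring

/-- For fixed `α` the points `α + γ` are distinct, so the inner sum over the box is at most the
whole `ℓ¹` norm. -/
lemma sum_box_le (v : SumGrid d) (n : ℕ) :
    ∑ γ ∈ box d n, ∑' α, v α * v (α + γ) ≤ ‖v‖ ^ 2 := by
  have hs : ∀ γ ∈ box d n, Summable fun α => v α * v (α + γ) := fun γ _ =>
    summable_mul v (translateSum γ v)
  rw [← Summable.tsum_finsetSum hs, sq, norm_eq_tsum_abs v, ← tsum_mul_right]
  refine (summable_sum hs).tsum_le_tsum (fun α => ?_) ((summable_abs_coe v).mul_right _)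
  rw [← Finset.mul_sum]
  refine (le_abs_self _).trans ?_
  rw [abs_mul]
  refine mul_le_mul_of_nonneg_left ((Finset.abs_sum_le_sum_abs _ _).trans ?_) (abs_nonneg _)
  have h := (summable_abs_coe v).sum_le_tsum ((box d n).map (addLeftEmbedding α))
    (fun _ _ => abs_nonneg _)
  simpa using h

/-- Expand `‖v(· + γ) - v‖²` and average over the `n ^ d` shifts of a box: the autocorrelations
together cost only `‖v‖₁²`, and the moduli are controlled by the Dirichlet sum. -/
lemma nash_box (v : SumGrid d) {n : ℕ} (hn : 1 ≤ n) :
    ∑' α, v α ^ 2 ≤ (n ^ d : ℝ)⁻¹ * ‖v‖ ^ 2 + d / 2 * n ^ 2 * dirichletSum v := by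
  have hn' : (0 : ℝ) < n ^ d := by positivity
  have h1 : ∑ γ ∈ box d n, 2 * ∑' α, v α ^ 2
      = 2 * ∑ γ ∈ box d n, ∑' α, v α * v (α + γ) + ∑ γ ∈ box d n, modulus v γ ^ 2 := by
    rw [Finset.mul_sum, ← Finset.sum_add_distrib]
    exact Finset.sum_congr rfl fun γ _ => two_mul_tsum_mul_translate v γ
  have h2 : ∑ γ ∈ box d n, modulus v γ ^ 2 ≤ ∑ _γ ∈ box d n, n ^ 2 * (d * dirichletSum v) := by
    refine Finset.sum_le_sum fun γ hγ => ?_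
    have h3 := modulus_le_of_mem_box v hγ
    have h4 : (∑ j, modulus v (unitVec j)) ^ 2 ≤ d * dirichletSum v := by
      simpa [dirichletSum] using sq_sum_le_card_mul_sum_sq (s := Finset.univ)
        (f := fun j : Fin d => modulus v (unitVec j))
    calc modulus v γ ^ 2 ≤ (n * ∑ j, modulus v (unitVec j)) ^ 2 := by
          have := modulus_nonneg v γ
          gcongr
      _ = n ^ 2 * (∑ j, modulus v (unitVec j)) ^ 2 := mul_pow _ _ _
      _ ≤ _ := by gcongr
  simp only [Finset.sum_const, card_box, nsmul_eq_mul, Nat.cast_pow] at h1 h2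
  have h5 := sum_box_le v n
  have h6 : (n : ℝ) ^ d * ∑' α, v α ^ 2
      ≤ (n : ℝ) ^ d * ((n ^ d : ℝ)⁻¹ * ‖v‖ ^ 2 + d / 2 * n ^ 2 * dirichletSum v) := by
    rw [mul_add, mul_inv_cancel_left₀ hn'.ne']
    linarith
  exact le_of_mul_le_mul_left h6 hn'

lemma dirichletSum_nonneg (v : SumGrid d) : 0 ≤ dirichletSum v :=
  Finset.sum_nonneg fun _ _ => sq_nonneg _

lemma tsum_sq_le_norm_sq (v : SumGrid d) : ∑' α, v α ^ 2 ≤ ‖v‖ ^ 2 := by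
  rw [sq ‖v‖]
  conv_rhs => enter [2]; rw [norm_eq_tsum_abs]
  rw [← tsum_mul_left]
  refine (summable_sq v).tsum_le_tsum (fun α => ?_) ((summable_abs_coe v).mul_left _)
  rw [← sq_abs, sq]
  exact mul_le_mul_of_nonneg_right
    (by simpa using lp.norm_apply_le_norm one_ne_zero v α) (abs_nonneg _)

/-- Nash's inequality in the form of a family of inequalities indexed by a length scale `R`. -/
lemma nash (v : SumGrid d) {Δx R : ℝ} (hΔ : 0 < Δx) (hR : 0 < R) :
    ∑' α, v α ^ 2 ≤ (2 * Δx / R) ^ d * ‖v‖ ^ 2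
      + d / 2 * R ^ 2 * ((Δx⁻¹) ^ 2 * dirichletSum v) := by
  have hE := dirichletSum_nonneg v
  rcases lt_or_ge R Δx with h | h
  -- Below the grid scale no averaging is possible, but there `ℓ¹ ⊂ ℓ²` suffices.
  · have h1 : 1 ≤ (2 * Δx / R) ^ d := by
      refine one_le_pow₀ ?_
      rw [le_div_iff₀ hR]; linarith
    have h2 : 0 ≤ d / 2 * R ^ 2 * ((Δx⁻¹) ^ 2 * dirichletSum v) := by positivity
    nlinarith [tsum_sq_le_norm_sq v, sq_nonneg ‖v‖]
  · have hq : 1 ≤ R / Δx := (one_le_div hΔ).2 h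
    -- Since `n ≥ 1`, rounding down loses at most a factor 2; this is the 2 in `2 * Δx / R`.
    set n := ⌊R / Δx⌋₊ with hn
    have hn1 : 1 ≤ n := Nat.one_le_floor_iff _ |>.2 hq
    have hnle : (n : ℝ) ≤ R / Δx := Nat.floor_le (by positivity)
    have hnlt : R / Δx < n + 1 := Nat.lt_floor_add_one _
    have hn1' : (1 : ℝ) ≤ n := by exact_mod_cast hn1
    refine (nash_box v hn1).trans (add_le_add ?_ ?_)
    · rw [← inv_pow]
      refine mul_le_mul_of_nonneg_right (pow_le_pow_left₀ (by positivity) ?_ d) (sq_nonneg _)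
      rw [inv_le_comm₀ (by positivity) (by positivity), inv_div]
      rw [div_le_iff₀ (by positivity)]
      rw [div_lt_iff₀ hΔ] at hnlt
      nlinarith
    · have : (n : ℝ) ^ 2 ≤ R ^ 2 * (Δx⁻¹) ^ 2 := by
        rw [← mul_pow, ← div_eq_mul_inv]; gcongr
      calc d / 2 * (n : ℝ) ^ 2 * dirichletSum v
          ≤ d / 2 * (R ^ 2 * (Δx⁻¹) ^ 2) * dirichletSum v := by gcongr
        _ = _ := by ring

/-! ### The energy inequality -/

/-- Summation by parts gives `-2 c |∇v|²` and a term with the difference of `c`. One `cmin |∇v|²`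
absorbs that term by Young's inequality; the other remains as dissipation. -/
lemma energy_le {Δx cmin L : ℝ} (hcmin : 0 < cmin) {c : Fin d → BddGrid d}
    (hc : ∀ j α, cmin ≤ c j α) (hL : ∀ j k α, |diffPlus Δx k (c j) α| ≤ L) (v : SumGrid d) :
    2 * pairing v (heatGen Δx c (toBdd v))
      ≤ -(cmin * ((Δx⁻¹) ^ 2 * dirichletSum v)) + d * (L ^ 2 / cmin) * ∑' α, v α ^ 2 := by
  have hA : heatGen Δx c (toBdd v)
      = ∑ j, c j * diffPlus Δx j (diffMinus Δx j (toBdd v)) := by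
    simp [heatGen]
  have key : ∀ j, 2 * pairing v (c j * diffPlus Δx j (diffMinus Δx j (toBdd v)))
      ≤ -(cmin * ((Δx⁻¹) ^ 2 * modulus v (unitVec j) ^ 2)) + L ^ 2 / cmin * ∑' α, v α ^ 2 := by
    intro j
    set e := unitVec j with he
    have s1 : Summable fun α => (c j α * v α) * (v (α + e) - v α) :=
      summable_mul (mulSum (c j) v) (translateSum e v - v)
    have s2 : Summable fun α => (c j α * v α) * (v α - v (α - e)) := by
      simpa [sub_eq_add_neg] using summable_mul (mulSum (c j) v) (v - translateSum (-e) v)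
    have s3 : Summable fun α => (c j (α + e) * v (α + e)) * (v (α + e) - v α) :=
      summable_mul (translateSum e (mulSum (c j) v)) (translateSum e v - v)
    have s4 : Summable fun α => (v (α + e) - v α) ^ 2 := summable_sq (translateSum e v - v)
    have s5 : Summable fun α => v (α + e) ^ 2 := summable_sq (translateSum e v)
    have e1 : pairing v (c j * diffPlus Δx j (diffMinus Δx j (toBdd v)))
        = (Δx⁻¹) ^ 2 * ∑' α, (c j α * v α - c j (α + e) * v (α + e)) * (v (α + e) - v α) := by
      have e2 : ∑' α, (c j (α + e) * v (α + e)) * (v (α + e) - v α)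
          = ∑' α, (c j α * v α) * (v α - v (α - e)) := by
        rw [← tsum_add_right (fun α => (c j α * v α) * (v α - v (α - e))) e]
        simp
      have e3 : ∑' α, (c j α * v α - c j (α + e) * v (α + e)) * (v (α + e) - v α)
          = ∑' α, (c j α * v α) * (v (α + e) - v α)
            - ∑' α, (c j (α + e) * v (α + e)) * (v (α + e) - v α) := by
        rw [← s1.tsum_sub s3]
        exact tsum_congr fun α => by ring
      rw [e3, e2, ← s1.tsum_sub s2, pairing_apply, ← tsum_mul_left]
      refine tsum_congr fun α => ?_
      rw [BoundedContinuousFunction.mul_apply, second_diff_apply]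
      simp only [toBdd_apply]
      ring
    have hpt : ∀ α, 2 * ((Δx⁻¹) ^ 2 * ((c j α * v α - c j (α + e) * v (α + e)) * (v (α + e) - v α)))
        ≤ -(cmin * ((Δx⁻¹) ^ 2 * (v (α + e) - v α) ^ 2)) + L ^ 2 / cmin * v (α + e) ^ 2 := by
      intro α
      set D := Δx⁻¹ * (v (α + e) - v α) with hD
      set s := diffPlus Δx j (c j) α with hs
      have hs' : s = Δx⁻¹ * (c j (α + e) - c j α) := diffPlus_apply _ _ _ _
      have h1 : 2 * ((Δx⁻¹) ^ 2 * ((c j α * v α - c j (α + e) * v (α + e)) * (v (α + e) - v α)))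
          = -(2 * c j α * D ^ 2) - 2 * s * v (α + e) * D := by
        rw [hD, hs']; ring
      have h2 : (Δx⁻¹) ^ 2 * (v (α + e) - v α) ^ 2 = D ^ 2 := by rw [hD]; ring
      rw [h1, h2]
      have h3 : s ^ 2 ≤ L ^ 2 := sq_le_sq' (abs_le.1 (hL j j α)).1 (abs_le.1 (hL j j α)).2
      have h4 : 0 ≤ (cmin * D + s * v (α + e)) ^ 2 / cmin := by positivity
      have h5 : (cmin * D + s * v (α + e)) ^ 2 / cmin
          = cmin * D ^ 2 + 2 * s * v (α + e) * D + s ^ 2 / cmin * v (α + e) ^ 2 := by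
        field_simp; ring
      have h6 : s ^ 2 / cmin * v (α + e) ^ 2 ≤ L ^ 2 / cmin * v (α + e) ^ 2 := by gcongr
      have h7 : cmin * D ^ 2 ≤ c j α * D ^ 2 := mul_le_mul_of_nonneg_right (hc j α) (sq_nonneg _)
      linarith
    have s6 : Summable fun α => (c j α * v α - c j (α + e) * v (α + e)) * (v (α + e) - v α) :=
      (s1.sub s3).congr fun α => by ring
    have := ((s6.mul_left ((Δx⁻¹) ^ 2)).mul_left 2).tsum_le_tsum hpt
      ((((s4.mul_left ((Δx⁻¹) ^ 2)).mul_left cmin).neg).add (s5.mul_left (L ^ 2 / cmin)))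
    rw [Summable.tsum_add (((s4.mul_left ((Δx⁻¹) ^ 2)).mul_left cmin).neg)
      (s5.mul_left (L ^ 2 / cmin)), tsum_neg] at this
    simp only [tsum_mul_left] at this
    rw [e1, modulus_sq, ← tsum_add_right (fun α => v α ^ 2) e]
    exact this
  rw [hA, map_sum, Finset.mul_sum]
  refine (Finset.sum_le_sum fun j _ => key j).trans (le_of_eq ?_)
  rw [Finset.sum_add_distrib, Finset.sum_neg_distrib, ← Finset.mul_sum, ← Finset.mul_sum,
    dirichletSum]
  simp; ring


/-! ### Decay of the rows of the kernel -/

lemma norm_heatRow {Δx : ℝ} {c : Fin d → BddGrid d} (hc : ∀ j α, 0 ≤ c j α) {t : ℝ} (ht : 0 ≤ t)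
    (α : Grid d) : ‖heatRow Δx c t α‖ = 1 := by
  rw [norm_eq_tsum_abs, ← tsum_heatRow Δx c t α]
  exact tsum_congr fun β => abs_of_nonneg (heatRow_nonneg hc ht α β)

lemma pairing_toBdd_comm (v w : SumGrid d) : pairing v (toBdd w) = pairing w (toBdd v) := by
  simp only [pairing_apply, toBdd_apply, mul_comm]

lemma hasDerivAt_bilinear {E F : Type*} [NormedAddCommGroup E] [NormedSpace ℝ E]
    [NormedAddCommGroup F] [NormedSpace ℝ F] (P : E →L[ℝ] F →L[ℝ] ℝ) (J : E →L[ℝ] F) {v : ℝ → E}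
    {v' : E} {t : ℝ} (h : HasDerivAt v v' t) :
    HasDerivAt (fun s => P (v s) (J (v s))) (P v' (J (v t)) + P (v t) (J v')) t :=
  (P.hasFDerivAt.comp_hasDerivAt t h).clm_apply (J.hasFDerivAt.comp_hasDerivAt t h)

/-- Rows evolve by the transposed generator; inside the quadratic form it can be moved to the other
factor, where `energy_le` applies. -/
lemma hasDerivAt_tsum_sq_heatRow (Δx : ℝ) (c : Fin d → BddGrid d) (α : Grid d) (t : ℝ) :
    HasDerivAt (fun s => ∑' β, heatRow Δx c s α β ^ 2)
      (2 * pairing (heatRow Δx c t α) (heatGen Δx c (toBdd (heatRow Δx c t α)))) t := by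
  have h : HasDerivAt (fun s => heatRow Δx c s α) (transposeGen Δx c (heatRow Δx c t α)) t :=
    hasDerivAt_evol_apply (transposeGen Δx c) (unitMass α) t
  generalize hv : (fun s => heatRow Δx c s α) = v at h
  have hvs : ∀ s, heatRow Δx c s α = v s := fun s => congrFun hv s
  simp only [hvs] at h ⊢
  have h3 := hasDerivAt_bilinear pairing toBdd h
  rw [pairing_toBdd_comm _ (transposeGen Δx c _), pairing_transposeGen, ← two_mul] at h3
  have e : (fun s => ∑' β, v s β ^ 2) = fun s => pairing (v s) (toBdd (v s)) :=
    funext fun s => tsum_congr fun β => sq _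
  rw [e]
  exact h3

lemma sqrt_pow_eq_rpow {t : ℝ} (ht : 0 ≤ t) (n : ℕ) : √t ^ n = t ^ ((n : ℝ) / 2) := by
  rw [Real.sqrt_eq_rpow, ← Real.rpow_natCast, ← Real.rpow_mul ht]; congr 1; ring

/-- Nash's argument with the length scale fixed at `R² = ε s` instead of optimised, so that the
differential inequality for `y = ∑ w²` is linear. The `ℓ¹` norm in Nash's inequality equals 1
because rows are probability vectors. -/
lemma exists_heatRow_sq_bound (hd : 1 ≤ d) {cmin : ℝ} (hcmin : 0 < cmin) (L T : ℝ) :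
    ∃ C : ℝ, 0 ≤ C ∧ ∀ (Δx : ℝ) (c : Fin d → BddGrid d), 0 < Δx → (∀ j α, cmin ≤ c j α) →
      (∀ j k α, |diffPlus Δx k (c j) α| ≤ L) → ∀ (t : ℝ), 0 < t → t ≤ T → ∀ α,
        ∑' β, heatRow Δx c t α β ^ 2 ≤ C * Δx ^ d * t ^ (-((d : ℝ) / 2)) := by
  have hdpos : (0 : ℝ) < d := by exact_mod_cast hd
  set C0 := d * (L ^ 2 / cmin) with hC0
  have hC0n : 0 ≤ C0 := by positivity
  -- Chosen so that `d` times the gradient term of Nash's inequality is exactly `s` times the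
  -- dissipation.
  set ε := 2 * cmin / d ^ 2 with hε
  have hεp : 0 < ε := by positivity
  refine ⟨2 * (2 / √ε) ^ d * Real.exp (C0 * T), by positivity,
    fun Δx c hΔ hc hL t ht htT α => ?_⟩
  have hc0 : ∀ j α, 0 ≤ c j α := fun j α => hcmin.le.trans (hc j α)
  set B := (2 * Δx / √ε) ^ d with hB
  have hBn : 0 ≤ B := by positivity
  set y : ℝ → ℝ := fun s => ∑' β, heatRow Δx c s α β ^ 2 with hy
  set y' : ℝ → ℝ := fun s =>
    2 * pairing (heatRow Δx c s α) (heatGen Δx c (toBdd (heatRow Δx c s α))) with hy'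
  have hyd : ∀ s, HasDerivAt y (y' s) s := hasDerivAt_tsum_sq_heatRow Δx c α
  have hineq : ∀ s, 0 < s → s * y' s ≤ -(d * y s) + d * (B * s ^ (-((d : ℝ) / 2))) + C0 * s * y s := by
    intro s hs
    have h1 := energy_le hcmin hc hL (heatRow Δx c s α)
    have h2 := nash (heatRow Δx c s α) hΔ (R := √(ε * s)) (by positivity)
    rw [norm_heatRow hc0 hs.le, Real.sq_sqrt (by positivity), Real.sqrt_mul hεp.le, ← div_div,
      div_pow _ (√s), sqrt_pow_eq_rpow hs.le, div_eq_mul_inv _ (s ^ _), ← Real.rpow_neg hs.le] at h2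
    have h3 : (d : ℝ) * (d / 2 * (ε * s) * ((Δx⁻¹) ^ 2 * dirichletSum (heatRow Δx c s α)))
        = s * (cmin * ((Δx⁻¹) ^ 2 * dirichletSum (heatRow Δx c s α))) := by
      rw [hε]; field_simp
    have h4 := mul_le_mul_of_nonneg_left h2 hdpos.le
    have h5 := mul_le_mul_of_nonneg_left h1 hs.le
    simp only [hy, hy']
    rw [mul_add, h3] at h4
    rw [hB, hC0]
    linarith
  -- The integrating factor `s ^ d * exp (-C0 s)` removes the terms in `y`; what is left is at most
  -- `d B s^(d/2 - 1)`, with primitive `2 B s^(d/2)`. So `z` decreases from `z 0 = 0`.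
  set z : ℝ → ℝ := fun s => s ^ d * (Real.exp (-(C0 * s)) * y s) - 2 * B * s ^ ((d : ℝ) / 2) with hz
  have hyc : Continuous y := continuous_iff_continuousAt.2 fun s => (hyd s).continuousAt
  have hzc : Continuous z := by
    refine Continuous.sub (by fun_prop) (continuous_const.mul ?_)
    exact Real.continuous_rpow_const (by positivity)
  have hzd : ∀ s, 0 < s → HasDerivAt z ((d : ℝ) * s ^ (d - 1) * (Real.exp (-(C0 * s)) * y s)
      + s ^ d * (Real.exp (-(C0 * s)) * (-C0) * y s + Real.exp (-(C0 * s)) * y' s)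
      - 2 * B * ((d : ℝ) / 2 * s ^ ((d : ℝ) / 2 - 1))) s := by
    intro s hs
    have he : HasDerivAt (fun r : ℝ => Real.exp (-(C0 * r))) (Real.exp (-(C0 * s)) * (-C0)) s := by
      have : HasDerivAt (fun r : ℝ => -(C0 * r)) (-C0) s := by
        simpa [Pi.neg_def] using ((hasDerivAt_id s).const_mul C0).neg
      exact this.exp
    exact ((hasDerivAt_pow d s).mul (he.mul (hyd s))).sub
      ((Real.hasDerivAt_rpow_const (Or.inl hs.ne')).const_mul (2 * B))
  have hanti : AntitoneOn z (Icc 0 t) := by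
    refine antitoneOn_of_deriv_nonpos (convex_Icc 0 t) hzc.continuousOn ?_ ?_
    · intro s hs
      rw [interior_Icc] at hs
      exact (hzd s hs.1).differentiableAt.differentiableWithinAt
    · intro s hs
      rw [interior_Icc] at hs
      have hs0 := hs.1
      rw [(hzd s hs0).deriv]
      obtain ⟨n, rfl⟩ : ∃ n, d = n + 1 := ⟨d - 1, by omega⟩
      have h1 := hineq s hs0
      have e1 : s ^ n * s ^ (-(((n + 1 : ℕ) : ℝ) / 2)) = s ^ (((n + 1 : ℕ) : ℝ) / 2 - 1) := by
        rw [← Real.rpow_natCast, ← Real.rpow_add hs0]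
        congr 1; push_cast; ring
      have hexp : Real.exp (-(C0 * s)) ≤ 1 := Real.exp_le_one_iff.2 (by
        have := mul_nonneg hC0n hs0.le; linarith)
      have hexp0 := Real.exp_pos (-(C0 * s))
      have h2 : s ^ n * Real.exp (-(C0 * s)) * (s * y' s)
          ≤ s ^ n * Real.exp (-(C0 * s)) * (-(((n + 1 : ℕ) : ℝ) * y s)
            + ((n + 1 : ℕ) : ℝ) * (B * s ^ (-(((n + 1 : ℕ) : ℝ) / 2))) + C0 * s * y s) := by
        gcongr
      have h3 : Real.exp (-(C0 * s)) * (((n + 1 : ℕ) : ℝ) * B * s ^ (((n + 1 : ℕ) : ℝ) / 2 - 1))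
          ≤ 1 * (((n + 1 : ℕ) : ℝ) * B * s ^ (((n + 1 : ℕ) : ℝ) / 2 - 1)) := by
        gcongr
      have h4 : s ^ n * Real.exp (-(C0 * s)) * (((n + 1 : ℕ) : ℝ) *
          (B * s ^ (-(((n + 1 : ℕ) : ℝ) / 2))))
          = Real.exp (-(C0 * s)) * (((n + 1 : ℕ) : ℝ) * B * s ^ (((n + 1 : ℕ) : ℝ) / 2 - 1)) := by
        rw [← e1]; ring
      rw [Nat.add_sub_cancel, pow_succ]
      linarith
  have h := hanti (left_mem_Icc.2 ht.le) (right_mem_Icc.2 ht.le) ht.le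
  have hz0 : z 0 = 0 := by
    simp only [hz]
    rw [zero_pow (by omega), Real.zero_rpow (by positivity)]; ring
  rw [hz0] at h
  simp only [hz] at h
  have hexp : Real.exp (C0 * t) ≤ Real.exp (C0 * T) := by gcongr
  have ht2 : (0 : ℝ) < t ^ ((d : ℝ) / 2) := Real.rpow_pos_of_pos ht _
  have e2 : t ^ d = t ^ ((d : ℝ) / 2) * t ^ ((d : ℝ) / 2) := by
    rw [← Real.rpow_add ht, add_halves, Real.rpow_natCast]
  have h6 : t ^ ((d : ℝ) / 2) * (Real.exp (-(C0 * t)) * y t) ≤ 2 * B := by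
    refine le_of_mul_le_mul_left ?_ ht2
    rw [← mul_assoc, ← e2]; linarith
  have h7 : y t ≤ 2 * B * Real.exp (C0 * t) * t ^ (-((d : ℝ) / 2)) := by
    rw [Real.rpow_neg ht.le, ← div_eq_mul_inv, le_div_iff₀ ht2]
    have h8 := mul_le_mul_of_nonneg_right h6 (Real.exp_pos (C0 * t)).le
    have h9 : Real.exp (-(C0 * t)) * Real.exp (C0 * t) = 1 := by
      rw [← Real.exp_add]; simp
    calc y t * t ^ ((d : ℝ) / 2)
        = t ^ ((d : ℝ) / 2) * y t * (Real.exp (-(C0 * t)) * Real.exp (C0 * t)) := by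
          rw [h9]; ring
      _ = t ^ ((d : ℝ) / 2) * (Real.exp (-(C0 * t)) * y t) * Real.exp (C0 * t) := by ring
      _ ≤ _ := h8
  refine h7.trans ?_
  have h10 : B = (2 / √ε) ^ d * Δx ^ d := by rw [hB, ← mul_pow]; congr 1; ring
  have h11 : 0 ≤ t ^ (-((d : ℝ) / 2)) := by positivity
  rw [h10]
  calc 2 * ((2 / √ε) ^ d * Δx ^ d) * Real.exp (C0 * t) * t ^ (-((d : ℝ) / 2))
      ≤ 2 * ((2 / √ε) ^ d * Δx ^ d) * Real.exp (C0 * T) * t ^ (-((d : ℝ) / 2)) := by gcongr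
    _ = _ := by ring

/-! ### Symmetry in one dimension -/

/-- Detailed balance. With a single coefficient the generator is `c ∇²` and its transpose `∇² c`, so
multiplication by `c` intertwines the two. -/
lemma mul_heatRow_comm (Δx : ℝ) (c : Fin 1 → BddGrid 1) (t : ℝ) (α β : Grid 1) :
    c 0 β * heatRow Δx c t α β = c 0 α * heatRow Δx c t β α := by
  have hint : ∀ v : SumGrid 1, (toBdd ∘L mulSum (c 0)) (transposeGen Δx c v)
      = heatGen Δx c ((toBdd ∘L mulSum (c 0)) v) := fun v => by
    ext γ
    rw [heatGen_apply']
    simp [transposeGen, sub_eq_add_neg]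
    ring
  have h := evol_intertwine (toBdd ∘L mulSum (c 0)) hint t (unitMass α)
  have h0 : (toBdd ∘L mulSum (c 0)) (unitMass α) = c 0 α • unitBdd α := by
    ext γ
    by_cases hγ : γ = α
    · subst hγ; simp [unitMass_apply, unitBdd_apply]
    · simp [unitMass_apply, unitBdd_apply, hγ]
  rw [h0, map_smul] at h
  have := congrArg (fun g : BddGrid 1 => g β) h
  rw [heatRow_apply Δx c t β α]
  simpa [heatRow, heat] using this

lemma heatRow_add (Δx : ℝ) (c : Fin d → BddGrid d) (s t : ℝ) (α β : Grid d) :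
    heatRow Δx c (s + t) α β = ∑' γ, heatRow Δx c s α γ * heatRow Δx c t γ β := by
  rw [heatRow_apply, heat, evol_add_apply]
  change heat Δx c s (heat Δx c t (unitBdd β)) α = _
  rw [heat_apply_eq_pairing, pairing_apply]
  simp only [heatRow_apply]

/-- Write the kernel at time `t` as a product of two kernels at time `t / 2`, turn the column into a
row by detailed balance at the cost of `cmax / cmin`, and apply the `ℓ²` bound to both rows. -/
lemma exists_heatRow_sup_bound {cmin : ℝ} (hcmin : 0 < cmin) (cmax L T : ℝ) :
    ∃ C : ℝ, 0 ≤ C ∧ ∀ (Δx : ℝ) (c : Fin 1 → BddGrid 1), 0 < Δx → (∀ j α, cmin ≤ c j α) →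
      (∀ j α, c j α ≤ cmax) →
      (∀ j k α, |diffPlus Δx k (c j) α| ≤ L) → ∀ (t : ℝ), 0 < t → t ≤ T → ∀ α β,
        heatRow Δx c t α β ≤ C * Δx * t ^ (-(1 / 2) : ℝ) := by
  obtain ⟨C, hC, h⟩ := exists_heatRow_sq_bound (d := 1) le_rfl hcmin L T
  refine ⟨|cmax| / cmin * C * 2 ^ (1 / 2 : ℝ), by positivity,
    fun Δx c hΔ hlow hup hL t ht htT α β => ?_⟩
  have ht2 : 0 < t / 2 := by positivity
  have hc0 : ∀ j α, 0 ≤ c j α := fun j α => hcmin.le.trans (hlow j α)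
  have hb := h Δx c hΔ hlow hL (t / 2) ht2 (by linarith)
  set Q := C * Δx ^ 1 * (t / 2) ^ (-(((1 : ℕ) : ℝ) / 2)) with hQ
  have hterm : ∀ γ, heatRow Δx c (t / 2) α γ * heatRow Δx c (t / 2) γ β
      ≤ |cmax| / cmin * (1 / 2 * heatRow Δx c (t / 2) α γ ^ 2
        + 1 / 2 * heatRow Δx c (t / 2) β γ ^ 2) := fun γ => by
    have h1 := heatRow_nonneg (Δx := Δx) hc0 ht2.le α γ
    have h2 := heatRow_nonneg (Δx := Δx) hc0 ht2.le β γ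
    have h3 : heatRow Δx c (t / 2) γ β = c 0 γ / c 0 β * heatRow Δx c (t / 2) β γ := by
      have := mul_heatRow_comm Δx c (t / 2) γ β
      have hne : c 0 β ≠ 0 := (hcmin.trans_le (hlow 0 β)).ne'
      field_simp
      linarith
    have h4 : c 0 γ / c 0 β ≤ |cmax| / cmin := by
      have := hlow 0 β
      have := (hup 0 γ).trans (le_abs_self cmax)
      gcongr
    rw [h3]
    calc heatRow Δx c (t / 2) α γ * (c 0 γ / c 0 β * heatRow Δx c (t / 2) β γ)
        = c 0 γ / c 0 β * (heatRow Δx c (t / 2) α γ * heatRow Δx c (t / 2) β γ) := by ring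
      _ ≤ |cmax| / cmin * (heatRow Δx c (t / 2) α γ * heatRow Δx c (t / 2) β γ) := by gcongr
      _ ≤ _ := by
        gcongr
        nlinarith [sq_nonneg (heatRow Δx c (t / 2) α γ - heatRow Δx c (t / 2) β γ)]
  have hs1 := (summable_sq (heatRow Δx c (t / 2) α)).mul_left (1 / 2)
  have hs2 := (summable_sq (heatRow Δx c (t / 2) β)).mul_left (1 / 2)
  have hs : Summable fun γ => heatRow Δx c (t / 2) α γ * heatRow Δx c (t / 2) γ β :=
    Summable.of_nonneg_of_le (fun γ => mul_nonneg (heatRow_nonneg hc0 ht2.le α γ)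
      (heatRow_nonneg hc0 ht2.le γ β)) hterm ((hs1.add hs2).mul_left _)
  have h5 : heatRow Δx c t α β ≤ |cmax| / cmin * Q := by
    rw [← add_halves t, heatRow_add]
    refine (hs.tsum_le_tsum hterm ((hs1.add hs2).mul_left _)).trans ?_
    rw [tsum_mul_left, hs1.tsum_add hs2, tsum_mul_left, tsum_mul_left]
    gcongr
    linarith [hb α, hb β]
  refine h5.trans (le_of_eq ?_)
  rw [hQ, Real.div_rpow ht.le zero_le_two, Real.rpow_neg zero_le_two]
  norm_num
  ring


/-! ### Norms -/

lemma eLpNorm_top_grid {Δx : ℝ} (hΔ : 0 < Δx) (f : Grid d → ℝ) :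
    eLpNorm f ∞ (gridMeasure d Δx) = ⨆ α, ‖f α‖ₑ := by
  rw [eLpNorm_exponent_top, gridMeasure, eLpNormEssSup_ennreal_smul_measure, eLpNormEssSup_count]
  exact (ENNReal.ofReal_pos.2 (by positivity)).ne'

lemma eLpNorm_top_le_iff {Δx : ℝ} (hΔ : 0 < Δx) (f : Grid d → ℝ) {m : ℝ} (hm : 0 ≤ m) :
    eLpNorm f ∞ (gridMeasure d Δx) ≤ ENNReal.ofReal m ↔ ∀ α, |f α| ≤ m := by
  rw [eLpNorm_top_grid hΔ, iSup_le_iff]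
  refine forall_congr' fun α => ?_
  rw [← ofReal_norm, ENNReal.ofReal_le_ofReal_iff hm, Real.norm_eq_abs]

lemma eLpNorm_top_coe {Δx : ℝ} (hΔ : 0 < Δx) (g : BddGrid d) :
    eLpNorm g ∞ (gridMeasure d Δx) = ENNReal.ofReal ‖g‖ := by
  refine le_antisymm ((eLpNorm_top_le_iff hΔ _ (norm_nonneg _)).2 (abs_apply_le g)) ?_
  rcases eq_or_ne (eLpNorm g ∞ (gridMeasure d Δx)) ∞ with h | h
  · rw [h]; exact le_top
  · rw [← ENNReal.ofReal_toReal h]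
    refine ENNReal.ofReal_le_ofReal (norm_le_of_abs_le ?_)
    exact (eLpNorm_top_le_iff hΔ _ ENNReal.toReal_nonneg).1 (ENNReal.ofReal_toReal h).ge

lemma exists_coe_eq {Δx : ℝ} (hΔ : 0 < Δx) {f : Grid d → ℝ}
    (h : eLpNorm f ∞ (gridMeasure d Δx) < ∞) : ∃ g : BddGrid d, f = g := by
  have := (eLpNorm_top_le_iff hΔ f ENNReal.toReal_nonneg).1 (ENNReal.ofReal_toReal h.ne).ge
  exact ⟨ofBdd f _ this, rfl⟩

lemma MemLpGrid.exists_coe {Δx : ℝ} (hΔ : 0 < Δx) {p : ℝ≥0∞} {f : Grid d → ℝ}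
    (h : MemLpGrid Δx p f) : ∃ g : BddGrid d, f = g :=
  exists_coe_eq hΔ h.1.2

lemma eLpNorm_grid {Δx : ℝ} {p : ℝ≥0∞} (h0 : p ≠ 0) (hp : p ≠ ∞) (f : Grid d → ℝ) :
    eLpNorm f p (gridMeasure d Δx)
      = (ENNReal.ofReal (Δx ^ d) * ∑' α, ‖f α‖ₑ ^ p.toReal) ^ (1 / p.toReal) := by
  rw [eLpNorm_eq_lintegral_rpow_enorm_toReal h0 hp, gridMeasure, lintegral_smul_measure,
    lintegral_count, smul_eq_mul]

lemma summable_rpow_of_eLpNorm_le {Δx : ℝ} (hΔ : 0 < Δx) {p : ℝ≥0∞} (h0 : p ≠ 0) (hp : p ≠ ∞)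
    {f : Grid d → ℝ} {m : ℝ} (hm : 0 ≤ m)
    (h : eLpNorm f p (gridMeasure d Δx) ≤ ENNReal.ofReal m) :
    (Summable fun α => |f α| ^ p.toReal) ∧
      Δx ^ d * ∑' α, |f α| ^ p.toReal ≤ m ^ p.toReal := by
  have hP : 0 < p.toReal := ENNReal.toReal_pos h0 hp
  rw [eLpNorm_grid h0 hp, one_div, ENNReal.rpow_inv_le_iff hP,
    ENNReal.ofReal_rpow_of_nonneg hm hP.le] at h
  have hterm : ∀ α, ‖f α‖ₑ ^ p.toReal = ENNReal.ofReal (|f α| ^ p.toReal) := fun α => by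
    rw [← ofReal_norm, ENNReal.ofReal_rpow_of_nonneg (norm_nonneg _) hP.le,
      Real.norm_eq_abs]
  have hΔd : ENNReal.ofReal (Δx ^ d) ≠ 0 := (ENNReal.ofReal_pos.2 (by positivity)).ne'
  simp_rw [hterm] at h
  have hfin : ∑' α, ENNReal.ofReal (|f α| ^ p.toReal) ≠ ∞ := fun h' => by
    rw [h', ENNReal.mul_top hΔd] at h
    exact absurd h (by simp)
  have hs : Summable fun α => |f α| ^ p.toReal := by
    have := ENNReal.summable_toReal hfin
    refine this.congr fun α => ?_
    rw [ENNReal.toReal_ofReal (by positivity)]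
  refine ⟨hs, ?_⟩
  rw [← ENNReal.ofReal_tsum_of_nonneg (fun _ => by positivity) hs,
    ← ENNReal.ofReal_mul (by positivity)] at h
  exact (ENNReal.ofReal_le_ofReal_iff (by positivity)).1 h

/-! ### Smoothing from `L^p` to `L^∞` -/

/-- Jensen's inequality for a probability vector, as Hölder's inequality for the splitting `w =
w^(1/q') w^(1/q)`. -/
lemma tsum_mul_le_of_convex {w g : Grid d → ℝ} (hw : ∀ α, 0 ≤ w α) (hws : Summable w)
    (hw1 : ∑' α, w α = 1) (hg : ∀ α, 0 ≤ g α) {q : ℝ} (hq : 1 < q)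
    (hs : Summable fun α => w α * g α ^ q) :
    ∑' α, w α * g α ≤ (∑' α, w α * g α ^ q) ^ (1 / q) := by
  have hpq := (Real.HolderConjugate.conjExponent hq).symm
  set q' := q.conjExponent
  have e1 : ∀ α, (w α ^ (1 / q')) ^ q' = w α := fun α => by
    rw [← Real.rpow_mul (hw α), one_div_mul_cancel hpq.ne_zero, Real.rpow_one]
  have e2 : ∀ α, (w α ^ (1 / q) * g α) ^ q = w α * g α ^ q := fun α => by
    rw [Real.mul_rpow (by have := hw α; positivity) (hg α), ← Real.rpow_mul (hw α),
      one_div_mul_cancel hpq.symm.ne_zero, Real.rpow_one]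
  have e3 : ∀ α, w α ^ (1 / q') * (w α ^ (1 / q) * g α) = w α * g α := fun α => by
    rw [← mul_assoc, ← Real.rpow_add_of_nonneg (hw α) hpq.one_div_nonneg hpq.symm.one_div_nonneg,
      one_div, one_div, hpq.inv_add_inv_eq_one, Real.rpow_one]
  have := Real.inner_le_Lp_mul_Lq_tsum_of_nonneg hpq (f := fun α => w α ^ (1 / q'))
    (g := fun α => w α ^ (1 / q) * g α) (fun α => by have := hw α; positivity)
    (fun α => mul_nonneg (by have := hw α; positivity) (hg α)) (by simpa only [e1] using hws)
    (by simpa only [e2] using hs)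
  simp only [e1, e2, e3, hw1, Real.one_rpow, one_mul] at this
  exact this

lemma norm_heat_le_of_tsum_le {Δx : ℝ} {c : Fin d → BddGrid d} (hc : ∀ j α, 0 ≤ c j α) {t : ℝ}
    (ht : 0 ≤ t) (G : BddGrid d) {q D : ℝ} (hq : 1 < q)
    (hD : ∀ α, (Summable fun β => heatRow Δx c t α β * |G β| ^ q) ∧
      ∑' β, heatRow Δx c t α β * |G β| ^ q ≤ D) :
    ‖heat Δx c t G‖ ≤ D ^ (1 / q) := by
  refine norm_le_of_abs_le fun α => ?_
  have hw := heatRow_nonneg (Δx := Δx) hc ht α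
  have h1 : |heat Δx c t G α| ≤ ∑' β, heatRow Δx c t α β * |G β| := by
    rw [heat_apply_eq_pairing, pairing_apply]
    have hs : Summable fun β => heatRow Δx c t α β * |G β| :=
      (summable_mul_bdd (heatRow Δx c t α) G).abs.congr fun β => by
        rw [abs_mul, abs_of_nonneg (hw β)]
    rw [← Real.norm_eq_abs]
    refine tsum_of_norm_bounded hs.hasSum fun β => ?_
    rw [Real.norm_eq_abs, abs_mul, abs_of_nonneg (hw β)]
  refine h1.trans ((tsum_mul_le_of_convex hw (summable_coe _) (tsum_heatRow Δx c t α)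
    (fun β => abs_nonneg _) hq (hD α).1).trans ?_)
  exact Real.rpow_le_rpow (tsum_nonneg fun β => mul_nonneg (hw β) (by positivity)) (hD α).2
    (by positivity)

lemma rpow_conj_aux {C t a m P q : ℝ} (hC : 0 ≤ C) (ht : 0 < t) (hm : 0 ≤ m) :
    (C * t ^ (-a) * m ^ (P / q)) ^ (q / P) = C ^ (q / P) * t ^ (-(a * q / P)) * m ^ (P / q * (q / P)) := by
  rw [Real.mul_rpow (by positivity) (by positivity), Real.mul_rpow hC (by positivity),
    ← Real.rpow_mul ht.le, ← Real.rpow_mul hm]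
  congr 3; ring

lemma exists_smoothing_bound (hd : 1 ≤ d) {cmin : ℝ} (hcmin : 0 < cmin) (cmax L T : ℝ) {p : ℝ≥0∞}
    (hp : (d : ℝ≥0∞) < p) :
    ∃ C : ℝ, 0 ≤ C ∧ ∃ a : ℝ, 0 ≤ a ∧ a < 1 / 2 ∧
      ∀ (Δx : ℝ) (c : Fin d → BddGrid d), 0 < Δx → (∀ j α, cmin ≤ c j α) →
      (∀ j α, c j α ≤ cmax) → (∀ j k α, |diffPlus Δx k (c j) α| ≤ L) →
      ∀ (G : BddGrid d) (m : ℝ), 0 ≤ m →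
        eLpNorm G p (gridMeasure d Δx) ≤ ENNReal.ofReal m →
        ∀ t : ℝ, 0 < t → t ≤ T → ‖heat Δx c t G‖ ≤ C * t ^ (-a) * m := by
  rcases eq_or_ne p ∞ with rfl | hpt
  · refine ⟨1, zero_le_one, 0, le_rfl, by norm_num, ?_⟩
    intro Δx c hΔ hlow hup hL G m hm hG t ht htT
    have h := norm_heat_le (Δx := Δx) (fun j α => hcmin.le.trans (hlow j α)) ht.le G
    have := norm_le_of_abs_le ((eLpNorm_top_le_iff hΔ G hm).1 hG)
    simpa using h.trans this
  have hp0 : p ≠ 0 := (zero_le.trans_lt hp).ne'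
  set P := p.toReal with hP
  have hdP : (d : ℝ) < P := by
    have := (ENNReal.toReal_lt_toReal (ENNReal.natCast_ne_top d) hpt).2 hp
    simpa using this
  have hd1 : (1 : ℝ) ≤ d := by exact_mod_cast hd
  have hP0 : 0 < P := by linarith
  rcases hd.eq_or_lt with rfl | hd2
  · obtain ⟨C, hC, hsup⟩ := exists_heatRow_sup_bound hcmin cmax L T
    -- In one dimension the pointwise kernel bound allows Jensen with the full exponent `P > 1`,
    -- giving `a = 1 / (2P)`.
    refine ⟨C ^ (1 / P), by positivity, 1 / 2 / P, by positivity, ?_, ?_⟩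
    · rw [div_lt_iff₀ hP0]; push_cast at hdP; linarith
    intro Δx c hΔ hlow hup hL G m hm hG t ht htT
    obtain ⟨hs, hle⟩ := summable_rpow_of_eLpNorm_le hΔ hp0 hpt hm hG
    have hc0 : ∀ j α, 0 ≤ c j α := fun j α => hcmin.le.trans (hlow j α)
    have hrow := hsup Δx c hΔ hlow hup hL t ht htT
    have hmain := norm_heat_le_of_tsum_le (Δx := Δx) hc0 ht.le G (q := P)
      (D := C * t ^ (-(1 / 2) : ℝ) * m ^ (P / 1)) (by simpa using hdP) fun α => by
        have hterm : ∀ β, heatRow Δx c t α β * |G β| ^ P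
            ≤ C * Δx * t ^ (-(1 / 2) : ℝ) * |G β| ^ P := fun β => by
          have := hrow α β
          gcongr
        have hs' := hs.mul_left (C * Δx * t ^ (-(1 / 2) : ℝ))
        have hs2 : Summable fun β => heatRow Δx c t α β * |G β| ^ P :=
          Summable.of_nonneg_of_le (fun β => mul_nonneg (heatRow_nonneg hc0 ht.le α β)
            (by positivity)) hterm hs'
        refine ⟨hs2, (hs2.tsum_le_tsum hterm hs').trans ?_⟩
        rw [tsum_mul_left]
        rw [pow_one] at hle
        calc C * Δx * t ^ (-(1 / 2) : ℝ) * ∑' β, |G β| ^ P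
            = C * t ^ (-(1 / 2) : ℝ) * (Δx * ∑' β, |G β| ^ P) := by ring
          _ ≤ C * t ^ (-(1 / 2) : ℝ) * m ^ (P / 1) := by rw [div_one]; gcongr
    rw [rpow_conj_aux hC ht hm] at hmain
    rwa [show P / 1 * (1 / P) = 1 by field_simp, Real.rpow_one, mul_one] at hmain
  · obtain ⟨C, hC, hsq⟩ := exists_heatRow_sq_bound hd hcmin L T
    have hd2' : (2 : ℝ) ≤ d := by exact_mod_cast hd2
    -- Jensen with exponent `P / 2 > 1`, then Cauchy–Schwarz against the row, contributes `t^(-d/4)`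
    -- to the power `2 / P`: `a = d / (2P)`. The factors `Δx ^ d` cancel.
    refine ⟨(√C) ^ (2 / P), by positivity, d / 4 * 2 / P, by positivity, ?_, ?_⟩
    · rw [div_lt_iff₀ hP0]; linarith
    intro Δx c hΔ hlow hup hL G m hm hG t ht htT
    obtain ⟨hs, hle⟩ := summable_rpow_of_eLpNorm_le hΔ hp0 hpt hm hG
    have hc0 : ∀ j α, 0 ≤ c j α := fun j α => hcmin.le.trans (hlow j α)
    have hrow := hsq Δx c hΔ hlow hL t ht htT
    have hmain := norm_heat_le_of_tsum_le (Δx := Δx) hc0 ht.le G (q := P / 2)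
      (D := √C * t ^ (-(d / 4) : ℝ) * m ^ (P / 2)) (by linarith) fun α => by
        have hw := heatRow_nonneg (Δx := Δx) hc0 ht.le α
        have hgsq : ∀ β, (|G β| ^ (P / 2)) ^ (2 : ℝ) = |G β| ^ P := fun β => by
          rw [← Real.rpow_mul (abs_nonneg _)]; congr 1; ring
        have hw2 : ∀ β, heatRow Δx c t α β ^ (2 : ℝ) = heatRow Δx c t α β ^ 2 := fun β =>
          Real.rpow_two _
        have h2 : (2 : ℝ).HolderConjugate 2 := Real.HolderConjugate.two_two
        have hf1 : Summable fun β => heatRow Δx c t α β ^ (2 : ℝ) := by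
          simpa only [hw2] using summable_sq (heatRow Δx c t α)
        have hf2 : Summable fun β => (|G β| ^ (P / 2)) ^ (2 : ℝ) := by simpa only [hgsq] using hs
        refine ⟨Real.summable_mul_of_Lp_Lq_of_nonneg h2 hw (fun β => by positivity) hf1 hf2, ?_⟩
        refine (Real.inner_le_Lp_mul_Lq_tsum_of_nonneg h2 hw (fun β => by positivity) hf1
          hf2).trans ?_
        simp only [hgsq, hw2]
        rw [← Real.sqrt_eq_rpow, ← Real.sqrt_eq_rpow]
        have h3 : ∑' β, |G β| ^ P ≤ m ^ P / Δx ^ d := by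
          rw [le_div_iff₀ (by positivity)]; linarith
        calc √(∑' β, heatRow Δx c t α β ^ 2) * √(∑' β, |G β| ^ P)
            ≤ √(C * Δx ^ d * t ^ (-((d : ℝ) / 2))) * √(m ^ P / Δx ^ d) := by
              gcongr
              exact hrow α
          _ = √(C * t ^ (-((d : ℝ) / 2)) * m ^ P) := by
              rw [← Real.sqrt_mul (by positivity)]
              congr 1; field_simp
          _ = √C * t ^ (-(d / 4) : ℝ) * m ^ (P / 2) := by
              rw [Real.sqrt_mul (by positivity), Real.sqrt_mul hC, Real.sqrt_eq_rpow (t ^ _),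
                Real.sqrt_eq_rpow (m ^ P), ← Real.rpow_mul ht.le, ← Real.rpow_mul hm]
              congr 2
              · congr 1; ring
              · ring
    rw [show 1 / (P / 2) = 2 / P by field_simp, rpow_conj_aux (Real.sqrt_nonneg C) ht hm] at hmain
    rwa [show P / 2 * (2 / P) = 1 by field_simp, Real.rpow_one] at hmain


/-! ### A Gronwall inequality with a singular kernel -/

lemma intervalIntegrable_sub_rpow {a : ℝ} (ha : a < 1) (t x y : ℝ) :
    IntervalIntegrable (fun s => (t - s) ^ (-a)) volume x y := by
  have h := (intervalIntegral.intervalIntegrable_rpow' (a := t - x) (b := t - y)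
    (r := -a) (by linarith)).comp_sub_left t
  simpa using h

lemma integral_sub_rpow {a : ℝ} (ha : a < 1) (t : ℝ) :
    ∫ s in (0 : ℝ)..t, (t - s) ^ (-a) = t ^ (1 - a) / (1 - a) := by
  rw [intervalIntegral.integral_comp_sub_left (fun r => r ^ (-a)) t, sub_self, sub_zero,
    integral_rpow (Or.inl (by linarith)), neg_add_eq_sub, Real.zero_rpow (by linarith), sub_zero]

lemma integral_sub_rpow_mul_exp_le {a lam : ℝ} (ha : a < 1) (hlam : 0 < lam) {t : ℝ} (ht : 0 ≤ t) :
    ∫ s in (0 : ℝ)..t, (t - s) ^ (-a) * Real.exp (-(lam * (t - s)))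
      ≤ (1 / lam) ^ (1 - a) * Real.Gamma (1 - a) := by
  rw [intervalIntegral.integral_comp_sub_left (fun r => r ^ (-a) * Real.exp (-(lam * r))) t,
    sub_self, sub_zero, intervalIntegral.integral_of_le ht]
  have h := Real.integral_rpow_mul_exp_neg_mul_Ioi (a := 1 - a) (r := lam) (by linarith) hlam
  rw [show 1 - a - 1 = -a by ring] at h
  have hpos : 0 < (1 / lam) ^ (1 - a) * Real.Gamma (1 - a) :=
    mul_pos (by positivity) (Real.Gamma_pos_of_pos (by linarith))
  -- Integrability is read off from the value: a non-integrable function would have integral 0, but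
  -- the Gamma value is positive.
  have hint : IntegrableOn (fun r : ℝ => r ^ (-a) * Real.exp (-(lam * r))) (Ioi 0) := by
    by_contra hn
    rw [integral_undef hn] at h
    exact hpos.ne h
  rw [← h]
  refine setIntegral_mono_set hint ?_ Ioc_subset_Ioi_self.eventuallyLE
  filter_upwards [ae_restrict_mem measurableSet_Ioi] with r hr
  have : (0 : ℝ) < r := hr
  simp only [Pi.zero_apply]; positivity

/-- In the norm weighted by `exp (-lam t)` the singular kernel has small mass, of order `lam^(a-1)`.
Evaluating at the maximum of the weighted function absorbs the integral in one step. -/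
lemma singular_gronwall {a C : ℝ} (ha : a < 1) (hC : 0 ≤ C) (T : ℝ) :
    ∃ K : ℝ, 0 ≤ K ∧ ∀ (N : ℝ → ℝ) (A F : ℝ), Continuous N → (∀ t, 0 ≤ N t) → 0 ≤ A → 0 ≤ F →
      (∀ t ∈ Icc 0 T, N t ≤ A + ∫ s in (0 : ℝ)..t, C * (t - s) ^ (-a) * (F + N s)) →
      ∀ t ∈ Icc 0 T, N t ≤ K * (A + F) := by
  set G := Real.Gamma (1 - a) with hG
  have hGpos : 0 < G := Real.Gamma_pos_of_pos (by linarith)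
  have hb : 0 < 2 * C * G + 1 := by positivity
  -- Makes `C` times the weighted mass of the kernel at most `C G / (2 C G + 1) ≤ 1/2`; the `+ 1`
  -- keeps `lam` positive when `C = 0`.
  set lam := (2 * C * G + 1) ^ (1 / (1 - a)) with hlam
  have hlampos : 0 < lam := by positivity
  have hlam2 : (1 / lam) ^ (1 - a) = 1 / (2 * C * G + 1) := by
    rw [Real.div_rpow zero_le_one hlampos.le, Real.one_rpow, hlam, ← Real.rpow_mul hb.le,
      one_div_mul_cancel (by linarith), Real.rpow_one]
  refine ⟨2 * Real.exp (lam * T), by positivity, fun N A F hN hN0 hA hF hle t ht => ?_⟩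
  obtain ⟨t0, ht0, hmax⟩ := isCompact_Icc.exists_isMaxOn (nonempty_of_mem ht)
    (f := fun s => Real.exp (-(lam * s)) * N s) (by fun_prop)
  set m := Real.exp (-(lam * t0)) * N t0 with hm
  have hm0 : 0 ≤ m := mul_nonneg (Real.exp_pos _).le (hN0 _)
  have hNm : ∀ s ∈ Icc 0 T, Real.exp (-(lam * s)) * N s ≤ m := fun s hs => hmax hs
  have hkey : m ≤ A + C * (F + m) * (1 / (2 * C * G + 1) * G) := by
    have h1 := hle t0 ht0
    have h2 : Real.exp (-(lam * t0)) * ∫ s in (0 : ℝ)..t0, C * (t0 - s) ^ (-a) * (F + N s)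
        ≤ ∫ s in (0 : ℝ)..t0,
          C * (F + m) * ((t0 - s) ^ (-a) * Real.exp (-(lam * (t0 - s)))) := by
      rw [← intervalIntegral.integral_const_mul]
      refine intervalIntegral.integral_mono_on ht0.1 ?_ ?_ fun s hs => ?_
      · exact ((((intervalIntegrable_sub_rpow ha t0 0 t0).const_mul C).mul_continuousOn
          (by fun_prop)).const_mul _)
      · exact (((intervalIntegrable_sub_rpow ha t0 0 t0).mul_continuousOn
          (by fun_prop)).const_mul _)
      · have hs0 : 0 ≤ t0 - s := sub_nonneg.2 hs.2
        have h3 : Real.exp (-(lam * t0)) * F ≤ Real.exp (-(lam * (t0 - s))) * F := by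
          gcongr
          linarith [hs.1]
        have h4 : Real.exp (-(lam * t0)) * N s ≤ Real.exp (-(lam * (t0 - s))) * m := by
          have := hNm s ⟨hs.1, hs.2.trans ht0.2⟩
          rw [show -(lam * t0) = -(lam * (t0 - s)) + -(lam * s) by ring, Real.exp_add, mul_assoc]
          gcongr
        calc Real.exp (-(lam * t0)) * (C * (t0 - s) ^ (-a) * (F + N s))
            = C * (t0 - s) ^ (-a) * (Real.exp (-(lam * t0)) * F + Real.exp (-(lam * t0)) * N s) := by
              ring
          _ ≤ C * (t0 - s) ^ (-a) *
              (Real.exp (-(lam * (t0 - s))) * F + Real.exp (-(lam * (t0 - s))) * m) := by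
              gcongr
          _ = _ := by ring
    rw [intervalIntegral.integral_const_mul] at h2
    have h5 := integral_sub_rpow_mul_exp_le ha hlampos ht0.1
    rw [hlam2] at h5
    have h6 : C * (F + m) * (∫ s in (0 : ℝ)..t0, (t0 - s) ^ (-a) * Real.exp (-(lam * (t0 - s))))
        ≤ C * (F + m) * (1 / (2 * C * G + 1) * G) := by gcongr
    have h7 : Real.exp (-(lam * t0)) * A ≤ A := by
      refine mul_le_of_le_one_left hA (Real.exp_le_one_iff.2 ?_)
      have := mul_nonneg hlampos.le ht0.1
      linarith
    have h8 := mul_le_mul_of_nonneg_left h1 (Real.exp_pos (-(lam * t0))).le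
    rw [mul_add] at h8
    linarith
  have hhalf : C * (1 / (2 * C * G + 1) * G) ≤ 1 / 2 := by
    rw [show C * (1 / (2 * C * G + 1) * G) = C * G / (2 * C * G + 1) by ring, div_le_iff₀ hb]
    linarith
  have hm2 : m ≤ 2 * (A + F) := by
    have : C * (F + m) * (1 / (2 * C * G + 1) * G) ≤ (F + m) * (1 / 2) := by
      rw [show C * (F + m) * (1 / (2 * C * G + 1) * G)
        = (F + m) * (C * (1 / (2 * C * G + 1) * G)) by ring]
      gcongr
    linarith
  have hexp : Real.exp (lam * t) * Real.exp (-(lam * t)) = 1 := by rw [← Real.exp_add]; simp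
  calc N t = Real.exp (lam * t) * (Real.exp (-(lam * t)) * N t) := by
        rw [← mul_assoc, hexp, one_mul]
    _ ≤ Real.exp (lam * T) * (2 * (A + F)) := by
        have := hNm t ht
        have h1 := (hNm t ht).trans hm2
        have := hN0 t
        have h2 : lam * t ≤ lam * T := mul_le_mul_of_nonneg_left ht.2 hlampos.le
        gcongr
    _ = _ := by ring

/-! ### Interpolation of the gradient -/

lemma abs_diffPlus_shift_sub_le {Δx H : ℝ} (hΔ : 0 < Δx) (j : Fin d) (ψ : BddGrid d)
    (hH : ‖diffPlus Δx j (diffMinus Δx j ψ)‖ ≤ H) (α : Grid d) (i : ℕ) :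
    |diffPlus Δx j ψ (α + i • unitVec j) - diffPlus Δx j ψ α| ≤ i * Δx * H := by
  induction i with
  | zero => simp
  | succ i ih =>
    have h1 : diffPlus Δx j ψ (α + (i + 1) • unitVec j) - diffPlus Δx j ψ (α + i • unitVec j)
        = Δx * diffPlus Δx j (diffMinus Δx j ψ) (α + (i + 1) • unitVec j) := by
      rw [second_diff_apply]
      simp only [diffPlus_apply, succ_nsmul, ← add_assoc, add_sub_cancel_right]
      field_simp
      ring
    have h2 : |Δx * diffPlus Δx j (diffMinus Δx j ψ) (α + (i + 1) • unitVec j)| ≤ Δx * H := by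
      rw [abs_mul, abs_of_pos hΔ]
      have := (abs_apply_le (diffPlus Δx j (diffMinus Δx j ψ)) (α + (i + 1) • unitVec j)).trans hH
      gcongr
    rw [← h1] at h2
    have := abs_sub_le (diffPlus Δx j ψ (α + (i + 1) • unitVec j))
      (diffPlus Δx j ψ (α + i • unitVec j)) (diffPlus Δx j ψ α)
    push_cast
    linarith

lemma abs_taylor_le {Δx H : ℝ} (hΔ : 0 < Δx) (j : Fin d) (ψ : BddGrid d)
    (hH : ‖diffPlus Δx j (diffMinus Δx j ψ)‖ ≤ H) (α : Grid d) (i : ℕ) :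
    |ψ (α + i • unitVec j) - ψ α - i * Δx * diffPlus Δx j ψ α| ≤ (i * Δx) ^ 2 * H := by
  have hH0 : 0 ≤ H := (norm_nonneg _).trans hH
  induction i with
  | zero => simp
  | succ i ih =>
    have h1 : ψ (α + (i + 1) • unitVec j) - ψ α - (i + 1 : ℕ) * Δx * diffPlus Δx j ψ α
        = (ψ (α + i • unitVec j) - ψ α - i * Δx * diffPlus Δx j ψ α)
          + Δx * (diffPlus Δx j ψ (α + i • unitVec j) - diffPlus Δx j ψ α) := by
      have : Δx * diffPlus Δx j ψ (α + i • unitVec j)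
          = ψ (α + (i + 1) • unitVec j) - ψ (α + i • unitVec j) := by
        rw [diffPlus_apply, mul_inv_cancel_left₀ hΔ.ne', succ_nsmul, add_assoc]
      rw [mul_sub, this]; push_cast; ring
    rw [h1]
    refine (abs_add_le _ _).trans ?_
    rw [abs_mul, abs_of_pos hΔ]
    have h2 := abs_diffPlus_shift_sub_le hΔ j ψ hH α i
    have h3 := mul_le_mul_of_nonneg_left h2 hΔ.le
    have h4 : 0 ≤ ((i : ℝ) + 1) * Δx ^ 2 * H := by positivity
    push_cast
    nlinarith

/-- Landau's inequality: by Taylor's formula over a distance of order one, a large slope would force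
a large oscillation of `ψ`. -/
lemma norm_diffPlus_le_interpolation {Δx H : ℝ} (hΔ : 0 < Δx) (j : Fin d) (ψ : BddGrid d)
    (hH : ‖diffPlus Δx j (diffMinus Δx j ψ)‖ ≤ H) :
    ‖diffPlus Δx j ψ‖ ≤ 2 * (‖ψ‖ + H) := by
  have hH0 : 0 ≤ H := (norm_nonneg _).trans hH
  refine norm_le_of_abs_le fun α => ?_
  -- For `Δx < 1` the distance `n * Δx` lies in `[1, 2]`; for `Δx ≥ 1` the difference quotient is
  -- bounded directly.
  obtain ⟨n, hn⟩ : ∃ n : ℕ, n = ⌈1 / Δx⌉₊ := ⟨_, rfl⟩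
  have hψ : ∀ β, |ψ β - ψ α| ≤ 2 * ‖ψ‖ := fun β => by
    have := abs_sub (ψ β) (ψ α)
    linarith [abs_apply_le ψ β, abs_apply_le ψ α]
  rcases le_or_gt 1 Δx with h1 | h1
  · rw [diffPlus_apply, abs_mul, abs_of_pos (inv_pos.2 hΔ)]
    have h2 : Δx⁻¹ ≤ 1 := inv_le_one_of_one_le₀ h1
    calc Δx⁻¹ * |ψ (α + unitVec j) - ψ α| ≤ 1 * (2 * ‖ψ‖) := by
          gcongr
          exact hψ _
      _ ≤ _ := by linarith
  · have hlow : 1 ≤ n * Δx := by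
      have := Nat.le_ceil (1 / Δx)
      rwa [← hn, div_le_iff₀ hΔ] at this
    have hup : n * Δx ≤ 2 := by
      have := Nat.ceil_lt_add_one (show 0 ≤ 1 / Δx by positivity)
      rw [← hn, ← sub_lt_iff_lt_add, lt_div_iff₀ hΔ] at this
      linarith
    have h2 := abs_taylor_le hΔ j ψ hH α n
    set R := (n : ℝ) * Δx
    have h3 : |R * diffPlus Δx j ψ α| ≤ 2 * ‖ψ‖ + R ^ 2 * H := by
      have e : R * diffPlus Δx j ψ α = (ψ (α + n • unitVec j) - ψ α)
          - (ψ (α + n • unitVec j) - ψ α - R * diffPlus Δx j ψ α) := by ring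
      rw [e]
      refine (abs_sub _ _).trans (add_le_add (hψ _) h2)
    rw [abs_mul, abs_of_pos (by linarith)] at h3
    have hR : 0 < R := by linarith
    have h4 : R * |diffPlus Δx j ψ α| ≤ R * (2 * (‖ψ‖ + H)) := by
      refine h3.trans ?_
      have : 0 ≤ ‖ψ‖ := norm_nonneg _
      nlinarith [mul_nonneg hR.le hH0, mul_nonneg (sub_nonneg.2 hlow) this,
        mul_nonneg (mul_nonneg hR.le (sub_nonneg.2 hup)) hH0]
    exact le_of_mul_le_mul_left h4 hR

end SemiDiscrete

namespace SemiDiscrete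

/-! ### Inhomogeneous linear equations -/

section

variable {E : Type*} [NormedAddCommGroup E] [NormedSpace ℝ E] [CompleteSpace E]

/-- The solution of `u' = B u + y`, `u(0) = x`. -/
noncomputable def affineEvol (B : E →L[ℝ] E) (x y : E) (t : ℝ) : E :=
  evol B t x + ∫ s in (0 : ℝ)..t, evol B s y

lemma affineEvol_zero (B : E →L[ℝ] E) (x y : E) : affineEvol B x y 0 = x := by
  simp [affineEvol]

lemma hasDerivAt_affineEvol (B : E →L[ℝ] E) (x y : E) (t : ℝ) :
    HasDerivAt (affineEvol B x y) (B (affineEvol B x y t) + y) t := by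
  have hc := continuous_evol_apply B y
  have h1 : HasDerivAt (fun u => ∫ s in (0 : ℝ)..u, evol B s y) (evol B t y) t :=
    intervalIntegral.integral_hasDerivAt_right (hc.intervalIntegrable _ _)
      (hc.stronglyMeasurableAtFilter _ _) hc.continuousAt
  have h2 : B (∫ s in (0 : ℝ)..t, evol B s y) = evol B t y - y := by
    rw [← ContinuousLinearMap.intervalIntegral_comp_comm _ (hc.intervalIntegrable _ _),
      intervalIntegral.integral_eq_sub_of_hasDerivAt (fun s _ => hasDerivAt_evol_apply B y s)
        ((B.continuous.comp hc).intervalIntegrable _ _)]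
    simp
  have h3 := (hasDerivAt_evol_apply B x t).add h1
  have e : B (evol B t x) + evol B t y = B (affineEvol B x y t) + y := by
    rw [affineEvol, map_add, h2]; abel
  rw [e] at h3
  exact h3

end

/-! ### Uniqueness of bounded solutions -/

/-- Integrating the inequality `n` times improves the bound `M` to `M (K t)^n / n!`. Only
componentwise derivatives are assumed, so the curve need not be differentiable in the supremum norm.
-/
lemma eq_zero_of_deriv_le {ι : Type*} {w : ℝ → ι → ℝ} {T M K : ℝ}
    (hM : ∀ t ∈ Icc 0 T, ∀ i, |w t i| ≤ M) (hcont : ∀ i, ContinuousOn (fun t => w t i) (Icc 0 T))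
    (h0 : ∀ i, w 0 i = 0)
    (hder : ∀ t ∈ Ioo 0 T, ∀ i, ∃ w', HasDerivAt (fun s => w s i) w' t ∧
      ∀ b, (∀ k, |w t k| ≤ b) → |w'| ≤ K * b) :
    ∀ t ∈ Icc 0 T, ∀ i, w t i = 0 := by
  have key : ∀ n : ℕ, ∀ t ∈ Icc 0 T, ∀ i, |w t i| ≤ M * ((K * t) ^ n / n.factorial) := by
    intro n
    induction n with
    | zero => simpa using hM
    | succ n ih =>
      intro t ht i
      set g : ℝ → ℝ := fun s => M * ((K * s) ^ (n + 1) / (n + 1).factorial) with hg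
      have hgd : ∀ s, HasDerivAt g (K * (M * ((K * s) ^ n / n.factorial))) s := fun s => by
        have h1 := ((((hasDerivAt_id s).const_mul K).pow (n + 1)).div_const
          ((n + 1).factorial : ℝ)).const_mul M
        refine h1.congr_deriv ?_
        rw [Nat.factorial_succ]; push_cast
        have : (n.factorial : ℝ) ≠ 0 := by positivity
        simp
        field_simp
      have hgc : Continuous g := by fun_prop
      have hg0 : g 0 = 0 := by simp [hg]
      have hT : 0 ≤ t := ht.1
      -- Both signs at once: `ε = 1` and `ε = -1` give the two halves of the absolute value bound.
      have hsign : ∀ ε : ℝ, |ε| = 1 → ε * w t i ≤ g t := by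
        intro ε hε
        have hanti : AntitoneOn (fun s => ε * w s i - g s) (Icc 0 T) := by
          refine antitoneOn_of_deriv_nonpos (convex_Icc 0 T)
            ((continuousOn_const.mul (hcont i)).sub hgc.continuousOn) ?_ ?_
          · intro s hs
            rw [interior_Icc] at hs
            obtain ⟨w', hw', -⟩ := hder s hs i
            exact ((hw'.const_mul ε).sub (hgd s)).differentiableAt.differentiableWithinAt
          · intro s hs
            rw [interior_Icc] at hs
            obtain ⟨w', hw', hb⟩ := hder s hs i
            have hd : HasDerivAt (fun s => ε * w s i - g s) _ s := (hw'.const_mul ε).sub (hgd s)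
            rw [hd.deriv]
            have h2 := hb _ (ih s (Ioo_subset_Icc_self hs))
            have h3 : ε * w' ≤ |w'| := by
              calc ε * w' ≤ |ε * w'| := le_abs_self _
                _ = |w'| := by rw [abs_mul, hε, one_mul]
            linarith
        have := hanti (left_mem_Icc.2 (ht.1.trans ht.2)) ht ht.1
        simp only [h0, hg0] at this
        linarith
      have h1 := hsign 1 (by simp)
      have h2 := hsign (-1) (by simp)
      exact abs_le.2 ⟨by linarith, by linarith⟩
  intro t ht i
  have hlim := (FloorSemiring.tendsto_pow_div_factorial_atTop (K * t)).const_mul M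
  rw [mul_zero] at hlim
  exact abs_nonpos_iff.1 (ge_of_tendsto' hlim fun n => key n t ht i)

variable {d : ℕ}

/-! ### Coefficients -/

lemma dist_gridPoint_add_unitVec {Δx : ℝ} (hΔ : 0 < Δx) (α : Grid d) (k : Fin d) :
    dist (gridPoint Δx (α + unitVec k)) (gridPoint Δx α) = Δx := by
  have h : gridPoint Δx (α + unitVec k) - gridPoint Δx α = EuclideanSpace.single k Δx := by
    ext i
    by_cases hi : i = k
    · subst hi; simp [gridPoint, add_mul]
    · simp [gridPoint, hi]
  rw [dist_eq_norm, h]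
  simp [abs_of_pos hΔ]

lemma IsCoefficient.exists_coe {Δx cmin cmax L : ℝ} {c : Grid d → Fin d → ℝ} (hΔ : 0 < Δx)
    (hcmin : 0 < cmin) (h : IsCoefficient Δx cmin cmax L c) :
    ∃ cb : Fin d → BddGrid d, c = (fun α j => cb j α) ∧ (∀ j α, cmin ≤ cb j α) ∧
      (∀ j α, cb j α ≤ cmax) ∧ ∀ j k α, |diffPlus Δx k (cb j) α| ≤ L := by
  have hb : ∀ j α, |c α j| ≤ cmax := fun j α => by
    rw [abs_of_pos (hcmin.trans_le (h.lower α j))]; exact h.upper α j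
  refine ⟨fun j => ofBdd (fun α => c α j) cmax (hb j), rfl, fun j α => h.lower α j,
    fun j α => h.upper α j, fun j k α => ?_⟩
  have h1 := h.lipschitz (α + unitVec k) α j
  rw [dist_gridPoint_add_unitVec hΔ] at h1
  rw [diffPlus_apply, abs_mul, abs_of_pos (inv_pos.2 hΔ), inv_mul_le_iff₀ hΔ, mul_comm Δx]
  exact h1

/-! ### The Cauchy problem with a potential -/

section

variable {Δx : ℝ} {c : Fin d → BddGrid d} {Y f ψ : BddGrid d}

/-- The solution of the Cauchy problem with potential `Y`. -/
noncomputable def cauchySol (Δx : ℝ) (c : Fin d → BddGrid d) (Y f ψ : BddGrid d) (t : ℝ) :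
    BddGrid d :=
  affineEvol (potGen Δx c Y) ψ f t

lemma hasDerivAt_cauchySol (t : ℝ) :
    HasDerivAt (cauchySol Δx c Y f ψ)
      (heatGen Δx c (cauchySol Δx c Y f ψ t) - Y * cauchySol Δx c Y f ψ t + f) t := by
  have := hasDerivAt_affineEvol (potGen Δx c Y) ψ f t
  rwa [potGen_apply] at this

lemma continuous_cauchySol : Continuous (cauchySol Δx c Y f ψ) :=
  continuous_iff_continuousAt.2 fun t => (hasDerivAt_cauchySol t).continuousAt

lemma cauchySol_zero : cauchySol Δx c Y f ψ 0 = ψ := affineEvol_zero _ _ _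

lemma isCauchySolution_cauchySol :
    IsCauchySolution Δx (fun α j => c j α) Y f ψ (fun t => cauchySol Δx c Y f ψ t) where
  bounded T := by
    obtain ⟨M, hM⟩ := (isCompact_Icc (a := (0 : ℝ)) (b := T)).exists_bound_of_continuousOn
      (continuous_cauchySol (Δx := Δx) (c := c) (Y := Y) (f := f) (ψ := ψ)).continuousOn
    exact ⟨M, fun t ht α => (abs_apply_le _ α).trans (hM t ht)⟩
  continuousOn α := ((evalAt α).continuous.comp continuous_cauchySol).continuousOn
  equation α t _ := by
    have := (evalAt α).hasFDerivAt.comp_hasDerivAt t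
      (hasDerivAt_cauchySol (Δx := Δx) (c := c) (Y := Y) (f := f) (ψ := ψ) t)
    rw [← heatGen_eq_ellipticOp]
    exact this
  initial α := by rw [cauchySol_zero]

lemma ellipticOp_sub (Δx : ℝ) (c : Grid d → Fin d → ℝ) (u v : Grid d → ℝ) (α : Grid d) :
    ellipticOp Δx c (fun β => u β - v β) α = ellipticOp Δx c u α - ellipticOp Δx c v α := by
  rw [ellipticOp, ellipticOp, ellipticOp, ← Finset.sum_sub_distrib]
  refine Finset.sum_congr rfl fun j _ => ?_
  simp only [gradPlus, gradMinus]
  ring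

lemma IsCauchySolution.unique {u v : ℝ → Grid d → ℝ}
    (hu : IsCauchySolution Δx (fun α j => c j α) Y f ψ u)
    (hv : IsCauchySolution Δx (fun α j => c j α) Y f ψ v) {t : ℝ} (ht : 0 ≤ t) (α : Grid d) :
    v t α = u t α := by
  obtain ⟨M1, hM1⟩ := hu.bounded t
  obtain ⟨M2, hM2⟩ := hv.bounded t
  refine sub_eq_zero.1 (eq_zero_of_deriv_le (w := fun s β => v s β - u s β) (T := t)
    (M := M2 + M1) (K := ‖potGen Δx c Y‖) ?_ ?_ ?_ ?_ t (right_mem_Icc.2 ht) α)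
  · exact fun s hs β => (abs_sub _ _).trans (add_le_add (hM2 s hs β) (hM1 s hs β))
  · exact fun β => ((hv.continuousOn β).sub (hu.continuousOn β)).mono Icc_subset_Ici_self
  · intro β; simp [hu.initial, hv.initial]
  · intro s hs β
    refine ⟨_, (hv.equation β s hs.1).sub (hu.equation β s hs.1), fun b hb => ?_⟩
    set g := ofBdd (fun γ => v s γ - u s γ) b hb with hg
    have h1 : potGen Δx c Y g β = ellipticOp Δx (fun α j => c j α) (v s) β - Y β * v s β + f β
        - (ellipticOp Δx (fun α j => c j α) (u s) β - Y β * u s β + f β) := by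
      have h2 : heatGen Δx c g β = ellipticOp Δx (fun α j => c j α) (v s) β
          - ellipticOp Δx (fun α j => c j α) (u s) β := by
        rw [heatGen_eq_ellipticOp, ← ellipticOp_sub]; rfl
      have h3 : g β = v s β - u s β := rfl
      rw [potGen_apply, BoundedContinuousFunction.sub_apply, BoundedContinuousFunction.mul_apply,
        h2, h3]
      ring
    rw [← h1]
    refine (abs_apply_le _ β).trans (((potGen Δx c Y).le_opNorm g).trans ?_)
    gcongr
    exact norm_le_of_abs_le hb

lemma cauchySol_nonneg (hc : ∀ j α, 0 ≤ c j α) (hf : ∀ α, 0 ≤ f α) (hψ : ∀ α, 0 ≤ ψ α) {t : ℝ}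
    (ht : 0 ≤ t) (α : Grid d) : 0 ≤ cauchySol Δx c Y f ψ t α := by
  have h1 := evol_potGen_nonneg Δx hc Y ht hψ α
  have h2 : (∫ s in (0 : ℝ)..t, evol (potGen Δx c Y) s f) α
      = ∫ s in (0 : ℝ)..t, evol (potGen Δx c Y) s f α :=
    ((evalAt α).intervalIntegral_comp_comm
      ((continuous_evol_apply (potGen Δx c Y) f).intervalIntegrable _ _)).symm
  have h3 : 0 ≤ ∫ s in (0 : ℝ)..t, evol (potGen Δx c Y) s f α :=
    intervalIntegral.integral_nonneg ht fun s hs => evol_potGen_nonneg Δx hc Y hs.1 hf α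
  rw [cauchySol, affineEvol, BoundedContinuousFunction.add_apply, h2]
  exact add_nonneg h1 h3

/-- The potential is treated as a source for the semigroup without potential. Smoothing from `L^p`
then sees `Y` only through `‖Y‖_p`, while the generator with `Y` would bring in its supremum. -/
lemma cauchySol_eq_duhamel (t : ℝ) :
    cauchySol Δx c Y f ψ t = heat Δx c t ψ
      + ∫ s in (0 : ℝ)..t, heat Δx c (t - s) (f - Y * cauchySol Δx c Y f ψ s) := by
  have hcont := continuous_cauchySol (Δx := Δx) (c := c) (Y := Y) (f := f) (ψ := ψ)
  have := eq_evol_add_integral (heatGen Δx c) (G := cauchySol Δx c Y f ψ)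
    hasDerivAt_cauchySol (by fun_prop) t
  rw [cauchySol_zero] at this
  rw [this]
  congr 1
  refine intervalIntegral.integral_congr fun s _ => ?_
  change heat Δx c (t - s) _ = heat Δx c (t - s) _
  congr 1
  abel

lemma continuous_duhamel_integrand (t : ℝ) :
    Continuous fun s => heat Δx c (t - s) (f - Y * cauchySol Δx c Y f ψ s) := by
  have hcont := continuous_cauchySol (Δx := Δx) (c := c) (Y := Y) (f := f) (ψ := ψ)
  exact ((continuous_evol (heatGen Δx c)).comp (continuous_const.sub continuous_id)).clm_apply
    (by fun_prop)

end

/-- Uniform bounds for the Cauchy problem. -/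
lemma exists_cauchySol_bound (hd : 1 ≤ d) {cmin : ℝ} (hcmin : 0 < cmin) (cmax L : ℝ) {T : ℝ}
    (hT : 0 < T) {p : ℝ≥0∞} (hp : (d : ℝ≥0∞) < p) {MY Mf : ℝ} (hMY : 0 ≤ MY) (hMf : 0 ≤ Mf) :
    ∃ C : ℝ, 0 ≤ C ∧ ∀ (Δx : ℝ) (c : Fin d → BddGrid d), 0 < Δx → (∀ j α, cmin ≤ c j α) →
      (∀ j α, c j α ≤ cmax) → (∀ j k α, |diffPlus Δx k (c j) α| ≤ L) →
      ∀ Y g h ψ : BddGrid d, eLpNorm Y p (gridMeasure d Δx) ≤ ENNReal.ofReal MY →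
        eLpNorm g p (gridMeasure d Δx) ≤ ENNReal.ofReal Mf → ‖h‖ ≤ Mf →
        ∀ t ∈ Icc 0 T, ‖cauchySol Δx c Y (g + h) ψ t‖ ≤ C * (1 + ‖ψ‖) ∧
          ∀ (k : Fin d) (H : ℝ), (∀ j, ‖diffPlus Δx j (diffMinus Δx j ψ)‖ ≤ H) →
            ‖diffPlus Δx k (cauchySol Δx c Y (g + h) ψ t)‖ ≤ C * (1 + ‖ψ‖ + H) := by
  obtain ⟨C1, hC1, a, ha0, ha, hsm⟩ := exists_smoothing_bound hd hcmin cmax L T hp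
  obtain ⟨C2, hC2, hgr⟩ := exists_gradient_bound hd hcmin L T
  -- The bounded part `h` needs no smoothing; since `1 ≤ T ^ a * r ^ (-a)` for `0 < r ≤ T`, it fits
  -- under the same singular factor.
  set C3 := (C1 + T ^ a) * (1 + MY) with hC3
  have hC3n : 0 ≤ C3 := by positivity
  obtain ⟨K, hK, hgron⟩ := singular_gronwall (a := a) (by linarith) hC3n T
  set b := 1 / 2 + a with hb
  have hb1 : b < 1 := by linarith
  set C4 := C2 * (1 / 2 : ℝ) ^ (-b) * C3 with hC4
  have hC4n : 0 ≤ C4 := by positivity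
  set S := T ^ (1 - b) / (1 - b) with hS
  have hSn : 0 ≤ S := div_nonneg (by positivity) (by linarith)
  refine ⟨K * (2 * Mf + 1) + 3 * C2 + C4 * (2 * Mf + K * (2 * Mf + 1)) * S + 2, by positivity,
    fun Δx c hΔ hlow hup hL Y g h ψ hY hg hh t ht => ?_⟩
  have hc0 : ∀ j α, 0 ≤ c j α := fun j α => hcmin.le.trans (hlow j α)
  set V := cauchySol Δx c Y (g + h) ψ with hV
  have hVc : Continuous V := continuous_cauchySol
  have hsource : ∀ r, 0 < r → r ≤ T → ∀ s,
      ‖heat Δx c r (g + h - Y * V s)‖ ≤ C3 * r ^ (-a) * (2 * Mf + ‖V s‖) := by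
    intro r hr hrT s
    have h1 := hsm Δx c hΔ hlow hup hL g Mf hMf hg r hr hrT
    have h2 : eLpNorm (Y * V s : BddGrid d) p (gridMeasure d Δx) ≤ ENNReal.ofReal (MY * ‖V s‖) := by
      have h3 : eLpNorm (Y * V s : BddGrid d) p (gridMeasure d Δx)
          ≤ ENNReal.ofReal ‖V s‖ * eLpNorm Y p (gridMeasure d Δx) := by
        refine eLpNorm_le_mul_eLpNorm_of_ae_le_mul (Filter.Eventually.of_forall fun α => ?_) p
        simp only [BoundedContinuousFunction.mul_apply, norm_mul, Real.norm_eq_abs]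
        rw [mul_comm]
        exact mul_le_mul_of_nonneg_right (abs_apply_le _ _) (abs_nonneg _)
      rw [mul_comm MY, ENNReal.ofReal_mul (norm_nonneg _)]
      exact h3.trans (by gcongr)
    have h4 := hsm Δx c hΔ hlow hup hL (Y * V s) (MY * ‖V s‖) (by positivity) h2 r hr hrT
    have h5 := (norm_heat_le (Δx := Δx) hc0 hr.le h).trans hh
    have h6 : Mf ≤ T ^ a * r ^ (-a) * Mf := by
      refine le_mul_of_one_le_left hMf ?_
      rw [Real.rpow_neg hr.le, ← div_eq_mul_inv, one_le_div (by positivity)]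
      exact Real.rpow_le_rpow hr.le hrT ha0
    rw [map_sub, map_add]
    refine (norm_sub_le _ _).trans ((add_le_add (norm_add_le _ _) le_rfl).trans ?_)
    have hra : 0 ≤ r ^ (-a) := by positivity
    have hTa : 0 ≤ T ^ a := by positivity
    have hv := norm_nonneg (V s)
    calc ‖heat Δx c r g‖ + ‖heat Δx c r h‖ + ‖heat Δx c r (Y * V s)‖
        ≤ C1 * r ^ (-a) * Mf + T ^ a * r ^ (-a) * Mf + C1 * r ^ (-a) * (MY * ‖V s‖) := by linarith
      _ = r ^ (-a) * ((C1 + T ^ a) * Mf + C1 * (MY * ‖V s‖)) := by ring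
      _ ≤ r ^ (-a) * (C3 * (2 * Mf + ‖V s‖)) := by
          refine mul_le_mul_of_nonneg_left ?_ hra
          have e : C3 * (2 * Mf + ‖V s‖) = (C1 + T ^ a) * Mf + C1 * (MY * ‖V s‖)
            + ((C1 + T ^ a) * Mf + (C1 + T ^ a) * MY * (2 * Mf) + T ^ a * (MY * ‖V s‖)
              + (C1 + T ^ a) * ‖V s‖) := by rw [hC3]; ring
          rw [e]
          exact le_add_of_nonneg_right (by positivity)
      _ = _ := by ring
  have hae : ∀ x : ℝ, ∀ᵐ s ∂(volume : Measure ℝ), s ≠ x := fun x => by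
    simp [ae_iff, measure_singleton]
  have hbound : ∀ t ∈ Icc 0 T, ‖V t‖ ≤ K * (‖ψ‖ + 2 * Mf) := by
    refine hgron (fun s => ‖V s‖) ‖ψ‖ (2 * Mf) hVc.norm (fun _ => norm_nonneg _) (norm_nonneg _)
      (by positivity) fun t ht => ?_
    have e : V t = heat Δx c t ψ + ∫ s in (0 : ℝ)..t, heat Δx c (t - s) (g + h - Y * V s) :=
      cauchySol_eq_duhamel t
    rw [e]
    refine (norm_add_le _ _).trans (add_le_add (norm_heat_le hc0 ht.1 ψ) ?_)
    refine intervalIntegral.norm_integral_le_of_norm_le ht.1 ?_ ?_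
    · filter_upwards [hae t] with s hst hs
      exact hsource (t - s) (sub_pos.2 (lt_of_le_of_ne hs.2 hst))
        (by linarith [hs.1, ht.2]) s
    · exact ((intervalIntegrable_sub_rpow (by linarith) t 0 t).const_mul C3).mul_continuousOn
        (by fun_prop)
  have hbd1 : ∀ t ∈ Icc 0 T, ‖V t‖ ≤ K * (2 * Mf + 1) * (1 + ‖ψ‖) := fun t ht => by
    refine (hbound t ht).trans ?_
    rw [mul_assoc]
    refine mul_le_mul_of_nonneg_left ?_ hK
    nlinarith [norm_nonneg ψ, mul_nonneg hMf (norm_nonneg ψ)]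
  have hψ0 := norm_nonneg ψ
  refine ⟨(hbd1 t ht).trans (mul_le_mul_of_nonneg_right ?_ (by positivity)), fun k H hH => ?_⟩
  · have : 0 ≤ C4 * (2 * Mf + K * (2 * Mf + 1)) * S := by positivity
    linarith
  have hH0 : 0 ≤ H := (norm_nonneg _).trans (hH k)
  -- The gradient bound for the semigroup requires positive time; at `t = 0` interpolation of the
  -- datum is used directly.
  rcases ht.1.eq_or_lt with rfl | htpos
  · rw [hV, cauchySol_zero]
    refine (norm_diffPlus_le_interpolation hΔ k ψ (hH k)).trans ?_
    have : 0 ≤ K * (2 * Mf + 1) + 3 * C2 + C4 * (2 * Mf + K * (2 * Mf + 1)) * S := by positivity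
    nlinarith [mul_nonneg this (show 0 ≤ 1 + ‖ψ‖ + H by positivity)]
  have e : diffPlus Δx k (V t) = diffPlus Δx k (heat Δx c t ψ)
      + ∫ s in (0 : ℝ)..t, diffPlus Δx k (heat Δx c (t - s) (g + h - Y * V s)) := by
    rw [ContinuousLinearMap.intervalIntegral_comp_comm _
      ((continuous_duhamel_integrand t).intervalIntegrable _ _), ← map_add]
    congr 1
    exact cauchySol_eq_duhamel t
  set Q := 2 * Mf + K * (2 * Mf + 1) * (1 + ‖ψ‖) with hQ
  have hQ0 : 0 ≤ Q := by positivity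
  have hgrad : ∀ s, 0 ≤ s → s < t →
      ‖diffPlus Δx k (heat Δx c (t - s) (g + h - Y * V s))‖ ≤ C4 * Q * (t - s) ^ (-b) := by
    intro s hs hst
    have hr : 0 < (t - s) / 2 := by linarith
    have hrT : (t - s) / 2 ≤ T := by linarith [ht.2]
    -- Half of the elapsed time smooths `L^p` to `L^∞`, the other half pays for the gradient. The
    -- exponents add to `b = 1/2 + a`, still below 1.
    have e1 : heat Δx c (t - s) (g + h - Y * V s)
        = heat Δx c ((t - s) / 2) (heat Δx c ((t - s) / 2) (g + h - Y * V s)) := by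
      conv_lhs => rw [← add_halves (t - s)]
      exact evol_add_apply _ _ _ _
    rw [e1]
    have h1 := (hgr Δx c hlow hL (heat Δx c ((t - s) / 2) (g + h - Y * V s)) _ hr hrT k).1
    have h2 := hsource _ hr hrT s
    have h3 := hbd1 s ⟨hs, by linarith [ht.2]⟩
    have e2 : ((t - s) / 2) ^ (-(1 / 2) : ℝ) * ((t - s) / 2) ^ (-a)
        = (1 / 2 : ℝ) ^ (-b) * (t - s) ^ (-b) := by
      rw [← Real.rpow_add hr, ← Real.mul_rpow (by norm_num) (by linarith)]
      congr 1
      · ring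
      · rw [hb]; ring
    calc _ ≤ C2 * ((t - s) / 2) ^ (-(1 / 2) : ℝ) * (C3 * ((t - s) / 2) ^ (-a) * (2 * Mf + ‖V s‖)) := by
          refine h1.trans ?_
          gcongr
      _ ≤ C2 * ((t - s) / 2) ^ (-(1 / 2) : ℝ) * (C3 * ((t - s) / 2) ^ (-a) * Q) := by
          rw [hQ]; gcongr
      _ = C2 * C3 * Q * (((t - s) / 2) ^ (-(1 / 2) : ℝ) * ((t - s) / 2) ^ (-a)) := by ring
      _ = _ := by rw [e2, hC4]; ring
  have hint : ‖∫ s in (0 : ℝ)..t, diffPlus Δx k (heat Δx c (t - s) (g + h - Y * V s))‖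
      ≤ ∫ s in (0 : ℝ)..t, C4 * Q * (t - s) ^ (-b) := by
    refine intervalIntegral.norm_integral_le_of_norm_le ht.1 ?_
      ((intervalIntegrable_sub_rpow hb1 t 0 t).const_mul _)
    filter_upwards [hae t] with s hst hs
    exact hgrad s hs.1.le (lt_of_le_of_ne hs.2 hst)
  rw [intervalIntegral.integral_const_mul, integral_sub_rpow hb1] at hint
  have hS2 : t ^ (1 - b) / (1 - b) ≤ S := by
    have : 0 < 1 - b := by linarith
    have := ht.2
    rw [hS]; gcongr
  have hini := (hgr Δx c hlow hL ψ t htpos ht.2 k).2 (2 * (‖ψ‖ + H))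
    (fun j => norm_diffPlus_le_interpolation hΔ j ψ (hH j))
  have hfin : C4 * Q * (t ^ (1 - b) / (1 - b)) ≤ C4 * Q * S := by gcongr
  rw [e]
  refine (norm_add_le _ _).trans ?_
  have e3 : (K * (2 * Mf + 1) + 3 * C2 + C4 * (2 * Mf + K * (2 * Mf + 1)) * S + 2) * (1 + ‖ψ‖ + H)
      = C2 * (‖ψ‖ + 2 * (‖ψ‖ + H)) + C4 * Q * S + ((K * (2 * Mf + 1) + 2) * (1 + ‖ψ‖ + H)
        + C2 * (3 + H) + C4 * S * (2 * Mf * (‖ψ‖ + H) + K * (2 * Mf + 1) * H)) := by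
    rw [hQ]; ring
  rw [e3]
  have hrest : 0 ≤ (K * (2 * Mf + 1) + 2) * (1 + ‖ψ‖ + H)
        + C2 * (3 + H) + C4 * S * (2 * Mf * (‖ψ‖ + H) + K * (2 * Mf + 1) * H) := by positivity
  linarith


/-! ### The fundamental solution -/

lemma eq_zero_of_homogeneous {Δx T M : ℝ} {c : Fin d → BddGrid d} {w : ℝ → Grid d → ℝ}
    (hM : ∀ t ∈ Icc 0 T, ∀ α, |w t α| ≤ M) (hcont : ∀ α, ContinuousOn (fun t => w t α) (Icc 0 T))
    (h0 : ∀ α, w 0 α = 0)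
    (hder : ∀ t ∈ Ioo 0 T, ∀ α,
      HasDerivAt (fun s => w s α) (ellipticOp Δx (fun α j => c j α) (w t) α) t) :
    ∀ t ∈ Icc 0 T, ∀ α, w t α = 0 := by
  refine eq_zero_of_deriv_le (K := ‖heatGen Δx c‖) hM hcont h0 fun t ht α =>
    ⟨_, hder t ht α, fun b hb => ?_⟩
  have h1 : ellipticOp Δx (fun α j => c j α) (w t) α = heatGen Δx c (ofBdd (w t) b hb) α := by
    rw [heatGen_eq_ellipticOp]; rfl
  rw [h1]
  refine (abs_apply_le _ α).trans (((heatGen Δx c).le_opNorm _).trans ?_)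
  gcongr
  exact norm_le_of_abs_le hb

/-- Passing to the kernel is a bounded linear map from operators to bounded matrices, so the kernel
inherits `C¹` dependence on time in the supremum norm from the exponential. -/
lemma contDiff_linear_evol {E F : Type*} [NormedAddCommGroup E] [NormedSpace ℝ E] [CompleteSpace E]
    [NormedAddCommGroup F] [NormedSpace ℝ F] {φ : (E →L[ℝ] E) → F} {K : ℝ}
    (hadd : ∀ S S', φ (S + S') = φ S + φ S') (hsmul : ∀ (a : ℝ) S, φ (a • S) = a • φ S)
    (hbound : ∀ S, ‖φ S‖ ≤ K * ‖S‖) (B : E →L[ℝ] E) : ContDiff ℝ 1 fun t => φ (evol B t) := by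
  let Φ : (E →L[ℝ] E) →L[ℝ] F :=
    LinearMap.mkContinuous { toFun := φ, map_add' := hadd, map_smul' := hsmul } K hbound
  have hd : ∀ t, HasDerivAt (fun t => Φ (evol B t)) (Φ (B * evol B t)) t := fun t =>
    Φ.hasFDerivAt.comp_hasDerivAt t (hasDerivAt_evol B t)
  change ContDiff ℝ 1 fun t => Φ (evol B t)
  rw [contDiff_one_iff_deriv]
  refine ⟨fun t => (hd t).differentiableAt, ?_⟩
  rw [show deriv (fun t => Φ (evol B t)) = fun t => Φ (B * evol B t) from
    funext fun t => (hd t).deriv]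
  exact Φ.continuous.comp (continuous_const.mul (continuous_evol B))

lemma norm_unitBdd_le (α : Grid d) : ‖unitBdd α‖ ≤ 1 := by
  refine norm_le_of_abs_le fun β => ?_
  by_cases h : β = α
  · subst h; simp [unitBdd_apply]
  · simp [unitBdd_apply, h]

lemma norm_mul_apply_unitBdd_le (a : ℝ) (S : BddGrid d →L[ℝ] BddGrid d) (α β : Grid d) :
    ‖a * S (unitBdd β) α‖ ≤ |a| * ‖S‖ := by
  have h := (abs_apply_le (S (unitBdd β)) α).trans (S.le_of_opNorm_le_of_le le_rfl
    (norm_unitBdd_le β))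
  rw [mul_one] at h
  rw [norm_mul, Real.norm_eq_abs, Real.norm_eq_abs]
  gcongr

/-- The kernel of an operator with respect to the grid measure. -/
noncomputable def kernel (Δx : ℝ) (S : BddGrid d →L[ℝ] BddGrid d) :
    lp (fun _ : Grid d × Grid d => ℝ) ∞ :=
  ⟨fun z => (Δx ^ d)⁻¹ * S (unitBdd z.2) z.1, memℓp_infty ⟨|(Δx ^ d)⁻¹| * ‖S‖, by
    rintro _ ⟨z, rfl⟩
    exact norm_mul_apply_unitBdd_le _ S z.1 z.2⟩⟩

lemma kernel_apply (Δx : ℝ) (S : BddGrid d →L[ℝ] BddGrid d) (α β : Grid d) :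
    kernel Δx S (α, β) = (Δx ^ d)⁻¹ * S (unitBdd β) α := rfl

lemma contDiff_kernel_heat (Δx : ℝ) (c : Fin d → BddGrid d) :
    ContDiff ℝ 1 fun t => kernel Δx (heat Δx c t) := by
  refine contDiff_linear_evol (K := |(Δx ^ d)⁻¹|) (fun S S' => ?_) (fun a S => ?_) (fun S => ?_)
    (heatGen Δx c)
  · exact Subtype.ext (funext fun z => mul_add _ _ _)
  · exact Subtype.ext (funext fun z => mul_left_comm _ _ _)
  · exact lp.norm_le_of_forall_le (by positivity) fun z =>
      norm_mul_apply_unitBdd_le _ S z.1 z.2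

lemma ellipticOp_const_mul (Δx a : ℝ) (c : Grid d → Fin d → ℝ) (u : Grid d → ℝ) (α : Grid d) :
    ellipticOp Δx c (fun β => a * u β) α = a * ellipticOp Δx c u α := by
  rw [ellipticOp, ellipticOp, Finset.mul_sum]
  refine Finset.sum_congr rfl fun j _ => ?_
  simp only [gradPlus, gradMinus]
  ring

lemma hasDerivAt_kernel_apply (Δx : ℝ) (c : Fin d → BddGrid d) (t : ℝ) (α β : Grid d) :
    HasDerivAt (fun s => kernel Δx (heat Δx c s) (α, β))
      (ellipticOp Δx (fun α j => c j α) (fun η => kernel Δx (heat Δx c t) (η, β)) α) t := by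
  have h := ((evalAt α).hasFDerivAt.comp_hasDerivAt t
    (hasDerivAt_evol_apply (heatGen Δx c) (unitBdd β) t)).const_mul (Δx ^ d)⁻¹
  have e : ellipticOp Δx (fun α j => c j α) (fun η => kernel Δx (heat Δx c t) (η, β)) α
      = (Δx ^ d)⁻¹ * heatGen Δx c (heat Δx c t (unitBdd β)) α := by
    rw [heatGen_eq_ellipticOp, ← ellipticOp_const_mul]; rfl
  rw [e]
  exact h

lemma kernel_heat_zero (Δx : ℝ) (c : Fin d → BddGrid d) (α β : Grid d) :
    kernel Δx (heat Δx c 0) (α, β) = dirac Δx (α - β) := by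
  rw [kernel_apply, heat, evol_zero, dirac]
  change (Δx ^ d)⁻¹ * unitBdd β α = _
  by_cases h : α = β
  · subst h; simp [unitBdd_apply]
  · rw [if_neg (sub_ne_zero.2 h)]; simp [unitBdd_apply, h]

lemma isFundamentalSolution_kernel (Δx T : ℝ) (c : Fin d → BddGrid d) :
    IsFundamentalSolution Δx T (fun α j => c j α) (fun t => kernel Δx (heat Δx c t)) where
  contDiffOn := (contDiff_kernel_heat Δx c).contDiffOn
  equation t _ α β := (hasDerivAt_kernel_apply Δx c t α β).hasDerivWithinAt
  initial α β := kernel_heat_zero Δx c α β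

/-- Each column is a bounded solution of the homogeneous equation with a prescribed datum, so
uniqueness applies for every fixed `β`. -/
lemma IsFundamentalSolution.eq_kernel {Δx T : ℝ} {c : Fin d → BddGrid d}
    {Γ : ℝ → lp (fun _ : Grid d × Grid d => ℝ) ∞}
    (h : IsFundamentalSolution Δx T (fun α j => c j α) Γ) {t : ℝ} (ht : t ∈ Icc 0 T)
    (α β : Grid d) : Γ t (α, β) = kernel Δx (heat Δx c t) (α, β) := by
  have h' := isFundamentalSolution_kernel Δx T c
  obtain ⟨M1, hM1⟩ := isCompact_Icc.exists_bound_of_continuousOn h.contDiffOn.continuousOn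
  obtain ⟨M2, hM2⟩ := isCompact_Icc.exists_bound_of_continuousOn h'.contDiffOn.continuousOn
  have hcoord : ∀ {G : ℝ → lp (fun _ : Grid d × Grid d => ℝ) ∞}, ContinuousOn G (Icc 0 T) →
      ∀ z, ContinuousOn (fun s => G s z) (Icc 0 T) := fun hG z =>
    (lp.evalCLM ℝ (fun _ : Grid d × Grid d => ℝ) ∞ z).continuous.comp_continuousOn hG
  refine sub_eq_zero.1 (eq_zero_of_homogeneous (Δx := Δx) (c := c)
    (w := fun s γ => Γ s (γ, β) - kernel Δx (heat Δx c s) (γ, β)) (M := M1 + M2) ?_ ?_ ?_ ?_ t ht α)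
  · intro s hs γ
    exact (abs_sub _ _).trans (add_le_add
      ((lp.norm_apply_le_norm ENNReal.top_ne_zero (Γ s) (γ, β)).trans (hM1 s hs))
      ((lp.norm_apply_le_norm ENNReal.top_ne_zero (kernel Δx (heat Δx c s)) (γ, β)).trans
        (hM2 s hs)))
  · exact fun γ => (hcoord h.contDiffOn.continuousOn (γ, β)).sub
      (hcoord h'.contDiffOn.continuousOn (γ, β))
  · intro γ; simp only [h.initial, h'.initial, sub_self]
  · intro s hs γ
    rw [ellipticOp_sub]
    exact ((h.equation s ⟨hs.1, hs.2.le⟩ γ β).hasDerivAt (Icc_mem_nhds hs.1 hs.2)).sub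
      (hasDerivAt_kernel_apply Δx c s γ β)

lemma IsFundamentalSolution.mul_eq {Δx T : ℝ} (hΔ : 0 < Δx) {c : Fin d → BddGrid d}
    {Γ : ℝ → lp (fun _ : Grid d × Grid d => ℝ) ∞}
    (h : IsFundamentalSolution Δx T (fun α j => c j α) Γ) {t : ℝ} (ht : t ∈ Icc 0 T)
    (α η : Grid d) (x : ℝ) : Γ t (α, η) * x * Δx ^ d = heatRow Δx c t α η * x := by
  have : Δx ^ d ≠ 0 := by positivity
  rw [h.eq_kernel ht, kernel_apply, ← heatRow_apply]
  field_simp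

lemma hasSum_heatRow (Δx : ℝ) (c : Fin d → BddGrid d) (t : ℝ) (α : Grid d) (g : BddGrid d) :
    HasSum (fun η => heatRow Δx c t α η * g η) (heat Δx c t g α) := by
  rw [heat_apply_eq_pairing, pairing_apply]
  exact (summable_mul_bdd _ g).hasSum

lemma continuous_heatRow_apply (Δx : ℝ) (c : Fin d → BddGrid d) (α η : Grid d) :
    Continuous fun t => heatRow Δx c t α η := by
  simp only [heatRow_apply]
  exact (evalAt α).continuous.comp (continuous_evol_apply (heatGen Δx c) (unitBdd η))

/-! ### Sources that are integrable in time -/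

/-- The source is only known to be measurable coordinate by coordinate. The value at `α` is a limit
of finite sums over coordinates, which avoids any measurability of `F` in the supremum norm. -/
lemma aestronglyMeasurable_heat {Ω : Type*} [MeasurableSpace Ω] {μ : Measure Ω} (Δx : ℝ)
    (c : Fin d → BddGrid d) {τ : Ω → ℝ} (hτ : Measurable τ) {F : Ω → BddGrid d}
    (hF : ∀ η, AEStronglyMeasurable (fun ω => F ω η) μ) (α : Grid d) :
    AEStronglyMeasurable (fun ω => heat Δx c (τ ω) (F ω) α) μ := by
  refine aestronglyMeasurable_of_tendsto_ae Filter.atTop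
    (f := fun (s : Finset (Grid d)) ω => ∑ η ∈ s, heatRow Δx c (τ ω) α η * F ω η) (fun s => ?_)
    (Filter.Eventually.of_forall fun ω => hasSum_heatRow Δx c (τ ω) α (F ω))
  refine Finset.aestronglyMeasurable_fun_sum s fun η _ => ?_
  exact ((continuous_heatRow_apply Δx c α η).measurable.comp hτ).aestronglyMeasurable.mul (hF η)

/-- On a fixed grid each value is at most `Δx^(-d/p)` times the `L^p` norm, so the source lies in
`L^q`, hence in `L¹`, of time with values in bounded functions. Off the good times it is replaced by
0. -/
lemma MemLqLpGrid.exists_bounded {Δx T : ℝ} (hΔ : 0 < Δx) {p q : ℝ≥0∞} (hp : p ≠ 0) (hq : 1 ≤ q)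
    {f : ℝ → Grid d → ℝ} (hf : MemLqLpGrid Δx T q p f) :
    ∃ F : ℝ → BddGrid d, (∀ᵐ s ∂(volume.restrict (Icc 0 T)), f s = F s) ∧
      (∀ η, AEStronglyMeasurable (fun s => F s η) (volume.restrict (Icc 0 T))) ∧
      Integrable (fun s => ‖F s‖) (volume.restrict (Icc 0 T)) := by
  classical
  let F : ℝ → BddGrid d := fun s =>
    if h : ∃ g : BddGrid d, f s = g then h.choose else 0
  have hF : ∀ᵐ s ∂(volume.restrict (Icc 0 T)), f s = F s := by
    filter_upwards [hf.mem] with s hs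
    have h := hs.exists_coe hΔ
    simp only [F, dif_pos h]
    exact h.choose_spec
  have hFm : ∀ η, AEStronglyMeasurable (fun s => F s η) (volume.restrict (Icc 0 T)) := fun η =>
    (hf.measurable η).congr (by filter_upwards [hF] with s hs; rw [hs])
  have hnorm : ∀ g : BddGrid d, ‖g‖ = (⨆ η, ‖g η‖ₑ).toReal := fun g => by
    rw [← eLpNorm_top_grid hΔ, eLpNorm_top_coe hΔ, ENNReal.toReal_ofReal (norm_nonneg _)]
  have hmeas : AEStronglyMeasurable (fun s => ‖F s‖) (volume.restrict (Icc 0 T)) := by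
    simp only [hnorm]
    -- The supremum norm is measurable as a supremum over the countable grid.
    exact (AEMeasurable.iSup fun η => (hFm η).enorm).ennreal_toReal.aestronglyMeasurable
  refine ⟨F, hF, hFm, ?_⟩
  set κ := ENNReal.ofReal (Δx ^ d) with hκ
  have hκ0 : κ ≠ 0 := (ENNReal.ofReal_pos.2 (by positivity)).ne'
  set A := κ ^ (1 / p).toReal with hA
  have hA0 : A ≠ 0 := by
    rw [hA]
    exact (ENNReal.rpow_pos (pos_iff_ne_zero.2 hκ0) ENNReal.ofReal_ne_top).ne'
  have hAtop : A ≠ ∞ := by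
    rw [hA]
    exact ENNReal.rpow_ne_top_of_nonneg ENNReal.toReal_nonneg ENNReal.ofReal_ne_top
  have hle : ∀ᵐ s ∂(volume.restrict (Icc 0 T)),
      ‖‖F s‖‖ₑ ≤ (A⁻¹).toNNReal * ‖eLpNorm (f s) p (gridMeasure d Δx)‖ₑ := by
    filter_upwards [hF] with s hs
    rw [hs, ENNReal.coe_toNNReal (ENNReal.inv_ne_top.2 hA0), enorm_eq_self, gridMeasure,
      eLpNorm_smul_measure_of_ne_zero hκ0, smul_eq_mul, ← mul_assoc,
      ENNReal.inv_mul_cancel hA0 hAtop, one_mul, enorm_norm, ← ofReal_norm,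
      ← eLpNorm_top_coe hΔ, eLpNorm_top_grid hΔ]
    exact iSup_le fun η => enorm_le_eLpNorm_count (F s) η hp
  have hmem : MemLp (fun s => ‖F s‖) q (volume.restrict (Icc 0 T)) := by
    refine ⟨hmeas, (eLpNorm_le_mul_eLpNorm_of_ae_le_mul' hle q).trans_lt ?_⟩
    exact ENNReal.mul_lt_top ENNReal.coe_lt_top hf.norm_lt_top
  exact memLp_one_iff_integrable.1 (hmem.mono_exponent hq)


/-! ### Duhamel's formula -/

section Duhamel

variable {Δx T : ℝ} {c : Fin d → BddGrid d} {F : ℝ → BddGrid d}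

/-- The response of the semidiscrete heat equation to the source `F`, with zero initial datum. -/
noncomputable def response (Δx : ℝ) (c : Fin d → BddGrid d) (F : ℝ → BddGrid d) (t : ℝ)
    (α : Grid d) : ℝ :=
  ∫ s in (0 : ℝ)..t, heat Δx c (t - s) (F s) α

lemma restrict_Ioc_le {t : ℝ} (ht : t ∈ Icc 0 T) :
    volume.restrict (Ioc 0 t) ≤ volume.restrict (Icc (0 : ℝ) T) :=
  Measure.restrict_mono (Ioc_subset_Icc_self.trans (Icc_subset_Icc_right ht.2)) le_rfl

lemma intervalIntegrable_heat_sub (hc : ∀ j α, 0 ≤ c j α)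
    (hFm : ∀ η, AEStronglyMeasurable (fun s => F s η) (volume.restrict (Icc 0 T)))
    (hFi : Integrable (fun s => ‖F s‖) (volume.restrict (Icc 0 T)))
    {t : ℝ} (ht : t ∈ Icc 0 T) (α : Grid d) :
    IntervalIntegrable (fun s => heat Δx c (t - s) (F s) α) volume 0 t := by
  rw [intervalIntegrable_iff_integrableOn_Ioc_of_le ht.1]
  refine Integrable.mono' (hFi.mono_measure (restrict_Ioc_le ht))
    (aestronglyMeasurable_heat Δx c (measurable_const.sub measurable_id)
      (fun η => (hFm η).mono_measure (restrict_Ioc_le ht)) α) ?_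
  filter_upwards [ae_restrict_mem measurableSet_Ioc] with s hs
  exact (abs_apply_le _ α).trans (norm_heat_le hc (sub_nonneg.2 hs.2) _)

lemma abs_response_le (hc : ∀ j α, 0 ≤ c j α)
    (hFi : Integrable (fun s => ‖F s‖) (volume.restrict (Icc 0 T)))
    {t : ℝ} (ht : t ∈ Icc 0 T) (α : Grid d) :
    |response Δx c F t α| ≤ ∫ s in Icc 0 T, ‖F s‖ := by
  rw [response, intervalIntegral.integral_of_le ht.1, ← Real.norm_eq_abs]
  refine (norm_integral_le_of_norm_le (hFi.mono_measure (restrict_Ioc_le ht)) ?_).trans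
    (integral_mono_measure (restrict_Ioc_le ht)
      (Filter.Eventually.of_forall fun s => norm_nonneg _) hFi)
  filter_upwards [ae_restrict_mem measurableSet_Ioc] with s hs
  exact (abs_apply_le _ α).trans (norm_heat_le hc (sub_nonneg.2 hs.2) _)

lemma ellipticOp_response (hc : ∀ j α, 0 ≤ c j α)
    (hFm : ∀ η, AEStronglyMeasurable (fun s => F s η) (volume.restrict (Icc 0 T)))
    (hFi : Integrable (fun s => ‖F s‖) (volume.restrict (Icc 0 T)))
    {t : ℝ} (ht : t ∈ Icc 0 T) (α : Grid d) :
    ellipticOp Δx (fun α j => c j α) (response Δx c F t) α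
      = ∫ s in (0 : ℝ)..t, heatGen Δx c (heat Δx c (t - s) (F s)) α := by
  have hI := fun β => intervalIntegrable_heat_sub (Δx := Δx) hc hFm hFi ht β
  simp only [heatGen_apply']
  rw [intervalIntegral.integral_finsetSum fun j _ =>
    ((((hI _).add (hI _)).sub ((hI _).const_mul 2)).const_mul _).const_mul _]
  rw [ellipticOp]
  refine Finset.sum_congr rfl fun j _ => ?_
  rw [intervalIntegral.integral_const_mul, intervalIntegral.integral_const_mul,
    intervalIntegral.integral_sub ((hI _).add (hI _)) ((hI _).const_mul 2),
    intervalIntegral.integral_add (hI _) (hI _), intervalIntegral.integral_const_mul]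
  simp only [gradPlus, gradMinus, add_sub_cancel_right, response, unitVec]
  ring

lemma aestronglyMeasurable_heatGen_heat {Ω : Type*} [MeasurableSpace Ω] {μ : Measure Ω} (Δx : ℝ)
    (c : Fin d → BddGrid d) {τ : Ω → ℝ} (hτ : Measurable τ) {F : Ω → BddGrid d}
    (hF : ∀ η, AEStronglyMeasurable (fun ω => F ω η) μ) (α : Grid d) :
    AEStronglyMeasurable (fun ω => heatGen Δx c (heat Δx c (τ ω) (F ω)) α) μ := by
  have h := fun β => aestronglyMeasurable_heat Δx c hτ hF β
  simp only [heatGen_apply']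
  exact Finset.aestronglyMeasurable_fun_sum _ fun j _ =>
    ((((h _).add (h _)).sub ((h _).const_mul 2)).const_mul _).const_mul _

lemma integral_heatGen_heat (Δx : ℝ) (c : Fin d → BddGrid d) (g : BddGrid d) (α : Grid d)
    (s t : ℝ) :
    ∫ r in s..t, heatGen Δx c (heat Δx c (r - s) g) α = heat Δx c (t - s) g α - g α := by
  have hder : ∀ r, HasDerivAt (fun r => heat Δx c (r - s) g α)
      (heatGen Δx c (heat Δx c (r - s) g) α) r := fun r =>
    ((evalAt α).hasFDerivAt.comp_hasDerivAt (r - s)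
      (hasDerivAt_evol_apply (heatGen Δx c) g (r - s))).comp_sub_const r s
  have hcont : Continuous fun r => heatGen Δx c (heat Δx c (r - s) g) α :=
    (evalAt α).continuous.comp ((heatGen Δx c).continuous.comp
      ((continuous_evol_apply (heatGen Δx c) g).comp (continuous_sub_right s)))
  rw [intervalIntegral.integral_eq_sub_of_hasDerivAt (fun r _ => hder r)
    (hcont.intervalIntegrable _ _), sub_self]
  simp [heat]

/-- The source need not be continuous, so the response is not differentiated directly. Fubini on the
triangle `s < r` and `∫_s^t A S(r-s) F(s) dr = S(t-s) F(s) - F(s)` give the equation in integrated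
form. -/
lemma response_eq_integral (hc : ∀ j α, 0 ≤ c j α)
    (hFm : ∀ η, AEStronglyMeasurable (fun s => F s η) (volume.restrict (Icc 0 T)))
    (hFi : Integrable (fun s => ‖F s‖) (volume.restrict (Icc 0 T)))
    {t : ℝ} (ht : t ∈ Icc 0 T) (α : Grid d) :
    IntervalIntegrable (fun r => ellipticOp Δx (fun α j => c j α) (response Δx c F r) α + F r α)
        volume 0 t ∧
      response Δx c F t α
        = ∫ r in (0 : ℝ)..t, (ellipticOp Δx (fun α j => c j α) (response Δx c F r) α + F r α) := by
  set μ := volume.restrict (Ioc 0 t) with hμ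
  have hμle : μ ≤ volume.restrict (Icc (0 : ℝ) T) := restrict_Ioc_le ht
  set G : ℝ → ℝ → ℝ := fun r s => heatGen Δx c (heat Δx c (r - s) (F s)) α with hG
  -- Cutting off to `s < r` keeps all semigroup times positive, so contraction dominates the kernel
  -- by `‖A‖ ‖F s‖` on the whole square.
  set K : ℝ → ℝ → ℝ := fun r s => if s < r then G r s else 0 with hK
  have hKint : Integrable (Function.uncurry K) (μ.prod μ) := by
    refine Integrable.mono' (((hFi.mono_measure hμle).const_mul ‖heatGen Δx c‖).comp_snd μ) ?_ ?_
    · have h1 : Function.uncurry K = {z : ℝ × ℝ | z.2 < z.1}.indicator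
          fun z => heatGen Δx c (heat Δx c (z.1 - z.2) (F z.2)) α := by
        ext z; simp [hK, hG, indicator, Function.uncurry]
      rw [h1]
      exact (aestronglyMeasurable_heatGen_heat Δx c (measurable_fst.sub measurable_snd)
        (fun η => ((hFm η).mono_measure hμle).comp_snd) α).indicator
          (measurableSet_lt measurable_snd measurable_fst)
    · refine Filter.Eventually.of_forall fun z => ?_
      by_cases h : z.2 < z.1
      · simp only [Function.uncurry, hK, if_pos h, hG]
        exact (abs_apply_le _ α).trans (((heatGen Δx c).le_opNorm _).trans
          (mul_le_mul_of_nonneg_left (norm_heat_le hc (sub_nonneg.2 h.le) _) (norm_nonneg _)))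
      · simp only [Function.uncurry, hK, if_neg h, norm_zero]
        positivity
  have hr : ∀ r ∈ Ioc 0 t, ∫ s, K r s ∂μ
      = ellipticOp Δx (fun α j => c j α) (response Δx c F r) α := fun r hr => by
    rw [ellipticOp_response hc hFm hFi ⟨hr.1.le, hr.2.trans ht.2⟩,
      intervalIntegral.integral_of_le hr.1.le,
      show K r = (Iio r).indicator (G r) from by ext s; simp [hK, indicator],
      hμ, setIntegral_indicator measurableSet_Iio, integral_Ioc_eq_integral_Ioo]
    congr 2
    ext s
    simp only [mem_inter_iff, mem_Ioc, mem_Iio, mem_Ioo]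
    exact ⟨fun h => ⟨h.1.1, h.2⟩, fun h => ⟨⟨h.1, h.2.le.trans hr.2⟩, h.2⟩⟩
  have hs : ∀ s ∈ Ioc 0 t, ∫ r, K r s ∂μ = heat Δx c (t - s) (F s) α - F s α := fun s hs => by
    rw [← integral_heatGen_heat, intervalIntegral.integral_of_le hs.2,
      show (fun r => K r s) = (Ioi s).indicator (fun r => G r s) from by
        ext r; simp [hK, indicator],
      hμ, setIntegral_indicator measurableSet_Ioi]
    congr 2
    ext r
    simp only [mem_inter_iff, mem_Ioc, mem_Ioi]
    exact ⟨fun h => ⟨h.2, h.1.2⟩, fun h => ⟨⟨hs.1.trans h.1, h.2⟩, h.1⟩⟩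
  have hFα : IntervalIntegrable (fun r => F r α) volume 0 t := by
    rw [intervalIntegrable_iff_integrableOn_Ioc_of_le ht.1]
    exact Integrable.mono' (hFi.mono_measure hμle) ((hFm α).mono_measure hμle)
      (Filter.Eventually.of_forall fun s => abs_apply_le _ α)
  have hE : IntervalIntegrable
      (fun r => ellipticOp Δx (fun α j => c j α) (response Δx c F r) α) volume 0 t := by
    rw [intervalIntegrable_iff_integrableOn_Ioc_of_le ht.1]
    exact hKint.integral_prod_left.congr
      ((ae_restrict_mem measurableSet_Ioc).mono fun r h => hr r h)
  refine ⟨hE.add hFα, ?_⟩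
  rw [intervalIntegral.integral_add hE hFα, ← sub_eq_iff_eq_add, response,
    ← intervalIntegral.integral_sub (intervalIntegrable_heat_sub hc hFm hFi ht α) hFα,
    intervalIntegral.integral_of_le ht.1, intervalIntegral.integral_of_le ht.1,
    ← setIntegral_congr_fun measurableSet_Ioc hs, ← setIntegral_congr_fun measurableSet_Ioc hr]
  exact (integral_integral_swap hKint).symm

end Duhamel


/-! ### Absolutely continuous solutions and their uniqueness -/

section Inhomogeneous

variable {Δx T : ℝ} {c : Fin d → BddGrid d}

lemma ellipticOp_add (Δx : ℝ) (c : Grid d → Fin d → ℝ) (u v : Grid d → ℝ) (α : Grid d) :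
    ellipticOp Δx c (fun β => u β + v β) α = ellipticOp Δx c u α + ellipticOp Δx c v α := by
  rw [ellipticOp, ellipticOp, ellipticOp, ← Finset.sum_add_distrib]
  refine Finset.sum_congr rfl fun j _ => ?_
  simp only [gradPlus, gradMinus]
  ring

lemma continuousOn_ellipticOp {s : Set ℝ} {w : ℝ → Grid d → ℝ} (Δx : ℝ) (c : Grid d → Fin d → ℝ)
    (hw : ∀ α, ContinuousOn (fun t => w t α) s) (α : Grid d) :
    ContinuousOn (fun t => ellipticOp Δx c (w t) α) s := by
  simp only [ellipticOp, gradPlus, gradMinus]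
  exact continuousOn_finsetSum _ fun j _ => continuousOn_const.mul
    (((((hw _).sub (hw _)).div_const _).sub (((hw _).sub (hw _)).div_const _)).div_const _)

/-- The integrated equation contains the differential one: indefinite integrals are absolutely
continuous and differentiable almost everywhere. -/
lemma isHeatSolution_of_eq_integral {c : Grid d → Fin d → ℝ} {f u : ℝ → Grid d → ℝ}
    {ψ : Grid d → ℝ} {M : ℝ} (hT : 0 ≤ T) (hM : ∀ t ∈ Icc 0 T, ∀ α, |u t α| ≤ M)
    (hi : ∀ α, IntervalIntegrable (fun t => ellipticOp Δx c (u t) α + f t α) volume 0 T)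
    (hu : ∀ t ∈ Icc 0 T, ∀ α,
      u t α = ψ α + ∫ r in (0 : ℝ)..t, (ellipticOp Δx c (u r) α + f r α)) :
    IsHeatSolution Δx T c f ψ u where
  bounded := ⟨M, hM⟩
  absolutelyContinuous α := by
    have h := (hi α).absolutelyContinuousOnInterval_intervalIntegral (left_mem_uIcc)
    rw [absolutelyContinuousOnInterval_iff] at h ⊢
    intro ε hε
    obtain ⟨δ, hδ, h⟩ := h ε hε
    refine ⟨δ, hδ, fun E hE hE' => (Finset.sum_congr rfl fun i hi => ?_).trans_lt (h E hE hE')⟩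
    have hm := hE.1 i hi
    rw [uIcc_of_le hT] at hm
    rw [hu _ hm.1, hu _ hm.2, dist_add_left]
  equation α := by
    rw [ae_restrict_iff' measurableSet_Ioo]
    filter_upwards [(hi α).ae_hasDerivAt_integral] with t ht htT
    rw [uIcc_of_le hT] at ht
    refine ((ht ⟨htT.1.le, htT.2.le⟩ 0 (left_mem_Icc.2 hT)).const_add (ψ α)).congr_of_eventuallyEq ?_
    filter_upwards [Icc_mem_nhds htT.1 htT.2] with s hs using hu s hs α
  initial α := by simpa using hu 0 (left_mem_Icc.2 hT) α

lemma IsHeatSolution.congr {c : Grid d → Fin d → ℝ} {f u v : ℝ → Grid d → ℝ}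
    {ψ : Grid d → ℝ} (hT : 0 ≤ T) (h : IsHeatSolution Δx T c f ψ u)
    (huv : ∀ t ∈ Icc 0 T, ∀ α, v t α = u t α) : IsHeatSolution Δx T c f ψ v where
  bounded := by
    obtain ⟨M, hM⟩ := h.bounded
    exact ⟨M, fun t ht α => by rw [huv t ht]; exact hM t ht α⟩
  absolutelyContinuous α := by
    have h := h.absolutelyContinuous α
    rw [absolutelyContinuousOnInterval_iff] at h ⊢
    intro ε hε
    obtain ⟨δ, hδ, h⟩ := h ε hε
    refine ⟨δ, hδ, fun E hE hE' => (Finset.sum_congr rfl fun i hi => ?_).trans_lt (h E hE hE')⟩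
    have hm := hE.1 i hi
    rw [uIcc_of_le hT] at hm
    rw [huv _ hm.1, huv _ hm.2]
  equation α := by
    filter_upwards [h.equation α, ae_restrict_mem measurableSet_Ioo] with t ht htT
    have e : v t = u t := funext fun β => huv t ⟨htT.1.le, htT.2.le⟩ β
    rw [e]
    refine ht.congr_of_eventuallyEq ?_
    filter_upwards [Icc_mem_nhds htT.1 htT.2] with s hs using huv s hs α
  initial α := by rw [huv 0 (left_mem_Icc.2 hT), h.initial]

/-- The rough source cancels in the difference. Absolute continuity turns the almost-everywhere
equation into an integral equation with continuous integrand, so the difference is a classical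
solution and vanishes. -/
lemma IsHeatSolution.unique {f u v : ℝ → Grid d → ℝ} {ψ : Grid d → ℝ} (hT : 0 ≤ T)
    (hu : IsHeatSolution Δx T (fun α j => c j α) f ψ u)
    (hv : IsHeatSolution Δx T (fun α j => c j α) f ψ v) :
    ∀ t ∈ Icc 0 T, ∀ α, v t α = u t α := by
  obtain ⟨M1, hM1⟩ := hu.bounded
  obtain ⟨M2, hM2⟩ := hv.bounded
  set w : ℝ → Grid d → ℝ := fun t α => v t α - u t α with hw
  have hac : ∀ α, AbsolutelyContinuousOnInterval (fun t => w t α) 0 T := fun α =>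
    (hv.absolutelyContinuous α).sub (hu.absolutelyContinuous α)
  have hcont : ∀ α, ContinuousOn (fun t => w t α) (Icc 0 T) := fun α => by
    simpa only [uIcc_of_le hT] using (hac α).continuousOn
  have hEcont : ∀ α, ContinuousOn (fun t => ellipticOp Δx (fun α j => c j α) (w t) α) (Icc 0 T) :=
    continuousOn_ellipticOp Δx _ hcont
  have h0 : ∀ α, w 0 α = 0 := fun α => by simp [hw, hu.initial, hv.initial]
  have hint : ∀ t ∈ Icc 0 T, ∀ α,
      w t α = ∫ r in (0 : ℝ)..t, ellipticOp Δx (fun α j => c j α) (w r) α := fun t ht α => by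
    have hac' := (hac α).mono (c := 0) (d := t) (by
      rw [uIcc_of_le hT, uIcc_of_le ht.1]; exact Icc_subset_Icc_right ht.2)
    rw [show w t α = w t α - w 0 α by rw [h0, sub_zero], ← hac'.integral_deriv_eq_sub,
      intervalIntegral.integral_of_le ht.1, intervalIntegral.integral_of_le ht.1,
      integral_Ioc_eq_integral_Ioo, integral_Ioc_eq_integral_Ioo]
    have hle : volume.restrict (Ioo (0 : ℝ) t) ≤ volume.restrict (Ioo (0 : ℝ) T) :=
      Measure.restrict_mono (Ioo_subset_Ioo_right ht.2) le_rfl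
    refine integral_congr_ae ?_
    filter_upwards [ae_mono hle (hu.equation α), ae_mono hle (hv.equation α)] with r h1 h2
    have h3 : HasDerivAt (fun s => w s α) _ r := h2.sub h1
    rw [h3.deriv, hw, ellipticOp_sub]
    ring
  have hz := eq_zero_of_homogeneous (Δx := Δx) (c := c) (w := w) (M := M2 + M1)
    (fun t ht α => (abs_sub _ _).trans (add_le_add (hM2 t ht α) (hM1 t ht α))) hcont h0
    fun t ht α => by
      have hmem := Icc_mem_nhds ht.1 ht.2
      have hFTC := intervalIntegral.integral_hasDerivAt_right
        (((hEcont α).mono (Icc_subset_Icc_right ht.2.le)).intervalIntegrable_of_Icc ht.1.le)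
        ((hEcont α).stronglyMeasurableAtFilter_nhdsWithin measurableSet_Icc t |>.filter_mono
          (by rw [nhdsWithin_eq_nhds.2 hmem]))
        ((hEcont α).continuousAt hmem)
      refine hFTC.congr_of_eventuallyEq ?_
      filter_upwards [hmem] with s hs using hint s hs α
  exact fun t ht α => sub_eq_zero.1 (hz t ht α)

variable {F : ℝ → BddGrid d}

lemma isHeatSolution_heat_add_response (hT : 0 ≤ T) (hc : ∀ j α, 0 ≤ c j α)
    (hFm : ∀ η, AEStronglyMeasurable (fun s => F s η) (volume.restrict (Icc 0 T)))
    (hFi : Integrable (fun s => ‖F s‖) (volume.restrict (Icc 0 T))) (ψ : BddGrid d) :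
    IsHeatSolution Δx T (fun α j => c j α) (fun t => F t) ψ
      (fun t α => heat Δx c t ψ α + response Δx c F t α) := by
  have hE : ∀ t α, ellipticOp Δx (fun α j => c j α)
      (fun β => heat Δx c t ψ β + response Δx c F t β) α + F t α
        = heatGen Δx c (heat Δx c t ψ) α
          + (ellipticOp Δx (fun α j => c j α) (response Δx c F t) α + F t α) := fun t α => by
    rw [ellipticOp_add, ← heatGen_eq_ellipticOp, add_assoc]
  have hcont : ∀ α, Continuous fun t => heatGen Δx c (heat Δx c t ψ) α := fun α =>
    (evalAt α).continuous.comp ((heatGen Δx c).continuous.comp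
      (continuous_evol_apply (heatGen Δx c) ψ))
  refine isHeatSolution_of_eq_integral (M := ‖ψ‖ + ∫ s in Icc 0 T, ‖F s‖) hT
    (fun t ht α => (abs_add_le _ _).trans (add_le_add
      ((abs_apply_le _ α).trans (norm_heat_le hc ht.1 ψ)) (abs_response_le hc hFi ht α)))
    (fun α => ?_) (fun t ht α => ?_)
  · simp only [hE]
    exact ((hcont α).intervalIntegrable _ _).add
      (response_eq_integral hc hFm hFi (right_mem_Icc.2 hT) α).1
  · obtain ⟨h1, h2⟩ := response_eq_integral (Δx := Δx) hc hFm hFi ht α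
    have h3 := integral_heatGen_heat Δx c ψ α 0 t
    simp only [sub_zero] at h3
    simp only [hE]
    rw [intervalIntegral.integral_add ((hcont α).intervalIntegrable _ _) h1, h3, ← h2]
    ring

lemma IsHeatSolution.congr_source {c : Grid d → Fin d → ℝ} {f g u : ℝ → Grid d → ℝ}
    {ψ : Grid d → ℝ} (h : IsHeatSolution Δx T c f ψ u)
    (hfg : ∀ᵐ t ∂(volume.restrict (Icc 0 T)), g t = f t) : IsHeatSolution Δx T c g ψ u where
  bounded := h.bounded
  absolutelyContinuous := h.absolutelyContinuous
  equation α := by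
    filter_upwards [h.equation α,
      ae_mono (Measure.restrict_mono Ioo_subset_Icc_self le_rfl) hfg] with t ht hg
    rwa [hg]
  initial := h.initial

variable {Γ : ℝ → lp (fun _ : Grid d × Grid d => ℝ) ∞} {f : ℝ → Grid d → ℝ}

lemma IsFundamentalSolution.hasSum (hΔ : 0 < Δx)
    (hΓ : IsFundamentalSolution Δx T (fun α j => c j α) Γ) {t : ℝ} (ht : t ∈ Icc 0 T)
    (g : BddGrid d) (α : Grid d) :
    HasSum (fun η => Γ t (α, η) * g η * Δx ^ d) (heat Δx c t g α) := by
  simp only [hΓ.mul_eq hΔ ht]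
  exact hasSum_heatRow Δx c t α g

lemma sub_mem_Icc_of_mem_Ioc {s t : ℝ} (ht : t ∈ Icc 0 T) (hs : s ∈ Ioc 0 t) :
    t - s ∈ Icc 0 T :=
  ⟨sub_nonneg.2 hs.2, (sub_le_self t hs.1.le).trans ht.2⟩

lemma duhamel_eq (hΔ : 0 < Δx) (hΓ : IsFundamentalSolution Δx T (fun α j => c j α) Γ)
    (hf : ∀ᵐ s ∂(volume.restrict (Icc 0 T)), f s = F s) (ψ : BddGrid d) {t : ℝ}
    (ht : t ∈ Icc 0 T) (α : Grid d) :
    duhamel Δx Γ f ψ t α = heat Δx c t ψ α + response Δx c F t α := by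
  rw [duhamel, (hΓ.hasSum hΔ ht ψ α).tsum_eq, response, intervalIntegral.integral_of_le ht.1,
    intervalIntegral.integral_of_le ht.1]
  congr 1
  refine integral_congr_ae ?_
  filter_upwards [ae_mono (restrict_Ioc_le ht) hf, ae_restrict_mem measurableSet_Ioc] with s hs hst
  rw [hs, (hΓ.hasSum hΔ (sub_mem_Icc_of_mem_Ioc ht hst) (F s) α).tsum_eq]

lemma duhamelConverges (hΔ : 0 < Δx) (hc : ∀ j α, 0 ≤ c j α)
    (hΓ : IsFundamentalSolution Δx T (fun α j => c j α) Γ)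
    (hFm : ∀ η, AEStronglyMeasurable (fun s => F s η) (volume.restrict (Icc 0 T)))
    (hFi : Integrable (fun s => ‖F s‖) (volume.restrict (Icc 0 T)))
    (hf : ∀ᵐ s ∂(volume.restrict (Icc 0 T)), f s = F s) (ψ : BddGrid d) {t : ℝ}
    (ht : t ∈ Icc 0 T) (α : Grid d) : DuhamelConverges Δx Γ f ψ t α where
  summable_initial := (hΓ.hasSum hΔ ht ψ α).summable
  summable_source := by
    filter_upwards [ae_mono (Measure.restrict_mono Ioo_subset_Ioc_self le_rfl)
      (ae_mono (restrict_Ioc_le ht) hf), ae_restrict_mem measurableSet_Ioo] with s hs hst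
    rw [hs]
    exact (hΓ.hasSum hΔ (sub_mem_Icc_of_mem_Ioc ht ⟨hst.1, hst.2.le⟩) (F s) α).summable
  integrable_source := by
    refine (intervalIntegrable_heat_sub (Δx := Δx) hc hFm hFi ht α).congr_ae ?_
    rw [uIoc_of_le ht.1]
    filter_upwards [ae_mono (restrict_Ioc_le ht) hf, ae_restrict_mem measurableSet_Ioc]
      with s hs hst
    rw [hs, (hΓ.hasSum hΔ (sub_mem_Icc_of_mem_Ioc ht hst) (F s) α).tsum_eq]

lemma one_le_of_one_div_add_lt {q r : ℝ≥0∞} (h : 1 / q + r < 1) : 1 ≤ q := by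
  have h1 : 1 / q < 1 := le_self_add.trans_lt h
  rw [one_div] at h1
  exact (ENNReal.inv_lt_one.1 h1).le

theorem exists_fundamentalSolution {cmin cmax L : ℝ} {c : Grid d → Fin d → ℝ} (hΔ : 0 < Δx)
    (hcmin : 0 < cmin) (hc : IsCoefficient Δx cmin cmax L c) (T : ℝ) :
    ∃ Γ, IsFundamentalSolution Δx T c Γ := by
  obtain ⟨cb, rfl, -⟩ := hc.exists_coe hΔ hcmin
  exact ⟨_, isFundamentalSolution_kernel Δx T cb⟩

theorem IsFundamentalSolution.isHeatSolution_iff {cmin cmax L : ℝ} {c : Grid d → Fin d → ℝ}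
    (hΔ : 0 < Δx) (hT : 0 < T) (hcmin : 0 < cmin) (hc : IsCoefficient Δx cmin cmax L c)
    (hΓ : IsFundamentalSolution Δx T c Γ) {p q : ℝ≥0∞} (hp : p ≠ 0) (hq : 1 ≤ q)
    {ψ : Grid d → ℝ} (hf : MemLqLpGrid Δx T q p f) (hψ : MemLpGrid Δx ∞ ψ) :
    (∀ t ∈ Icc 0 T, ∀ α, DuhamelConverges Δx Γ f ψ t α) ∧
      ∀ u : ℝ → Grid d → ℝ, IsHeatSolution Δx T c f ψ u ↔
        ∀ t ∈ Icc 0 T, ∀ α, u t α = duhamel Δx Γ f ψ t α := by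
  obtain ⟨cb, rfl, hlow, -⟩ := hc.exists_coe hΔ hcmin
  obtain ⟨ψ, rfl⟩ := hψ.exists_coe hΔ
  obtain ⟨F, hfF, hFm, hFi⟩ := hf.exists_bounded hΔ hp hq
  have hc0 : ∀ j α, 0 ≤ cb j α := fun j α => hcmin.le.trans (hlow j α)
  refine ⟨fun t ht α => duhamelConverges hΔ hc0 hΓ hFm hFi hfF ψ ht α, fun u => ?_⟩
  have hsol := (isHeatSolution_heat_add_response (Δx := Δx) hT.le hc0 hFm hFi ψ).congr_source hfF
  constructor
  · intro hu t ht α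
    rw [duhamel_eq hΔ hΓ hfF ψ ht]
    exact hsol.unique hT.le hu t ht α
  · intro hu
    exact hsol.congr hT.le fun t ht α => by rw [hu t ht, duhamel_eq hΔ hΓ hfF ψ ht]

end Inhomogeneous


/-! ### Well-posedness and uniform bounds for the Cauchy problem -/

section Potential

variable {Δx cmin cmax L : ℝ} {c : Grid d → Fin d → ℝ} {p : ℝ≥0∞} {Y f ψ : Grid d → ℝ}

lemma MemLpAddLinfty.exists_coe (hΔ : 0 < Δx) (h : MemLpAddLinfty Δx p f) :
    ∃ g : BddGrid d, f = g := by
  obtain ⟨g, k, hg, hk, rfl⟩ := h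
  obtain ⟨g, rfl⟩ := hg.exists_coe hΔ
  obtain ⟨k, rfl⟩ := hk.exists_coe hΔ
  exact ⟨g + k, rfl⟩

/-- The infimum runs over arbitrary splittings, but finiteness of the norm bounds `k`, and then `g =
f - k` is bounded because `f` is. -/
lemma exists_splitting_of_sumNorm_lt (hΔ : 0 < Δx) (hf : MemLpAddLinfty Δx p f) {M : ℝ}
    (hM : 0 ≤ M) (h : sumNorm Δx p f < ENNReal.ofReal M) :
    ∃ g k : BddGrid d, f = ⇑(g + k) ∧ eLpNorm g p (gridMeasure d Δx) ≤ ENNReal.ofReal M ∧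
      ‖k‖ ≤ M := by
  obtain ⟨F, rfl⟩ := hf.exists_coe hΔ
  simp only [sumNorm, iInf_lt_iff] at h
  obtain ⟨g, k, hgk, hlt⟩ := h
  have hk : eLpNorm k ∞ (gridMeasure d Δx) < ENNReal.ofReal M := le_add_self.trans_lt hlt
  obtain ⟨k, rfl⟩ := exists_coe_eq hΔ (hk.trans_le le_top)
  have hg : g = ⇑(F - k) := by
    ext α
    have := congrFun hgk α
    simp only [Pi.add_apply] at this
    simp [this]
  subst hg
  refine ⟨F - k, k, by rw [sub_add_cancel], (le_self_add.trans_lt hlt).le, ?_⟩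
  rw [eLpNorm_top_coe hΔ] at hk
  exact (ENNReal.ofReal_le_ofReal_iff hM).1 hk.le

lemma norm_diffMinus_le (Δx : ℝ) (j : Fin d) (g : BddGrid d) :
    ‖diffMinus Δx j g‖ ≤ ‖diffPlus Δx j g‖ := by
  refine norm_le_of_abs_le fun α => ?_
  have h := abs_apply_le (diffPlus Δx j g) (α - unitVec j)
  rwa [diffPlus_apply, sub_add_cancel, ← diffMinus_apply] at h

theorem exists_isCauchySolution (hΔ : 0 < Δx) (hcmin : 0 < cmin)
    (hc : IsCoefficient Δx cmin cmax L c) (hY : MemLpGrid Δx p Y) (hf : MemLpAddLinfty Δx p f)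
    (hψ : MemLpGrid Δx ∞ ψ) :
    ∃ u, IsCauchySolution Δx c Y f ψ u ∧
      (∀ v, IsCauchySolution Δx c Y f ψ v → ∀ t, 0 ≤ t → ∀ α, v t α = u t α) ∧
      ((∀ α, 0 ≤ f α) → (∀ α, 0 ≤ ψ α) → ∀ t, 0 ≤ t → ∀ α, 0 ≤ u t α) := by
  obtain ⟨c, rfl, hlow, -⟩ := hc.exists_coe hΔ hcmin
  obtain ⟨Y, rfl⟩ := hY.exists_coe hΔ
  obtain ⟨f, rfl⟩ := hf.exists_coe hΔ
  obtain ⟨ψ, rfl⟩ := hψ.exists_coe hΔ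
  exact ⟨_, isCauchySolution_cauchySol, fun v hv t ht α => isCauchySolution_cauchySol.unique hv ht α,
    fun hf hψ t ht α => cauchySol_nonneg (fun j α => hcmin.le.trans (hlow j α)) hf hψ ht α⟩

theorem exists_isCauchySolution_bound (hd : 1 ≤ d) (hp : (d : ℝ≥0∞) < p) {T : ℝ}
    (cmax L : ℝ) (MY Mf : ℝ≥0) (hT : 0 < T) (hcmin : 0 < cmin) :
    ∃ C : ℝ≥0, ∀ (Δx : ℝ) (c : Grid d → Fin d → ℝ) (Y f ψ : Grid d → ℝ) (u : ℝ → Grid d → ℝ),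
      0 < Δx → IsCoefficient Δx cmin cmax L c → MemLpGrid Δx p Y →
      eLpNorm Y p (gridMeasure d Δx) ≤ MY → MemLpAddLinfty Δx p f → sumNorm Δx p f ≤ Mf →
      MemLpGrid Δx ∞ ψ → IsCauchySolution Δx c Y f ψ u → ∀ t ∈ Icc 0 T,
        eLpNorm (u t) ∞ (gridMeasure d Δx) ≤ C * (1 + eLpNorm ψ ∞ (gridMeasure d Δx)) ∧
        ∀ j,
          eLpNorm (gradPlus Δx j (u t)) ∞ (gridMeasure d Δx)
            ≤ C * (1 + eLpNorm ψ ∞ (gridMeasure d Δx)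
              + ⨆ k, eLpNorm (gradPlus Δx k (gradMinus Δx k ψ)) ∞ (gridMeasure d Δx)) ∧
          eLpNorm (gradMinus Δx j (u t)) ∞ (gridMeasure d Δx)
            ≤ C * (1 + eLpNorm ψ ∞ (gridMeasure d Δx)
              + ⨆ k, eLpNorm (gradPlus Δx k (gradMinus Δx k ψ)) ∞ (gridMeasure d Δx)) := by
  -- The `+ 1` makes the inequality for the infimum strict, so that a splitting can be chosen
  -- without knowing that the infimum is attained.
  obtain ⟨C, hC, hbound⟩ := exists_cauchySol_bound hd hcmin cmax L hT hp MY.coe_nonneg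
    (Mf := Mf + 1) (by positivity)
  refine ⟨C.toNNReal, fun Δx c Y f ψ u hΔ hc hY hYM hf hfM hψ hu t ht => ?_⟩
  obtain ⟨c, rfl, hlow, hup, hlip⟩ := hc.exists_coe hΔ hcmin
  obtain ⟨Y, rfl⟩ := hY.exists_coe hΔ
  obtain ⟨ψ, rfl⟩ := hψ.exists_coe hΔ
  obtain ⟨g, k, rfl, hg, hk⟩ := exists_splitting_of_sumNorm_lt hΔ hf (M := Mf + 1) (by positivity)
    (hfM.trans_lt (by
      rw [← ENNReal.ofReal_coe_nnreal]
      exact (ENNReal.ofReal_lt_ofReal_iff (by positivity)).2 (lt_add_one _)))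
  obtain ⟨h1, h2⟩ := hbound Δx c hΔ hlow hup hlip Y g k ψ (by simpa using hYM) hg hk t ht
  have hut : u t = cauchySol Δx c Y (g + k) ψ t :=
    funext fun α => isCauchySolution_cauchySol.unique hu ht.1 α
  set U := cauchySol Δx c Y (g + k) ψ t with hU
  have hCeq : ((C.toNNReal : ℝ≥0) : ℝ≥0∞) = ENNReal.ofReal C := rfl
  simp only [hut, gradMinus_coe, gradPlus_coe, eLpNorm_top_coe hΔ, hCeq]
  have hS : (⨆ k, ENNReal.ofReal ‖diffPlus Δx k (diffMinus Δx k ψ)‖) ≠ ∞ :=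
    ((iSup_le fun k => ENNReal.ofReal_le_ofReal (Finset.single_le_sum
      (f := fun k => ‖diffPlus Δx k (diffMinus Δx k ψ)‖) (fun _ _ => norm_nonneg _)
      (Finset.mem_univ k))).trans_lt ENNReal.ofReal_lt_top).ne
  set H := (⨆ k, ENNReal.ofReal ‖diffPlus Δx k (diffMinus Δx k ψ)‖).toReal with hH
  have hHle : ∀ k, ‖diffPlus Δx k (diffMinus Δx k ψ)‖ ≤ H := fun k => by
    rw [hH, ← ENNReal.ofReal_le_iff_le_toReal hS]
    exact le_iSup (fun k => ENNReal.ofReal ‖diffPlus Δx k (diffMinus Δx k ψ)‖) k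
  have hgrad : ∀ j, ENNReal.ofReal ‖diffPlus Δx j U‖ ≤ ENNReal.ofReal C * (1 + ENNReal.ofReal ‖ψ‖
      + ⨆ k, ENNReal.ofReal ‖diffPlus Δx k (diffMinus Δx k ψ)‖) := fun j => by
    rw [← ENNReal.ofReal_toReal hS, ← hH, ← ENNReal.ofReal_one,
      ← ENNReal.ofReal_add zero_le_one (norm_nonneg _),
      ← ENNReal.ofReal_add (by positivity) ENNReal.toReal_nonneg, ← ENNReal.ofReal_mul hC]
    exact ENNReal.ofReal_le_ofReal (h2 j H hHle)
  refine ⟨?_, fun j => ⟨hgrad j,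
    (ENNReal.ofReal_le_ofReal (norm_diffMinus_le Δx j U)).trans (hgrad j)⟩⟩
  rw [← ENNReal.ofReal_one, ← ENNReal.ofReal_add zero_le_one (norm_nonneg _),
    ← ENNReal.ofReal_mul hC]
  exact ENNReal.ofReal_le_ofReal h1

end Potential

end SemiDiscrete

/-! ### The main theorem -/

theorem mainTheorem9 (d : ℕ) (hd : 1 ≤ d) :
    -- existence of the fundamental solution, and the Duhamel formula
    (∀ (Δx T cmin cmax L : ℝ) (c : Grid d → Fin d → ℝ), 0 < Δx → 0 < T → 0 < cmin →
      IsCoefficient Δx cmin cmax L c →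
      (∃ Γ, IsFundamentalSolution Δx T c Γ) ∧
      ∀ Γ, IsFundamentalSolution Δx T c Γ →
      ∀ p q : ℝ≥0∞, (d : ℝ≥0∞) < p → 1 / q + (d : ℝ≥0∞) / (2 * p) < 1 →
      ∀ (f : ℝ → Grid d → ℝ) (ψ : Grid d → ℝ),
        MemLqLpGrid Δx T q p f → MemLpGrid Δx ∞ ψ →
        (∀ t ∈ Icc 0 T, ∀ α, DuhamelConverges Δx Γ f ψ t α) ∧
        ∀ u : ℝ → Grid d → ℝ, IsHeatSolution Δx T c f ψ u ↔
          ∀ t ∈ Icc 0 T, ∀ α, u t α = duhamel Δx Γ f ψ t α) ∧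
    -- the Cauchy problem with a potential: existence, uniqueness, non-negativity
    (∀ p : ℝ≥0∞, (d : ℝ≥0∞) < p →
      (∀ (Δx cmin cmax L : ℝ) (c : Grid d → Fin d → ℝ) (Y f ψ : Grid d → ℝ),
        0 < Δx → 0 < cmin → IsCoefficient Δx cmin cmax L c →
        MemLpGrid Δx p Y → MemLpAddLinfty Δx p f →
        MemLpGrid Δx ∞ ψ →
        (∀ j, MemLpGrid Δx ∞
          (gradPlus Δx j (gradMinus Δx j ψ))) →
        ∃ u, IsCauchySolution Δx c Y f ψ u ∧
          (∀ v, IsCauchySolution Δx c Y f ψ v →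
            ∀ t, 0 ≤ t → ∀ α, v t α = u t α) ∧
          ((∀ α, 0 ≤ f α) → (∀ α, 0 ≤ ψ α) → ∀ t, 0 ≤ t → ∀ α, 0 ≤ u t α)) ∧
      -- bounds that are uniform in the grid size
      ∀ (T cmin cmax L : ℝ) (MY Mf : ℝ≥0), 0 < T → 0 < cmin →
        ∃ C : ℝ≥0, ∀ (Δx : ℝ) (c : Grid d → Fin d → ℝ) (Y f ψ : Grid d → ℝ)
          (u : ℝ → Grid d → ℝ),
          0 < Δx → IsCoefficient Δx cmin cmax L c →
          MemLpGrid Δx p Y →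
          eLpNorm Y p (gridMeasure d Δx) ≤ MY →
          MemLpAddLinfty Δx p f → sumNorm Δx p f ≤ Mf →
          MemLpGrid Δx ∞ ψ →
          (∀ j, MemLpGrid Δx ∞
            (gradPlus Δx j (gradMinus Δx j ψ))) →
          IsCauchySolution Δx c Y f ψ u →
          ∀ t ∈ Icc 0 T,
            eLpNorm (u t) ∞ (gridMeasure d Δx)
                ≤ C * (1 + eLpNorm ψ ∞ (gridMeasure d Δx)) ∧
              ∀ j,
                eLpNorm (gradPlus Δx j (u t)) ∞ (gridMeasure d Δx)
                    ≤ C * (1 + eLpNorm ψ ∞ (gridMeasure d Δx)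
                      + ⨆ k, eLpNorm (gradPlus Δx k (gradMinus Δx k ψ)) ∞
                          (gridMeasure d Δx)) ∧
                eLpNorm (gradMinus Δx j (u t)) ∞ (gridMeasure d Δx)
                    ≤ C * (1 + eLpNorm ψ ∞ (gridMeasure d Δx)
                      + ⨆ k, eLpNorm (gradPlus Δx k (gradMinus Δx k ψ)) ∞
                          (gridMeasure d Δx))) := by
  refine ⟨fun Δx T cmin cmax L c hΔ hT hcmin hc => ⟨exists_fundamentalSolution hΔ hcmin hc T,
    fun Γ hΓ p q hp hpq f ψ hf hψ =>
      hΓ.isHeatSolution_iff hΔ hT hcmin hc (ne_bot_of_gt hp) (one_le_of_one_div_add_lt hpq) hf hψ⟩,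
    fun p hp => ⟨fun Δx cmin cmax L c Y f ψ hΔ hcmin hc hY hf hψ _ =>
      exists_isCauchySolution hΔ hcmin hc hY hf hψ,
    fun T cmin cmax L MY Mf hT hcmin => ?_⟩⟩
  obtain ⟨C, hC⟩ := exists_isCauchySolution_bound hd hp cmax L MY Mf hT hcmin
  exact ⟨C, fun Δx c Y f ψ u hΔ hc hY hYM hf hfM hψ _ hu =>
    hC Δx c Y f ψ u hΔ hc hY hYM hf hfM hψ hu⟩
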